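/- \textbf{Setting.} Let $d\ge 1$ and let $S$ be a stationary point process on $\mathbb R^d$ (a random locally finite subset) with intensity $1$, and let $S^\circ$ have the law of its Palm version, i.e. $\mathbb P(S^\circ\in A)=\mathbb E\,\#\{x\in S\cap[0,1)^d: S-x\in A\}$. For a configuration $\mathbf s$ let ${\rm Vor}(s)$ be the closed Voronoi cell of $s\in\mathbf s$; two distinct points $s,s'\in\mathbf s$ are neighbors, $a(s,s',\mathbf s)=1$, if ${\rm Vor}(s)\cap{\rm Vor}(s')$ has dimension $d-1$, and $a(s,s',\mathbf s)=0$ otherwise. Assume that the number $a(0,S^\circ)$ of neighbors of the origin satisfies $\mathbb E\, e^{\beta a(0,S^\circ)}<\infty$ for some $\beta>0$. Put $\tau_x\mathbf s=\mathbf s-x$. For a height function $f$ on $\mathbf s$ put $\nabla f(s,s')=a(s,s',\mathbf s)\,(f(s')-f(s))$. Let $\gamma$ be a measurable surface (a real-valued function $\gamma(s,\mathbf s)$ of a configuration and a point of it) with covariant gradient: $\nabla\gamma(s'-s,s''-s,\tau_s\mathbf s)=\nabla\gamma(s',s'',\mathbf s)$ for all $\mathbf s$ and $s,s',s''\in\mathbf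 s$. For nonnegative (random) fields $\zeta$ write $\mathcal C(\zeta)=\frac12\,\mathbb E\sum_{s\in S^\circ}a(0,s,S^\circ)\,\zeta(0,s,S^\circ)$. \textbf{Harness process.} Enumerate the points of $S^\circ$ measurably as $(s_n)$ and let $(T_n)$ be independent rate-one Poisson processes on $\mathbb R$, independent of $S^\circ$; the epochs of $T_n$ are attached to $s_n$. Given $(S^\circ,T)$, the backward walk started at $s$ at time $t$ moves backwards in time down to time $0$ and, at each epoch of the point where it sits, jumps to a uniformly chosen neighbor of that point. Let $p_t(s,s')$ be the conditional probability given $(S^\circ,T)$ that it is at $s'$ at time $0$. The harness process with initial surface $\gamma$ is $\eta_t(s)=\sum_{s'\in S^\circ}p_t(s,s')\,\gamma(s',S^\circ)$. Let $\psi_t=\eta_t-\gamma$. \textbf{Lemma.} Let $r\ge 1$ and $t\ge 0$. If $\mathcal C(|\nabla\gamma|^r)<\infty$, then almost surely the series defining $\eta_t(s)$ converges absolutely for every $s\in S^\circ$ and $\psi_t$ is translation invariant, i.e. $\psi_t(s,(S^\circ,T))=\psi_t(0,\tau_s(S^\circ,T))$ for every $s\in S^\circ$, where $\tau_s$ translates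 the points together with their attached epochs. Moreover $$\mathcal C(|\nabla\psi_t|^r)\;\le\;2^r\,\mathcal C(|\nabla\gamma|^r)\,m^r(t)\;<\;\infty ,$$ where $m^r(t)$ is the $r$-th moment of a Poisson random variable with mean $t$. -/

import Mathlib

open MeasureTheory ProbabilityTheory Set
open scoped ENNReal NNReal

noncomputable section

namespace Harness

/-! ### Locally finite configurations -/

/-- Locally finite subsets of `X`. -/
def Config (X : Type*) [PseudoMetricSpace X] : Type _ :=
  {s : Set X // ∀ B : Set X, Bornology.IsBounded B → (s ∩ B).Finite}

/-- The number of points of the configuration `c` in the (bounded) set `B`. -/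
def count {X : Type*} [PseudoMetricSpace X] (B : Set X) (c : Config X) : ℕ :=
  (c.1 ∩ B).ncard

/-- The σ-algebra generated by the events that a bounded Borel set contains `k` points. -/
instance instMeasurableSpaceConfig (X : Type*) [PseudoMetricSpace X] [MeasurableSpace X] :
    MeasurableSpace (Config X) :=
  MeasurableSpace.generateFrom
    {A | ∃ (B : Set X) (k : ℕ), MeasurableSet B ∧ Bornology.IsBounded B ∧
      A = {c : Config X | count B c = k}}

/-- The Euclidean space of dimension `d`. -/
abbrev Space (d : ℕ) : Type := EuclideanSpace ℝ (Fin d)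

/-- The translate `{y - x : y ∈ c}` of the configuration `c`. -/
def shift {d : ℕ} (x : Space d) (c : Config (Space d)) : Config (Space d) :=
  ⟨{y | y + x ∈ c.1}, by
    intro B hB
    have h1 : Bornology.IsBounded ((fun y : Space d => y + x) '' B) := by
      rw [Metric.isBounded_iff] at hB ⊢
      obtain ⟨C, hC⟩ := hB
      refine ⟨C, ?_⟩
      rintro _ ⟨y, hy, rfl⟩ _ ⟨z, hz, rfl⟩
      simpa using hC hy hz
    refine Set.Finite.of_finite_image ((c.2 _ h1).subset ?_)
      (add_left_injective x).injOn
    rintro _ ⟨y, ⟨hy, hyB⟩, rfl⟩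
    exact ⟨hy, y, hyB, rfl⟩⟩

/-! ### Stationarity, intensity and the Palm version -/

/-- The half-open unit cube. -/
def unitCube (d : ℕ) : Set (Space d) := {x | ∀ i, x i ∈ Set.Ico (0 : ℝ) 1}

/-- The law `P` of a point process is invariant under translations. -/
def IsStationary {d : ℕ} (P : Measure (Config (Space d))) : Prop :=
  ∀ x : Space d, P.map (shift x) = P

/-- The mean number of points in a cube of volume one is one. -/
def HasUnitIntensity {d : ℕ} (P : Measure (Config (Space d))) : Prop :=
  ∫⁻ c, (count (unitCube d) c : ℝ≥0∞) ∂P = 1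

/-- `Q` is the Palm distribution of the stationary law `P` of intensity one: `Q A` is the mean
number of the points `x` of the process in the unit cube such that the configuration
seen from `x` is in `A`. -/
def IsPalm {d : ℕ} (P Q : Measure (Config (Space d))) : Prop :=
  ∀ A : Set (Config (Space d)), MeasurableSet A →
    Q A = ∫⁻ c, (({x ∈ c.1 | x ∈ unitCube d ∧ shift x c ∈ A}.encard : ℕ∞) : ℝ≥0∞) ∂P

/-! ### The Voronoi graph, surfaces and gradients -/

/-- The (closed) Voronoi cell of `x` in the configuration `c`. -/
def voronoi {d : ℕ} (c : Config (Space d)) (x : Space d) : Set (Space d) :=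
  {z | ∀ y ∈ c.1, dist z x ≤ dist z y}

/-- Voronoi neighbors: two distinct points of `c` such that the intersection of their cells,
which is a convex set, has dimension `d - 1`. -/
def Neighbor {d : ℕ} (c : Config (Space d)) (x y : Space d) : Prop :=
  x ∈ c.1 ∧ y ∈ c.1 ∧ x ≠ y ∧ (voronoi c x ∩ voronoi c y).Nonempty ∧
    Module.finrank ℝ (vectorSpan ℝ (voronoi c x ∩ voronoi c y)) + 1 = d

/-- The set of neighbors of `x`. -/
def nbrs {d : ℕ} (c : Config (Space d)) (x : Space d) : Set (Space d) := {y | Neighbor c x y}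

open Classical in
/-- The conductances. -/
def cond {d : ℕ} (c : Config (Space d)) (x y : Space d) : ℝ := if Neighbor c x y then 1 else 0

/-- The gradient, on the graph of `c`, of the heights `f`. -/
def grad {d : ℕ} (c : Config (Space d)) (f : Space d → ℝ) (x y : Space d) : ℝ :=
  cond c x y * (f y - f x)

/-- The surface `γ` (height `γ x c` at the point `x` of `c`) has a covariant gradient. -/
def HasCovariantGradient {d : ℕ} (γ : Space d → Config (Space d) → ℝ) : Prop :=
  ∀ c : Config (Space d), ∀ x ∈ c.1, ∀ y ∈ c.1, ∀ z ∈ c.1,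
    grad (shift x c) (fun w => γ w (shift x c)) (y - x) (z - x) = grad c (fun w => γ w c) y z

/-- Half of the mean of the sum of `ζ (0, y)` over the neighbors `y` of the origin, for a
nonnegative random field `ζ` on the random configuration `S₀`. -/
def campbell {d : ℕ} {Ω : Type*} [MeasurableSpace Ω] (μ : Measure Ω)
    (S₀ : Ω → Config (Space d)) (ζ : Ω → Space d → Space d → ℝ≥0∞) : ℝ≥0∞ :=
  2⁻¹ * ∫⁻ ω, ∑' y : (S₀ ω).1, ENNReal.ofReal (cond (S₀ ω) 0 y) * ζ ω 0 y ∂μ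

/-- The number of neighbors of the origin is finite with a finite exponential moment. -/
def HasExpMomentDegree {d : ℕ} {Ω : Type*} [MeasurableSpace Ω] (μ : Measure Ω)
    (S₀ : Ω → Config (Space d)) : Prop :=
  (∀ᵐ ω ∂μ, (nbrs (S₀ ω) 0).Finite) ∧
    ∃ β : ℝ, 0 < β ∧ ∫⁻ ω, ENNReal.ofReal (Real.exp (β * (nbrs (S₀ ω) 0).ncard)) ∂μ < ⊤

/-! ### Poisson processes and the graphical construction -/

/-- `T` is a homogeneous Poisson process on the line with intensity one. -/
def IsPoissonProcess {Ω : Type*} [MeasurableSpace Ω] (μ : Measure Ω) (T : Ω → Config ℝ) : Prop :=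
  (∀ A : Set ℝ, MeasurableSet A → Bornology.IsBounded A →
    μ.map (fun ω => count A (T ω)) = poissonMeasure (volume A).toNNReal) ∧
  ∀ (k : ℕ) (A : Fin k → Set ℝ), (∀ i, MeasurableSet (A i)) →
    (∀ i, Bornology.IsBounded (A i)) → Pairwise (fun i j => Disjoint (A i) (A j)) →
    iIndepFun (fun i ω => count (A i) (T ω)) μ

/-- The epochs attached to each site when the `n`-th point `e n c` of `c` carries the epochs
`T n`. -/
def epochs {d : ℕ} (e : ℕ → Config (Space d) → Space d) (c : Config (Space d))
    (T : ℕ → Config ℝ) (x : Space d) : Set ℝ :=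
  {τ | ∃ n, e n c = x ∧ τ ∈ (T n).1}

open Classical in
/-- The backward walk on `c` with epochs `m`, given `c` and `m`. From the point `x`, with the
times in `I` still to be explored backwards, it jumps at the last epoch of `x` in `I` to a
uniformly chosen neighbor of `x`, and goes on from there with the positive times before that
epoch; it stops when its current point has no epoch left. `walkLaw c m n x I y` is the
probability that it makes at most `n` jumps and stops at `y`. -/
def walkLaw {d : ℕ} (c : Config (Space d)) (m : Space d → Set ℝ) :
    ℕ → Space d → Set ℝ → Space d → ℝ≥0∞
  | 0, x, I, y => if m x ∩ I = ∅ ∧ x = y then 1 else 0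
  | n + 1, x, I, y =>
    if m x ∩ I = ∅ then (if x = y then 1 else 0)
    else ((nbrs c x).encard : ℝ≥0∞)⁻¹ *
      ∑' z : nbrs c x, walkLaw c m n z (Set.Ioo 0 (sSup (m x ∩ I))) y

/-- The probability, given `c` and `m`, that the backward walk started at `x` at time `t`
is at `y` at time `0`. -/
def transProb {d : ℕ} (c : Config (Space d)) (m : Space d → Set ℝ) (t : ℝ)
    (x y : Space d) : ℝ≥0∞ :=
  ⨆ n, walkLaw c m n x (Set.Ioc 0 t) y

/-- The height at time `t` and at the point `x` of the harness process with initial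
surface `γ`. -/
def harness {d : ℕ} (γ : Space d → Config (Space d) → ℝ) (c : Config (Space d))
    (m : Space d → Set ℝ) (t : ℝ) (x : Space d) : ℝ :=
  ∑' y : c.1, (transProb c m t x y).toReal * γ y c

/-- The difference of the harness process at time `t` and its initial surface. -/
def psi {d : ℕ} (γ : Space d → Config (Space d) → ℝ) (c : Config (Space d))
    (m : Space d → Set ℝ) (t : ℝ) (x : Space d) : ℝ :=
  harness γ c m t x - γ x c

/-- The moment of order `r` of a Poisson random variable with mean `t`. -/
def poissonMoment (r : ℝ) (t : ℝ≥0) : ℝ≥0∞ :=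
  ∫⁻ n, (n : ℝ≥0∞) ^ r ∂(poissonMeasure t)

end Harness

end

/-! The height `η_t(s)` is the mean of `γ` at the endpoint of the backward walk, so `ψ_t(s)` is the
mean of the sum of the gradients of `γ` along its path. Thus `ψ_t` sees `γ` only through its
gradient, which is covariant; this gives the translation invariance (`psi_shift`). For the moments,
Jensen's inequality over the paths and the power mean inequality along a path with `n` jumps bound
`|ψ_t(s)|^r` by the mean of `n^(r-1)` times the sum of the `r`-th powers of the slopes met by the
walk (`psi_enorm_rpow_le`).

Next, average over the epochs with the configuration fixed. A path with `n` jumps between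
successively distinct sites agrees with the clocks with probability `e^{-t} t^n / n!`, whatever
sites it visits or revisits (`measure_follows`): after a jump the walk reads only earlier times,
which are still unexplored. So the number of jumps is Poisson and independent of the trajectory of a
simple random walk. In particular almost no mass is lost in infinitely many jumps
(`ae_tsum_pathProb_eq_one`).

Finally, average over the configuration. By the mass transport principle (`massTransport`), the Palm
measure biased by the degree is invariant for the environment seen from the walk
(`lintegral_tsum_nbrs`). Each of the `n` steps therefore has degree-weighted mean energy at most `2
C(|∇γ|^r)`, and `n * n^(r-1)` averages to `m^r(t)` (`lintegral_degree_mul_poissonEnergy_le`). A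
gradient of `ψ_t` is controlled by its values at the two ends of an edge, with constant `2^(r-1)`,
and mass transport gives the two ends equal bounds. Because the epochs are averaged out first, mass
transport is needed only for configurations, not for configurations marked with epochs. -/

namespace Harness

/-! ### Measurability of sums over the points of a configuration. -/

section Config

variable {X : Type*} [MetricSpace X] [MeasurableSpace X] [BorelSpace X]

lemma measurable_count {B : Set X} (hB : MeasurableSet B) (hb : Bornology.IsBounded B) :
    Measurable (count B : Config X → ℕ) :=
  measurable_to_countable' fun k =>
    MeasurableSpace.measurableSet_generateFrom ⟨B, k, hB, hb, rfl⟩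

/-- The counting measure of a configuration. -/
noncomputable def pts (c : Config X) : Measure X := Measure.sum fun x : c.1 => Measure.dirac (x : X)

lemma lintegral_pts (c : Config X) (f : X → ℝ≥0∞) : ∫⁻ x, f x ∂(pts c) = ∑' x : c.1, f x := by
  rw [pts, lintegral_sum_measure]
  simp

lemma pts_apply (c : Config X) {B : Set X} (hB : MeasurableSet B) :
    pts c B = ((c.1 ∩ B).encard : ℝ≥0∞) := by
  classical
  rw [← lintegral_indicator_one hB, lintegral_pts, tsum_subtype c.1 (B.indicator 1),
    indicator_indicator, ← tsum_subtype (c.1 ∩ B) (1 : X → ℝ≥0∞)]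
  simp

lemma pts_eq_count (c : Config X) {B : Set X} (hB : MeasurableSet B)
    (hb : Bornology.IsBounded B) : pts c B = count B c := by
  rw [pts_apply c hB, count, ← (c.2 B hb).cast_ncard_eq]
  simp

/-- The σ-algebra on configurations speaks of bounded sets only; the general case is the increasing
limit over `B ∩ closedBall o n`. -/
lemma measurable_pts : Measurable (pts : Config X → Measure X) := by
  refine Measure.measurable_of_measurable_coe _ fun B hB => ?_
  rcases isEmpty_or_nonempty X with hX | ⟨⟨o⟩⟩
  · have : B = ∅ := Subsingleton.elim _ _
    simp [this]
  have h : ∀ c : Config X, pts c B = ⨆ n : ℕ, pts c (B ∩ Metric.closedBall o n) := by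
    intro c
    rw [← Directed.measure_iUnion, ← inter_iUnion, Metric.iUnion_closedBall_nat, inter_univ]
    exact directed_of_isDirected_le fun m n hmn =>
      inter_subset_inter_right _ (Metric.closedBall_subset_closedBall (by exact_mod_cast hmn))
  simp_rw [h]
  refine Measurable.iSup fun n => ?_
  have hb : Bornology.IsBounded (B ∩ Metric.closedBall o (n : ℝ)) :=
    Metric.isBounded_closedBall.subset inter_subset_right
  have hm : MeasurableSet (B ∩ Metric.closedBall o (n : ℝ)) :=
    hB.inter Metric.isClosed_closedBall.measurableSet
  simp_rw [pts_eq_count _ hm hb]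
  exact measurable_from_top.comp (measurable_count hm hb)

/-- The counting measure of a configuration, as a kernel. -/
noncomputable def ptsKernel (X : Type*) [MetricSpace X] [MeasurableSpace X] [BorelSpace X] :
    Kernel (Config X) X := ⟨pts, measurable_pts⟩

lemma ptsKernel_apply (c : Config X) : ptsKernel X c = pts c := rfl

/-- The number of points in a ball is not bounded uniformly in the configuration, so cutting space
into annuli is not enough. Splitting further by the value `k` of the count in the annulus gives
countably many kernels, each of mass at most `k`. -/
instance isSFiniteKernel_ptsKernel : IsSFiniteKernel (ptsKernel X) := by
  classical
  rcases isEmpty_or_nonempty X with hX | ⟨⟨o⟩⟩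
  · have : ptsKernel X = 0 := by
      ext c s hs
      have : s = ∅ := Subsingleton.elim _ _
      simp [this]
    rw [this]; infer_instance
  let D : ℕ → Set X := disjointed fun n : ℕ => Metric.closedBall o (n : ℝ)
  have hDm : ∀ n, MeasurableSet (D n) :=
    MeasurableSet.disjointed fun n => Metric.isClosed_closedBall.measurableSet
  have hDb : ∀ n, Bornology.IsBounded (D n) := fun n =>
    Metric.isBounded_closedBall.subset (disjointed_subset _ n)
  have hDU : ⋃ n, D n = univ := by
    rw [iUnion_disjointed, Metric.iUnion_closedBall_nat]
  have hA : ∀ n k, MeasurableSet {c : Config X | count (D n) c = k} := fun n k =>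
    measurable_count (hDm n) (hDb n) (measurableSet_singleton k)
  let κ : ℕ × ℕ → Kernel (Config X) X := fun p =>
    Kernel.piecewise (hA p.1 p.2) ((ptsKernel X).restrict (hDm p.1)) 0
  have hκ : ∀ p c B, MeasurableSet B →
      κ p c B = if count (D p.1) c = p.2 then pts c (B ∩ D p.1) else 0 := by
    intro p c B hB
    simp only [κ, Kernel.piecewise_apply, mem_ofPred_eq]
    split_ifs
    · rw [Kernel.restrict_apply, Measure.restrict_apply hB, ptsKernel_apply]
    · simp
  have hfin : ∀ p, IsFiniteKernel (κ p) := by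
    intro p
    refine ⟨⟨p.2, by simp, fun c => ?_⟩⟩
    rw [hκ p c _ MeasurableSet.univ]
    split_ifs with h
    · rw [univ_inter, pts_eq_count c (hDm _) (hDb _), h]
    · simp
  have hsum : ptsKernel X = Kernel.sum κ := by
    ext c B hB
    rw [Kernel.sum_apply' _ _ hB, ENNReal.tsum_prod (f := fun a b => κ (a, b) c B)]
    simp_rw [hκ _ c B hB]
    have h1 : ∀ a, (∑' b : ℕ, if count (D a) c = b then pts c (B ∩ D a) else 0) = pts c (B ∩ D a) :=
      fun a => (tsum_eq_single (count (D a) c) fun b hb => if_neg (Ne.symm hb)).trans (if_pos rfl)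
    simp only [h1]
    rw [← measure_iUnion, ← inter_iUnion, hDU, inter_univ, ptsKernel_apply]
    · exact fun i j hij => ((disjoint_disjointed _) hij).mono inter_subset_right inter_subset_right
    · exact fun n => hB.inter (hDm n)
  rw [hsum]
  infer_instance

/-- A sum over the points of a random configuration is an integral against an s-finite kernel.
Nearly every later measurability statement about configurations reduces to this one. -/
lemma measurable_tsum_config {α : Type*} [MeasurableSpace α] {f : α → X → ℝ≥0∞}
    (hf : Measurable (Function.uncurry f)) {g : α → Config X} (hg : Measurable g) :
    Measurable fun a => ∑' x : (g a).1, f a x := by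
  simp_rw [← lintegral_pts]
  exact Measurable.lintegral_kernel_prod_right (κ := (ptsKernel X).comap g hg) hf

lemma tsum_config_ne_zero (c : Config X) (p : X → Prop) [DecidablePred p] :
    (∑' x : c.1, if p x then (1 : ℝ≥0∞) else 0) ≠ 0 ↔ ∃ x ∈ c.1, p x := by
  simp [ENNReal.tsum_eq_zero]

/-- Existence of a point with a property means that the sum of its indicator is nonzero. -/
lemma measurableSet_exists_config {α : Type*} [MeasurableSpace α] {p : α → X → Prop}
    (hp : MeasurableSet {q : α × X | p q.1 q.2}) {g : α → Config X} (hg : Measurable g) :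
    MeasurableSet {a | ∃ x ∈ (g a).1, p a x} := by
  classical
  have h := measurable_tsum_config (f := fun a x => if p a x then (1 : ℝ≥0∞) else 0)
    (Measurable.ite hp measurable_const measurable_const) hg
  have h2 := h (measurableSet_singleton 0).compl
  convert h2 using 1
  ext a
  rw [mem_preimage, mem_compl_iff, mem_singleton_iff, ← ne_eq, tsum_config_ne_zero]
  rfl

lemma measurableSet_mem_config [SecondCountableTopology X] {α : Type*} [MeasurableSpace α]
    {x : α → X} (hx : Measurable x) {g : α → Config X} (hg : Measurable g) :
    MeasurableSet {a | x a ∈ (g a).1} := by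
  have := measurableSet_exists_config (p := fun a y => y = x a)
    (measurableSet_eq_fun measurable_snd (hx.comp measurable_fst)) hg
  simpa using this

lemma measurable_config_of_count {α : Type*} [MeasurableSpace α] {g : α → Config X}
    (h : ∀ B : Set X, MeasurableSet B → Bornology.IsBounded B → Measurable fun a => pts (g a) B) :
    Measurable g := by
  refine measurable_generateFrom ?_
  rintro _ ⟨B, k, hB, hb, rfl⟩
  have := h B hB hb (measurableSet_singleton (k : ℝ≥0∞))
  convert this using 1
  ext a
  simp [pts_eq_count _ hB hb]

end Config

/-! ### Translations of configurations. -/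

section Shift

variable {d : ℕ}

lemma mem_shift {x y : Space d} {c : Config (Space d)} : y ∈ (shift x c).1 ↔ y + x ∈ c.1 := Iff.rfl

lemma tsum_shift (x : Space d) (c : Config (Space d)) (f : Space d → ℝ≥0∞) :
    ∑' y : (shift x c).1, f y = ∑' y : c.1, f (y - x) := by
  let E : (shift x c).1 ≃ c.1 :=
    { toFun := fun y => ⟨y + x, y.2⟩
      invFun := fun y => ⟨y - x, by rw [mem_shift, sub_add_cancel]; exact y.2⟩
      left_inv := fun y => by simp
      right_inv := fun y => by simp }
  rw [← E.tsum_eq]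
  simp [E]

lemma shift_shift (x y : Space d) (c : Config (Space d)) :
    shift x (shift y c) = shift (x + y) c := by
  apply Subtype.ext
  ext z
  simp only [mem_shift, add_assoc]

lemma measurable_shift {α : Type*} [MeasurableSpace α] {x : α → Space d} (hx : Measurable x)
    {g : α → Config (Space d)} (hg : Measurable g) : Measurable fun a => shift (x a) (g a) := by
  refine measurable_config_of_count fun B hB _ => ?_
  have h : ∀ a, pts (shift (x a) (g a)) B = ∑' y : (g a).1, B.indicator 1 ((y : Space d) - x a) := by
    intro a
    rw [← lintegral_indicator_one hB, lintegral_pts, tsum_shift]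
  simp_rw [h]
  refine measurable_tsum_config (f := fun a y => B.indicator 1 (y - x a)) ?_ hg
  exact (measurable_one.indicator hB).comp (measurable_snd.sub (hx.comp measurable_fst))

end Shift

end Harness

namespace Harness

/-! ### The refined Campbell formula and the mass transport principle. -/

section Palm

variable {d : ℕ}

lemma unitCube_eq : unitCube d = WithLp.ofLp ⁻¹' (univ.pi fun _ : Fin d => Ico (0 : ℝ) 1) := by
  ext x; simp [unitCube]

lemma measurableSet_unitCube : MeasurableSet (unitCube d) := by
  rw [unitCube_eq]
  exact (MeasurableSet.univ_pi fun _ => measurableSet_Ico).preimage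
    (PiLp.volume_preserving_ofLp (Fin d)).measurable

lemma volume_unitCube : volume (unitCube d) = 1 := by
  rw [unitCube_eq, (PiLp.volume_preserving_ofLp (Fin d)).measure_preimage
    (MeasurableSet.univ_pi fun _ => measurableSet_Ico).nullMeasurableSet, volume_pi_pi]
  simp

lemma interior_unitCube_nonempty : (interior (unitCube d)).Nonempty := by
  refine ⟨WithLp.toLp 2 fun _ => 2⁻¹, ?_⟩
  rw [mem_interior]
  refine ⟨WithLp.ofLp ⁻¹' (univ.pi fun _ : Fin d => Ioo (0 : ℝ) 1), ?_, ?_, ?_⟩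
  · rw [unitCube_eq]
    exact preimage_mono (pi_mono fun _ _ => Ioo_subset_Ico_self)
  · exact (isOpen_set_pi finite_univ fun _ _ => isOpen_Ioo).preimage (PiLp.continuous_ofLp 2 _)
  · simp only [mem_preimage, mem_pi, mem_univ, true_imp_iff, mem_Ioo]
    intro _; norm_num

/-- The Campbell measure of a point process: the mean of the sum, over the points `x`, of the unit
masses at `(x, shift x c)`. -/
noncomputable def campbellMeasure (P : Measure (Config (Space d))) :
    Measure (Space d × Config (Space d)) :=
  (P ⊗ₘ ptsKernel (Space d)).map fun q => (q.2, shift q.2 q.1)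

lemma measurable_prod_shift :
    Measurable fun q : Config (Space d) × Space d => (q.2, shift q.2 q.1) :=
  measurable_snd.prodMk (measurable_shift measurable_snd measurable_fst)

lemma lintegral_campbellMeasure (P : Measure (Config (Space d))) [SFinite P]
    {h : Space d × Config (Space d) → ℝ≥0∞} (hh : Measurable h) :
    ∫⁻ q, h q ∂(campbellMeasure P) = ∫⁻ c, ∑' x : c.1, h (x, shift x c) ∂P := by
  rw [campbellMeasure, lintegral_map hh measurable_prod_shift]
  refine (Measure.lintegral_compProd (hh.comp measurable_prod_shift)).trans ?_
  simp only [ptsKernel_apply, lintegral_pts, Function.comp_apply]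

lemma campbellMeasure_prod (P : Measure (Config (Space d))) [SFinite P] {B : Set (Space d)}
    (hB : MeasurableSet B) {A : Set (Config (Space d))} (hA : MeasurableSet A) :
    campbellMeasure P (B ×ˢ A) =
      ∫⁻ c, ∑' x : c.1, (B ×ˢ A).indicator 1 ((x : Space d), shift x c) ∂P := by
  rw [← lintegral_indicator_one (hB.prod hA), lintegral_campbellMeasure]
  exact measurable_one.indicator (hB.prod hA)

lemma IsPalm.campbellMeasure_unitCube {P Q : Measure (Config (Space d))} [SFinite P]
    (hpalm : IsPalm P Q) {A : Set (Config (Space d))} (hA : MeasurableSet A) :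
    campbellMeasure P (unitCube d ×ˢ A) = Q A := by
  classical
  rw [campbellMeasure_prod P measurableSet_unitCube hA, hpalm A hA]
  refine lintegral_congr fun c => ?_
  rw [← ENNReal.tsum_set_one]
  refine Eq.trans ?_ (tsum_subtype {x | x ∈ c.1 ∧ x ∈ unitCube d ∧ shift x c ∈ A}
    (1 : Space d → ℝ≥0∞)).symm
  rw [tsum_subtype c.1 fun x => (unitCube d ×ˢ A).indicator 1 (x, shift x c)]
  refine tsum_congr fun x => ?_
  by_cases h1 : x ∈ c.1 <;> by_cases h2 : x ∈ unitCube d <;> by_cases h3 : shift x c ∈ A <;>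
    simp [indicator, h1, h2, h3]

/-- Translating the configuration moves each point but leaves the configuration seen from that point
unchanged, so invariance of `P` becomes invariance in the first coordinate. -/
lemma IsStationary.campbellMeasure_translate {P : Measure (Config (Space d))} [SFinite P]
    (hstat : IsStationary P) {B : Set (Space d)} (hB : MeasurableSet B)
    {A : Set (Config (Space d))} (hA : MeasurableSet A) (v : Space d) :
    campbellMeasure P (((fun x => v + x) ⁻¹' B) ×ˢ A) = campbellMeasure P (B ×ˢ A) := by
  have hB' : MeasurableSet ((fun x => v + x) ⁻¹' B) := hB.preimage (measurable_const_add v)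
  rw [campbellMeasure_prod P hB' hA, campbellMeasure_prod P hB hA]
  conv_lhs => rw [← hstat v]
  have hs : Measurable (shift v) := measurable_shift measurable_const measurable_id
  rw [lintegral_map _ hs]
  · refine lintegral_congr fun c => ?_
    rw [tsum_shift v c fun x => (((fun x => v + x) ⁻¹' B) ×ˢ A).indicator 1 (x, shift x (shift v c))]
    refine tsum_congr fun x => ?_
    rw [shift_shift, sub_add_cancel]
    have hx : ((x : Space d) - v, shift (x : Space d) c) ∈ ((fun x => v + x) ⁻¹' B) ×ˢ A ↔
        ((x : Space d), shift (x : Space d) c) ∈ B ×ˢ A := by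
      rw [mem_prod, mem_prod, mem_preimage, add_sub_cancel]
    simp only [indicator, Pi.one_apply]
    by_cases hq : ((x : Space d), shift (x : Space d) c) ∈ B ×ˢ A
    · rw [if_pos hq, if_pos (hx.2 hq)]
    · rw [if_neg hq, if_neg (mt hx.1 hq)]
  · exact measurable_tsum_config (g := id)
      (f := fun c x => (((fun x => v + x) ⁻¹' B) ×ˢ A).indicator 1 (x, shift x c))
      ((measurable_one.indicator (hB'.prod hA)).comp measurable_prod_shift) measurable_id

/-- The refined Campbell formula. -/
theorem campbellMeasure_eq_prod {P Q : Measure (Config (Space d))} [IsProbabilityMeasure P]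
    [IsProbabilityMeasure Q] (hstat : IsStationary P) (hpalm : IsPalm P Q) :
    campbellMeasure P = (volume : Measure (Space d)).prod Q := by
  symm
  refine Measure.prod_eq fun B A hB hA => ?_
  set M := campbellMeasure P
  -- For fixed `A` this is a translation invariant measure in `B`, hence a multiple of Lebesgue
  -- measure by uniqueness of Haar measure. The unit cube identifies the factor as `Q A`.
  let ν : Measure (Space d) := (M.restrict (univ ×ˢ A)).map Prod.fst
  have hν : ∀ B, MeasurableSet B → ν B = M (B ×ˢ A) := by
    intro B hB
    rw [Measure.map_apply measurable_fst hB, Measure.restrict_apply (measurable_fst hB)]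
    congr 1
    ext; simp
  have : ν.IsAddLeftInvariant := by
    refine ⟨fun v => ?_⟩
    ext B hB
    rw [Measure.map_apply (measurable_const_add v) hB, hν _ (measurable_const_add v hB), hν _ hB]
    exact hstat.campbellMeasure_translate hB hA v
  have hcube : ν (unitCube d) = Q A := by
    rw [hν _ measurableSet_unitCube, hpalm.campbellMeasure_unitCube hA]
  have : IsFiniteMeasureOnCompacts ν := by
    refine ⟨fun K hK => ?_⟩
    refine measure_lt_top_of_isCompact_of_isAddLeftInvariant' (U := unitCube d)
      interior_unitCube_nonempty ?_ hK
    rw [hcube]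
    exact measure_ne_top _ _
  have h := Measure.isAddLeftInvariant_eq_smul ν (volume : Measure (Space d))
  have h1 : ν (unitCube d) = (Measure.addHaarScalarFactor ν volume : ℝ≥0∞) := by
    conv_lhs => rw [h]
    rw [Measure.smul_apply, volume_unitCube]
    simp [ENNReal.smul_def]
  rw [← hν B hB, h, Measure.smul_apply, ENNReal.smul_def, ← h1, hcube, smul_eq_mul, mul_comm]

lemma Config.countable (c : Config (Space d)) : Countable c.1 := by
  rw [countable_coe_iff]
  have : c.1 = ⋃ n : ℕ, c.1 ∩ Metric.closedBall 0 n := by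
    rw [← inter_iUnion, Metric.iUnion_closedBall_nat, inter_univ]
  rw [this]
  exact countable_iUnion fun n => (c.2 _ Metric.isBounded_closedBall).countable

/-- The mass transport principle. -/
theorem massTransport {P Q : Measure (Config (Space d))} [IsProbabilityMeasure P]
    [IsProbabilityMeasure Q] (hstat : IsStationary P) (hpalm : IsPalm P Q)
    {g : Space d → Config (Space d) → ℝ≥0∞} (hg : Measurable (Function.uncurry g)) :
    ∫⁻ c, ∑' y : c.1, g y c ∂Q = ∫⁻ c, ∑' y : c.1, g (-y) (shift y c) ∂Q := by
  classical
  -- A localizing weight of integral one turns a Palm mean into a sum over the points of the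
  -- stationary process.
  obtain ⟨I, hI, hI1⟩ : ∃ I : Space d → ℝ≥0∞, Measurable I ∧ ∫⁻ x, I x = 1 :=
    ⟨(unitCube d).indicator 1, measurable_one.indicator measurableSet_unitCube, by
      rw [lintegral_indicator_one measurableSet_unitCube, volume_unitCube]⟩
  have hF : Measurable fun c : Config (Space d) => ∑' y : c.1, g y c :=
    measurable_tsum_config (f := fun c y => g y c) (g := id) (hg.comp measurable_swap) measurable_id
  have hS : Measurable fun q : (Space d × Config (Space d)) × Space d => shift q.2 q.1.2 :=
    measurable_shift measurable_snd measurable_fst.snd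
  have hgS : Measurable fun q : (Space d × Config (Space d)) × Space d =>
      g (-q.2) (shift q.2 q.1.2) := by
    have hn : Measurable fun q : (Space d × Config (Space d)) × Space d => -q.2 :=
      measurable_snd.neg
    have hp : Measurable fun q : (Space d × Config (Space d)) × Space d =>
      (-q.2, shift q.2 q.1.2) := hn.prodMk hS
    exact hg.comp hp
  have hIS : Measurable fun q : (Space d × Config (Space d)) × Space d => I (q.1.1 + q.2) :=
    hI.comp (measurable_fst.fst.add measurable_snd)
  have hG : Measurable fun q : Space d × Config (Space d) =>
      ∑' y : q.2.1, I (q.1 + y) * g (-y) (shift y q.2) :=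
    measurable_tsum_config (f := fun q y => I (q.1 + y) * g (-y) (shift y q.2)) (hIS.mul hgS)
      measurable_snd
  have h1 : ∫⁻ c, ∑' y : c.1, g y c ∂Q
      = ∫⁻ q, I q.1 * ∑' y : q.2.1, g y q.2 ∂(campbellMeasure P) := by
    rw [campbellMeasure_eq_prod hstat hpalm, lintegral_prod_mul hI.aemeasurable hF.aemeasurable,
      hI1, one_mul]
  -- In absolute coordinates both sides are sums over ordered pairs of points; they differ by
  -- exchanging the sender and the receiver, so the weight moves from one end to the other.
  have h2 : ∀ c : Config (Space d), ∑' x : c.1, I x * ∑' y : (shift x c).1, g y (shift x c)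
      = ∑' x : c.1, ∑' y : (shift x c).1, I (x + y) * g (-y) (shift y (shift x c)) := by
    intro c
    have e1 : ∀ x : c.1, I x * ∑' y : (shift x c).1, g y (shift x c)
        = ∑' y : c.1, I x * g (y - x) (shift x c) := by
      intro x
      rw [tsum_shift x c fun y => g y (shift x c), ENNReal.tsum_mul_left]
    have e2 : ∀ x : c.1, (∑' y : (shift x c).1, I (x + y) * g (-y) (shift y (shift x c)))
        = ∑' y : c.1, I y * g (x - y) (shift y c) := by
      intro x
      rw [tsum_shift x c fun y => I (x + y) * g (-y) (shift y (shift x c))]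
      simp [shift_shift]
    rw [tsum_congr e1, tsum_congr e2]
    exact ENNReal.tsum_comm
  -- After disintegration the location is independent of the configuration, and integrating it out
  -- removes the weight, wherever it is centred.
  have h3 : ∀ c : Config (Space d),
      ∫⁻ x : Space d, ∑' y : c.1, I (x + y) * g (-y) (shift y c)
        = ∑' y : c.1, g (-y) (shift y c) := by
    intro c
    have := c.countable
    have hIy : ∀ y : Space d, Measurable fun x => I (x + y) := fun y =>
      hI.comp (measurable_add_const y)
    have hIi : ∀ y : Space d, ∫⁻ x, I (x + y) = 1 := fun y => by
      rw [lintegral_add_right_eq_self I y, hI1]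
    have hIm : ∀ (y : Space d) (a : ℝ≥0∞), ∫⁻ x, I (x + y) * a = a := fun y a => by
      rw [lintegral_mul_const _ (hIy y), hIi, one_mul]
    rw [lintegral_tsum fun y : c.1 => ((hIy y).mul_const _).aemeasurable]
    exact tsum_congr fun y => hIm _ _
  rw [h1, lintegral_campbellMeasure P (h := fun q => I q.1 * ∑' y : q.2.1, g y q.2)
    ((hI.comp measurable_fst).mul (hF.comp measurable_snd)), lintegral_congr h2,
    ← lintegral_campbellMeasure P hG, campbellMeasure_eq_prod hstat hpalm,
    lintegral_prod_symm' _ hG]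
  exact lintegral_congr h3

/-- Almost sure properties seen from the origin hold seen from every point. -/
theorem ae_forall_shift {P Q : Measure (Config (Space d))} [IsProbabilityMeasure P]
    [IsProbabilityMeasure Q] (hstat : IsStationary P) (hpalm : IsPalm P Q)
    {A : Set (Config (Space d))} (hA : MeasurableSet A) (h : ∀ᵐ c ∂Q, c ∈ A) :
    ∀ᵐ c ∂Q, ∀ x ∈ c.1, shift x c ∈ A := by
  classical
  -- Every point that sees a bad environment sends mass one to all points. The mean mass sent by the
  -- origin is zero, and the mass it receives is the number of bad points.
  have hm : Measurable (Function.uncurry fun (_ : Space d) (c : Config (Space d)) =>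
      Aᶜ.indicator (1 : Config (Space d) → ℝ≥0∞) c) :=
    (measurable_one.indicator hA.compl).comp measurable_snd
  have h1 := massTransport hstat hpalm hm
  have h0 : ∫⁻ c, ∑' _ : c.1, Aᶜ.indicator (1 : Config (Space d) → ℝ≥0∞) c ∂Q = 0 := by
    rw [lintegral_eq_zero_iff']
    · filter_upwards [h] with c hc
      simp [hc]
    · exact (measurable_tsum_config (g := id) (f := fun c _ => Aᶜ.indicator 1 c)
        ((measurable_one.indicator hA.compl).comp measurable_fst) measurable_id).aemeasurable
  rw [h0, eq_comm, lintegral_eq_zero_iff] at h1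
  · filter_upwards [h1] with c hc x hx
    simp only [Pi.zero_apply, ENNReal.tsum_eq_zero] at hc
    by_contra hn
    have := hc ⟨x, hx⟩
    simp [indicator, hn] at this
  · exact measurable_tsum_config (g := id) (f := fun c x => Aᶜ.indicator 1 (shift x c))
      ((measurable_one.indicator hA.compl).comp (measurable_shift measurable_snd measurable_fst))
      measurable_id

/-- Seen from a point `x` of the process, `x` itself sits at the origin. -/
theorem IsPalm.ae_zero_mem {P Q : Measure (Config (Space d))} [IsProbabilityMeasure P]
    (hpalm : IsPalm P Q) : ∀ᵐ c ∂Q, (0 : Space d) ∈ c.1 := by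
  have hA : MeasurableSet {c : Config (Space d) | (0 : Space d) ∈ c.1} :=
    measurableSet_mem_config measurable_const measurable_id
  rw [ae_iff]
  have := hpalm _ hA.compl
  refine this.trans ?_
  refine (lintegral_congr fun c => ?_).trans lintegral_zero
  have : {x | x ∈ c.1 ∧ x ∈ unitCube d ∧ shift x c ∈ {c : Config (Space d) | (0 : Space d) ∈ c.1}ᶜ}
      = ∅ := by
    ext x
    simp only [mem_ofPred_eq, mem_compl_iff, mem_shift, zero_add, mem_empty_iff_false, iff_false]
    tauto
  rw [this]
  simp

end Palm

end Harness

namespace Harness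

/-! ### Voronoi neighbors: measurability and existence. -/

section Voronoi

variable {d : ℕ}

open scoped RealInnerProductSpace

/-- The coefficient of the displacement, in the direction of `y - x`, of the orthogonal projection
of `z` to the bisector of `x` and `y`. -/
noncomputable def bisCoeff (x y z : Space d) : ℝ :=
  (‖y - x‖ ^ 2 - 2 * ⟪z - x, y - x⟫) / (2 * ‖y - x‖ ^ 2)

/-- The orthogonal projection of `z` to the bisector of `x` and `y`. -/
noncomputable def bisProj (x y z : Space d) : Space d := z + bisCoeff x y z • (y - x)

lemma dist_le_dist_iff_inner (x y z : Space d) :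
    dist z x ≤ dist z y ↔ 2 * ⟪z - x, y - x⟫ ≤ ‖y - x‖ ^ 2 := by
  have h : ‖z - y‖ ^ 2 = ‖z - x‖ ^ 2 - 2 * ⟪z - x, y - x⟫ + ‖y - x‖ ^ 2 := by
    rw [← norm_sub_sq_real]; congr 2; abel
  rw [dist_eq_norm, dist_eq_norm, ← sq_le_sq₀ (norm_nonneg _) (norm_nonneg _), h]
  constructor <;> intro h <;> linarith

lemma dist_eq_dist_iff_inner (x y z : Space d) :
    dist z x = dist z y ↔ 2 * ⟪z - x, y - x⟫ = ‖y - x‖ ^ 2 := by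
  have h : ‖z - y‖ ^ 2 = ‖z - x‖ ^ 2 - 2 * ⟪z - x, y - x⟫ + ‖y - x‖ ^ 2 := by
    rw [← norm_sub_sq_real]; congr 2; abel
  rw [dist_eq_norm, dist_eq_norm, ← sq_eq_sq₀ (norm_nonneg _) (norm_nonneg _), h]
  constructor <;> intro h <;> linarith

lemma norm_sub_ne_zero {x y : Space d} (hxy : x ≠ y) : ‖y - x‖ ≠ 0 :=
  norm_ne_zero_iff.2 (sub_ne_zero.2 hxy.symm)

lemma norm_sub_sq_pos {x y : Space d} (hxy : x ≠ y) : 0 < ‖y - x‖ ^ 2 := by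
  have := norm_sub_ne_zero hxy
  positivity

lemma dist_bisProj {x y : Space d} (hxy : x ≠ y) (z : Space d) :
    dist (bisProj x y z) x = dist (bisProj x y z) y := by
  rw [dist_eq_dist_iff_inner, bisProj, add_sub_right_comm, inner_add_left, real_inner_smul_left,
    real_inner_self_eq_norm_sq, bisCoeff]
  have := norm_sub_ne_zero hxy
  field_simp
  ring

lemma bisProj_of_dist_eq {x y z : Space d} (h : dist z x = dist z y) : bisProj x y z = z := by
  rw [dist_eq_dist_iff_inner] at h
  rw [bisProj, bisCoeff, h]
  simp

lemma bisProj_add_smul {x y : Space d} (hxy : x ≠ y) (z : Space d) (s : ℝ) :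
    bisProj x y (z + s • (y - x)) = bisProj x y z := by
  have h : bisCoeff x y (z + s • (y - x)) = bisCoeff x y z - s := by
    rw [bisCoeff, bisCoeff, add_sub_right_comm, inner_add_left, real_inner_smul_left,
      real_inner_self_eq_norm_sq]
    have := norm_sub_ne_zero hxy
    field_simp
    ring
  rw [bisProj, bisProj, h, add_assoc, ← add_smul]
  congr 2
  ring

/-- The projection is affine, which is why the cylinder over a convex facet is convex. -/
lemma bisProj_combo (x y : Space d) {a b : ℝ} (hab : a + b = 1) (z w : Space d) :
    bisProj x y (a • z + b • w) = a • bisProj x y z + b • bisProj x y w := by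
  have h : bisCoeff x y (a • z + b • w) = a * bisCoeff x y z + b * bisCoeff x y w := by
    have h1 : a • z + b • w - x = a • (z - x) + b • (w - x) := by
      have : x = a • x + b • x := by rw [← add_smul, hab, one_smul]
      nth_rewrite 1 [this]
      simp only [smul_sub]
      abel
    simp only [bisCoeff]
    rw [h1, inner_add_left, real_inner_smul_left, real_inner_smul_left]
    have : ‖y - x‖ ^ 2 = a * ‖y - x‖ ^ 2 + b * ‖y - x‖ ^ 2 := by rw [← add_mul, hab, one_mul]
    nth_rewrite 1 [this]
    ring
  rw [bisProj, bisProj, bisProj, h, add_smul, smul_add, smul_add, smul_smul, smul_smul]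
  abel

lemma continuous_bisProj (x y : Space d) : Continuous (bisProj x y) := by
  unfold bisProj bisCoeff
  fun_prop

lemma measurable_bisProj : Measurable fun q : (Space d × Space d) × Space d =>
    bisProj q.1.1 q.1.2 q.2 := by
  unfold bisProj bisCoeff
  fun_prop

lemma isClosed_voronoi (c : Config (Space d)) (x : Space d) : IsClosed (voronoi c x) := by
  have : voronoi c x = ⋂ y ∈ c.1, {z | dist z x ≤ dist z y} := by
    ext; simp [voronoi]
  rw [this]
  exact isClosed_biInter fun y _ => isClosed_le (by fun_prop) (by fun_prop)

lemma convex_voronoi (c : Config (Space d)) (x : Space d) : Convex ℝ (voronoi c x) := by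
  have : voronoi c x = ⋂ y ∈ c.1, {z | dist z x ≤ dist z y} := by
    ext; simp [voronoi]
  rw [this]
  refine convex_iInter₂ fun y _ => ?_
  have h : {z : Space d | dist z x ≤ dist z y}
      = {z | (innerSL ℝ (y - x)) z ≤ ‖y - x‖ ^ 2 / 2 + ⟪x, y - x⟫} := by
    ext z
    rw [mem_ofPred_eq, mem_ofPred_eq, dist_le_dist_iff_inner, inner_sub_left, innerSL_apply_apply,
      real_inner_comm z (y - x)]
    constructor <;> intro h <;> linarith
  rw [h]
  exact convex_halfSpace_le (innerSL ℝ (y - x)).toLinearMap.isLinear _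

lemma mem_voronoi_of_dist_eq {c : Config (Space d)} {x y z : Space d} (hz : z ∈ voronoi c x)
    (h : dist z x = dist z y) : z ∈ voronoi c y := fun w hw => h ▸ hz w hw

lemma dist_eq_of_mem_voronoi {c : Config (Space d)} {x y z : Space d} (hx : x ∈ c.1) (hy : y ∈ c.1)
    (hz : z ∈ voronoi c x ∩ voronoi c y) : dist z x = dist z y :=
  le_antisymm (hz.1 y hy) (hz.2 x hx)

/-- The points that project to the common facet of the cells of `x` and `y`. -/
def facetCylinder (c : Config (Space d)) (x y : Space d) : Set (Space d) :=
  {z | bisProj x y z ∈ voronoi c x}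

lemma mem_facetCylinder {c : Config (Space d)} {x y z : Space d} :
    z ∈ facetCylinder c x y ↔ bisProj x y z ∈ voronoi c x := Iff.rfl

lemma isClosed_facetCylinder (c : Config (Space d)) (x y : Space d) :
    IsClosed (facetCylinder c x y) :=
  (isClosed_voronoi c x).preimage (continuous_bisProj x y)

lemma convex_facetCylinder (c : Config (Space d)) (x y : Space d) :
    Convex ℝ (facetCylinder c x y) := by
  intro z hz w hw a b ha hb hab
  rw [mem_facetCylinder, bisProj_combo x y hab]
  exact convex_voronoi c x hz hw ha hb hab

lemma subset_facetCylinder {c : Config (Space d)} {x y : Space d} (hx : x ∈ c.1) (hy : y ∈ c.1) :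
    voronoi c x ∩ voronoi c y ⊆ facetCylinder c x y := fun z hz => by
  rw [mem_facetCylinder, bisProj_of_dist_eq (dist_eq_of_mem_voronoi hx hy hz)]
  exact hz.1

lemma bisProj_mem_of_mem_facetCylinder {c : Config (Space d)} {x y z : Space d} (hxy : x ≠ y)
    (hz : z ∈ facetCylinder c x y) : bisProj x y z ∈ voronoi c x ∩ voronoi c y :=
  ⟨mem_facetCylinder.1 hz, mem_voronoi_of_dist_eq (mem_facetCylinder.1 hz) (dist_bisProj hxy z)⟩

lemma vectorSpan_facetCylinder {c : Config (Space d)} {x y : Space d} (hx : x ∈ c.1) (hy : y ∈ c.1)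
    (hxy : x ≠ y) (hne : (voronoi c x ∩ voronoi c y).Nonempty) :
    vectorSpan ℝ (facetCylinder c x y) =
      vectorSpan ℝ (voronoi c x ∩ voronoi c y) ⊔ Submodule.span ℝ {y - x} := by
  apply le_antisymm
  · rw [vectorSpan_def, Submodule.span_le]
    rintro _ ⟨a, ha, b, hb, rfl⟩
    have h : a -ᵥ b = (bisProj x y a -ᵥ bisProj x y b) +
        (bisCoeff x y b - bisCoeff x y a) • (y - x) := by
      simp only [vsub_eq_sub, bisProj, sub_smul]
      abel
    change a -ᵥ b ∈ _
    rw [h]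
    exact Submodule.add_mem_sup (vsub_mem_vectorSpan ℝ (bisProj_mem_of_mem_facetCylinder hxy ha)
      (bisProj_mem_of_mem_facetCylinder hxy hb))
      (Submodule.smul_mem _ _ (Submodule.mem_span_singleton_self _))
  · refine sup_le (vectorSpan_mono ℝ (subset_facetCylinder hx hy)) ?_
    rw [Submodule.span_singleton_le_iff_mem]
    obtain ⟨z, hz⟩ := hne
    have hz1 := subset_facetCylinder hx hy hz
    have hz2 : z + (1 : ℝ) • (y - x) ∈ facetCylinder c x y := by
      rw [mem_facetCylinder, bisProj_add_smul hxy]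
      exact hz1
    have := vsub_mem_vectorSpan ℝ hz2 hz1
    simpa using this

/-- The directions within the facet are orthogonal to `y - x`, so thickening along `y - x` adds
exactly one dimension. A facet of dimension `d - 1` becomes a full-dimensional convex set. -/
lemma finrank_vectorSpan_facetCylinder {c : Config (Space d)} {x y : Space d} (hx : x ∈ c.1)
    (hy : y ∈ c.1) (hxy : x ≠ y) (hne : (voronoi c x ∩ voronoi c y).Nonempty) :
    Module.finrank ℝ (vectorSpan ℝ (facetCylinder c x y)) =
      Module.finrank ℝ (vectorSpan ℝ (voronoi c x ∩ voronoi c y)) + 1 := by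
  have hv : y - x ≠ 0 := sub_ne_zero.2 hxy.symm
  have hle : vectorSpan ℝ (voronoi c x ∩ voronoi c y) ≤ (Submodule.span ℝ {y - x})ᗮ := by
    rw [vectorSpan_def, Submodule.span_le]
    rintro _ ⟨a, ha, b, hb, rfl⟩
    have h1 := (dist_eq_dist_iff_inner x y a).1 (dist_eq_of_mem_voronoi hx hy ha)
    have h2 := (dist_eq_dist_iff_inner x y b).1 (dist_eq_of_mem_voronoi hx hy hb)
    rw [SetLike.mem_coe]
    change a -ᵥ b ∈ _
    rw [Submodule.mem_orthogonal_singleton_iff_inner_left, vsub_eq_sub,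
      ← sub_sub_sub_cancel_right a b x, inner_sub_left]
    linarith
  have hdisj : Disjoint (vectorSpan ℝ (voronoi c x ∩ voronoi c y)) (Submodule.span ℝ {y - x}) :=
    ((Submodule.orthogonal_disjoint _).mono_right hle).symm
  have h := Submodule.finrank_sup_add_finrank_inf_eq
    (vectorSpan ℝ (voronoi c x ∩ voronoi c y)) (Submodule.span ℝ {y - x})
  rw [hdisj.eq_bot, finrank_bot, add_zero, finrank_span_singleton hv] at h
  rw [vectorSpan_facetCylinder hx hy hxy hne, h]

/-- Two distinct points are neighbors if and only if the cylinder over their common facet has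
positive volume. -/
theorem neighbor_iff_volume (c : Config (Space d)) (x y : Space d) :
    Neighbor c x y ↔ x ∈ c.1 ∧ y ∈ c.1 ∧ x ≠ y ∧ volume (facetCylinder c x y) ≠ 0 := by
  refine and_congr_right fun hx => and_congr_right fun hy => and_congr_right fun hxy => ?_
  -- The frontier of a convex set is null, so a closed convex set without interior has volume zero.
  have hvol : volume (facetCylinder c x y) ≠ 0 ↔ (interior (facetCylinder c x y)).Nonempty := by
    constructor
    · intro h
      by_contra hn
      rw [not_nonempty_iff_eq_empty] at hn
      have := (convex_facetCylinder c x y).addHaar_frontier volume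
      rw [frontier, hn, sdiff_empty, (isClosed_facetCylinder c x y).closure_eq] at this
      exact h this
    · intro h
      exact ((isOpen_interior.measure_pos volume h).trans_le
        (measure_mono interior_subset)).ne'
  rw [hvol, (convex_facetCylinder c x y).interior_nonempty_iff_affineSpan_eq_top]
  have key : ∀ hne : (voronoi c x ∩ voronoi c y).Nonempty,
      affineSpan ℝ (facetCylinder c x y) = ⊤ ↔
        Module.finrank ℝ (vectorSpan ℝ (voronoi c x ∩ voronoi c y)) + 1 = d := by
    intro hne
    rw [AffineSubspace.affineSpan_eq_top_iff_vectorSpan_eq_top_of_nonempty ℝ _ _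
      (hne.mono (subset_facetCylinder hx hy)),
      ← finrank_vectorSpan_facetCylinder hx hy hxy hne]
    constructor
    · intro h; rw [h, finrank_top, finrank_euclideanSpace, Fintype.card_fin]
    · intro h; exact Submodule.eq_top_of_finrank_eq (by rw [h, finrank_euclideanSpace, Fintype.card_fin])
  constructor
  · rintro ⟨hne, h⟩; exact (key hne).2 h
  · intro h
    have hne : (facetCylinder c x y).Nonempty := by
      rw [nonempty_iff_ne_empty]
      rintro h0
      rw [h0, AffineSubspace.span_empty] at h
      exact AffineSubspace.bot_ne_top ℝ (Space d) (Space d) h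
    obtain ⟨z, hz⟩ := hne
    have hne : (voronoi c x ∩ voronoi c y).Nonempty :=
      ⟨_, bisProj_mem_of_mem_facetCylinder hxy hz⟩
    exact ⟨hne, (key hne).1 h⟩

lemma measurableSet_mem_voronoi {α : Type*} [MeasurableSpace α] {g : α → Config (Space d)}
    (hg : Measurable g) {x z : α → Space d} (hx : Measurable x) (hz : Measurable z) :
    MeasurableSet {a | z a ∈ voronoi (g a) (x a)} := by
  have h : MeasurableSet {a | ∃ y ∈ (g a).1, dist (z a) y < dist (z a) (x a)} := by
    refine measurableSet_exists_config (p := fun a y => dist (z a) y < dist (z a) (x a)) ?_ hg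
    exact measurableSet_lt ((hz.comp measurable_fst).dist measurable_snd)
      ((hz.comp measurable_fst).dist (hx.comp measurable_fst))
  convert h.compl using 1
  ext a
  simp [voronoi]

/-- The dimension of a facet is not visibly measurable in the configuration. The volume of the
cylinder is: it is the measure of a section of a jointly measurable set. -/
theorem measurableSet_neighbor {α : Type*} [MeasurableSpace α] {g : α → Config (Space d)}
    (hg : Measurable g) {x y : α → Space d} (hx : Measurable x) (hy : Measurable y) :
    MeasurableSet {a | Neighbor (g a) (x a) (y a)} := by
  have hS : MeasurableSet {q : α × Space d | bisProj (x q.1) (y q.1) q.2 ∈ voronoi (g q.1) (x q.1)} :=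
    measurableSet_mem_voronoi (hg.comp measurable_fst) (hx.comp measurable_fst)
      (measurable_bisProj.comp (((hx.comp measurable_fst).prodMk (hy.comp measurable_fst)).prodMk
        measurable_snd))
  have hV := measurable_measure_prodMk_left (ν := (volume : Measure (Space d))) hS
  have h := (measurableSet_mem_config hx hg).inter ((measurableSet_mem_config hy hg).inter
    ((measurableSet_eq_fun hx hy).compl.inter (hV (measurableSet_singleton 0).compl)))
  convert h using 1
  ext a
  exact neighbor_iff_volume _ _ _

/-- In a configuration with at least two points, every point has a neighbor. -/
theorem exists_neighbor {c : Config (Space d)} {x y : Space d} (hx : x ∈ c.1) (hy : y ∈ c.1)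
    (hxy : x ≠ y) : ∃ z, Neighbor c x z := by
  by_contra! hno
  -- A common facet never exceeds dimension `d - 1`, so failing to be neighbors makes the inequality
  -- strict.
  have hdim : ∀ z ∈ c.1, x ≠ z → (voronoi c x ∩ voronoi c z).Nonempty →
      Module.finrank ℝ (vectorSpan ℝ (voronoi c x ∩ voronoi c z)) + 1 < d := by
    intro z hz hxz hne
    refine lt_of_le_of_ne ?_ fun h => hno z ⟨hx, hz, hxz, hne, h⟩
    rw [← finrank_vectorSpan_facetCylinder hx hz hxz hne]
    exact (Submodule.finrank_le _).trans_eq (by rw [finrank_euclideanSpace, Fintype.card_fin])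
  -- The union of the lines from `x` through the facet shared with `z`. If the facet has dimension
  -- at most `d - 2`, these lines stay, up to translation by `x`, in a proper subspace, which is
  -- null.
  let S : c.1 → Set (Space d) := fun z =>
    {w | (voronoi c x ∩ voronoi c z).Nonempty ∧ x ≠ z ∧ ∃ p ∈ voronoi c x ∩ voronoi c z,
      ∃ s : ℝ, w - x = s • (p - x)}
  have hS : ∀ z, volume (S z) = 0 := by
    intro z
    by_cases hz : (voronoi c x ∩ voronoi c z).Nonempty ∧ x ≠ z
    · obtain ⟨k, hk⟩ := hz.1
      set A := vectorSpan ℝ (voronoi c x ∩ voronoi c z) ⊔ Submodule.span ℝ {k - x} with hA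
      have hAtop : A ≠ ⊤ := by
        intro h
        have h1 : Module.finrank ℝ A ≤
            Module.finrank ℝ (vectorSpan ℝ (voronoi c x ∩ voronoi c z)) + 1 :=
          (Submodule.finrank_add_le_finrank_add_finrank _ _).trans
            (Nat.add_le_add_left ((finrank_span_le_card {k - x}).trans (by simp)) _)
        rw [h, finrank_top, finrank_euclideanSpace, Fintype.card_fin] at h1
        exact absurd (hdim z z.2 hz.2 hz.1) (not_lt.2 h1)
      refine measure_mono_null (t := (fun w => w - x) ⁻¹' (A : Set (Space d))) ?_ ?_
      · rintro w ⟨-, -, p, hp, s, hs⟩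
        change w - x ∈ A
        rw [hs]
        refine Submodule.smul_mem _ _ ?_
        rw [← sub_add_sub_cancel p k x]
        exact Submodule.add_mem_sup (vsub_mem_vectorSpan ℝ hp hk)
          (Submodule.mem_span_singleton_self _)
      · simp_rw [sub_eq_add_neg]
        rw [measure_preimage_add_right]
        exact Measure.addHaar_submodule _ _ hAtop
    · have : S z = ∅ := by
        ext w
        simp only [S, mem_ofPred_eq, mem_empty_iff_false, iff_false]
        exact fun h => hz ⟨h.1, h.2.1⟩
      rw [this, measure_empty]
  -- The segment from `x` to a point `w` outside its cell leaves the cell through a facet. Hence a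
  -- nonempty open set is covered by countably many null sets, a contradiction.
  have hsub : {w : Space d | dist w y < dist w x} ⊆ ⋃ z, S z := by
    intro w hw
    have hw' : ‖y - x‖ ^ 2 < 2 * ⟪w - x, y - x⟫ := by
      by_contra! h
      exact absurd ((dist_le_dist_iff_inner x y w).2 h) (not_le.2 hw)
    -- The points whose bisector with `x` is crossed before `w`. Cauchy–Schwarz puts them within `2
    -- * ‖w - x‖` of `x`, so they are finitely many.
    let F : Set (Space d) := {z ∈ c.1 | x ≠ z ∧ ‖z - x‖ ^ 2 < 2 * ⟪w - x, z - x⟫}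
    have hF : F.Finite := by
      refine (c.2 (Metric.closedBall x (2 * ‖w - x‖)) Metric.isBounded_closedBall).subset ?_
      rintro z ⟨hz, -, h⟩
      refine ⟨hz, ?_⟩
      rw [Metric.mem_closedBall, dist_eq_norm]
      have h1 := real_inner_le_norm (w - x) (z - x)
      by_contra! h2
      have h3 : 0 ≤ ‖z - x‖ := norm_nonneg _
      nlinarith
    -- The minimized quantity is the parameter at which the segment crosses the bisector; at the
    -- first crossing it is still in the cell of `x`.
    obtain ⟨z, ⟨hzc, hxz, hz⟩, hmin⟩ := Set.exists_min_image F
      (fun z => ‖z - x‖ ^ 2 / (2 * ⟪w - x, z - x⟫)) hF ⟨y, hy, hxy, hw'⟩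
    have hz0 := norm_sub_sq_pos hxz
    set s := ‖z - x‖ ^ 2 / (2 * ⟪w - x, z - x⟫) with hs
    have hspos : 0 < s := div_pos hz0 (hz0.trans hz)
    have hs1 : s < 1 := (div_lt_one (hz0.trans hz)).2 hz
    have hpx : x + s • (w - x) - x = s • (w - x) := by abel
    have hp : x + s • (w - x) ∈ voronoi c x := by
      intro u hu
      rw [dist_le_dist_iff_inner, hpx, real_inner_smul_left]
      by_cases hxu : x = u
      · simp [hxu]
      by_cases h : ‖u - x‖ ^ 2 < 2 * ⟪w - x, u - x⟫
      · have h1 := hmin u ⟨hu, hxu, h⟩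
        rw [le_div_iff₀ ((norm_sub_sq_pos hxu).trans h)] at h1
        linarith
      · have := norm_sub_sq_pos hxu
        nlinarith
    have hp' : dist (x + s • (w - x)) x = dist (x + s • (w - x)) z := by
      rw [dist_eq_dist_iff_inner, hpx, real_inner_smul_left, hs]
      have h0 := (hz0.trans hz).ne'
      rw [mul_left_comm, div_mul_cancel₀ _ h0]
    have hpm : x + s • (w - x) ∈ voronoi c x ∩ voronoi c z := ⟨hp, mem_voronoi_of_dist_eq hp hp'⟩
    refine mem_iUnion.2 ⟨⟨z, hzc⟩, ⟨_, hpm⟩, hxz, _, hpm, s⁻¹, ?_⟩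
    rw [hpx, smul_smul, inv_mul_cancel₀ hspos.ne', one_smul]
  have hnull : volume {w : Space d | dist w y < dist w x} = 0 := by
    have := c.countable
    exact measure_mono_null hsub (measure_iUnion_null hS)
  have hopen : IsOpen {w : Space d | dist w y < dist w x} :=
    isOpen_lt (by fun_prop) (by fun_prop)
  refine (hopen.measure_pos volume ⟨y, ?_⟩).ne' hnull
  simpa using hxy.symm

end Voronoi

/-! ### Covariance of the Voronoi graph and of the walk under translations. -/

section Covariance

open scoped Pointwise

variable {d : ℕ}

lemma voronoi_shift (c : Config (Space d)) (x y : Space d) :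
    voronoi (shift x c) y = (-x) +ᵥ voronoi c (y + x) := by
  ext z
  rw [mem_vadd_set_iff_neg_vadd_mem, neg_neg, vadd_eq_add, add_comm x z]
  constructor
  · intro h w hw
    have := h (w - x) (by rw [mem_shift, sub_add_cancel]; exact hw)
    rwa [← dist_add_right z y x, ← dist_add_right z (w - x) x, sub_add_cancel] at this
  · intro h w hw
    have := h (w + x) hw
    rwa [dist_add_right, dist_add_right] at this

lemma neighbor_shift (c : Config (Space d)) (x y z : Space d) :
    Neighbor (shift x c) y z ↔ Neighbor c (y + x) (z + x) := by
  unfold Neighbor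
  rw [voronoi_shift, voronoi_shift, ← vadd_set_inter, vectorSpan_vadd, vadd_set_nonempty,
    mem_shift, mem_shift, Ne, Ne, add_left_inj]

lemma nbrs_shift (c : Config (Space d)) (x y : Space d) :
    nbrs (shift x c) y = (fun z => z + x) ⁻¹' nbrs c (y + x) := by
  ext z
  exact neighbor_shift c x y z

lemma encard_nbrs_shift (c : Config (Space d)) (x y : Space d) :
    (nbrs (shift x c) y).encard = (nbrs c (y + x)).encard := by
  rw [nbrs_shift, ← (Equiv.addRight x).injective.encard_image]
  exact congrArg encard (image_preimage_eq _ (Equiv.addRight x).surjective)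

lemma tsum_nbrs_shift (c : Config (Space d)) (x y : Space d) (f : Space d → ℝ≥0∞) :
    ∑' z : nbrs (shift x c) y, f (z + x) = ∑' z : nbrs c (y + x), f z := by
  rw [tsum_subtype (nbrs c (y + x)) f, ← (Equiv.addRight x).tsum_eq,
    tsum_subtype (nbrs (shift x c) y) fun z => f (z + x), nbrs_shift]
  rfl

lemma walkLaw_shift (c : Config (Space d)) (m : Space d → Set ℝ) (x : Space d) (n : ℕ)
    (y : Space d) (I : Set ℝ) (z : Space d) :
    walkLaw (shift x c) (fun y => m (y + x)) n y I z = walkLaw c m n (y + x) I (z + x) := by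
  induction n generalizing y I with
  | zero => simp [walkLaw]
  | succ n ih =>
    simp only [walkLaw, ih, add_left_inj, encard_nbrs_shift]
    rw [tsum_nbrs_shift c x y fun w => walkLaw c m n w (Ioo 0 (sSup (m (y + x) ∩ I))) (z + x)]

lemma transProb_shift (c : Config (Space d)) (m : Space d → Set ℝ) (t : ℝ) (x y z : Space d) :
    transProb (shift x c) (fun y => m (y + x)) t y z = transProb c m t (y + x) (z + x) := by
  simp only [transProb, walkLaw_shift]

end Covariance

end Harness

namespace Harness

/-! ### Independence of the past and the future of the Poisson clocks. -/

section Restriction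

/-- The epochs in the interval `(0, s]`. -/
def restrict (s : ℝ) (θ : Config ℝ) : Config ℝ :=
  ⟨θ.1 ∩ Ioc 0 s, fun B hB => (θ.2 B hB).subset (inter_subset_inter_left _ inter_subset_left)⟩

lemma pts_restrict (s : ℝ) (θ : Config ℝ) {B : Set ℝ} (hB : MeasurableSet B) :
    pts (restrict s θ) B = count (Ioc 0 s ∩ B) θ := by
  rw [← pts_eq_count θ (measurableSet_Ioc.inter hB)
    ((Metric.isBounded_Ioc 0 s).subset inter_subset_left), pts_apply _ hB,
    pts_apply _ (measurableSet_Ioc.inter hB), ← inter_assoc]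
  rfl

lemma measurable_restrict (s : ℝ) : Measurable (restrict s) := by
  refine measurable_config_of_count fun B hB _ => ?_
  simp_rw [pts_restrict s _ hB]
  exact measurable_from_top.comp (measurable_count (measurableSet_Ioc.inter hB)
    ((Metric.isBounded_Ioc 0 s).subset inter_subset_left))

lemma count_eq_sum {X κ : Type*} [MetricSpace X] [MeasurableSpace X] [BorelSpace X] [Fintype κ]
    {A : κ → Set X} (hA : ∀ k, MeasurableSet (A k)) (hb : ∀ k, Bornology.IsBounded (A k))
    (hd : Pairwise fun k l => Disjoint (A k) (A l)) (p : κ → Prop) [DecidablePred p]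
    {B : Set X} (hB : B = ⋃ k ∈ Finset.univ.filter p, A k) (θ : Config X) :
    count B θ = ∑ k with p k, count (A k) θ := by
  have hm : MeasurableSet B := hB ▸ Finset.measurableSet_biUnion _ fun k _ => hA k
  have hBb : Bornology.IsBounded B := by
    rw [hB, Bornology.isBounded_biUnion_finset]
    exact fun k _ => hb k
  have h := measure_biUnion_finset (μ := pts θ) (s := Finset.univ.filter p) (f := A)
    (fun k _ l _ hkl => hd hkl) fun k _ => hA k
  rw [← hB, pts_eq_count θ hm hBb] at h
  simp_rw [pts_eq_count θ (hA _) (hb _)] at h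
  exact_mod_cast h

end Restriction

section Independence

variable {Ω : Type*} [MeasurableSpace Ω] {μ : Measure Ω} [IsProbabilityMeasure μ]

lemma IsPoissonProcess.iIndepFun_count {T : Ω → Config ℝ} (hT : IsPoissonProcess μ T)
    {κ : Type*} [Fintype κ] {A : κ → Set ℝ} (hA : ∀ k, MeasurableSet (A k))
    (hb : ∀ k, Bornology.IsBounded (A k)) (hd : Pairwise fun k l => Disjoint (A k) (A l)) :
    iIndepFun (fun k ω => count (A k) (T ω)) μ := by
  let E := Fintype.equivFin κ
  have h := hT.2 (Fintype.card κ) (fun i => A (E.symm i)) (fun i => hA _) (fun i => hb _)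
    fun i j hij => hd (E.symm.injective.ne hij)
  have h2 := h.precomp E.injective
  simpa [Function.comp_def] using h2

/-- The counts of a Poisson process on finitely many subsets of `(0, s]` are independent of the
count on a disjoint set. -/
lemma IsPoissonProcess.indepFun_counts {T : Ω → Config ℝ} (hm : Measurable T)
    (hT : IsPoissonProcess μ T) {s : ℝ} {C : Set ℝ} (hC : MeasurableSet C)
    (hCb : Bornology.IsBounded C) (hsC : Disjoint (Ioc 0 s) C) {ι : Type*} [Finite ι]
    {B : ι → Set ℝ} (hB : ∀ i, MeasurableSet (B i)) (hBs : ∀ i, B i ⊆ Ioc 0 s) :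
    IndepFun (fun ω i => count (B i) (T ω)) (fun ω => count C (T ω)) μ := by
  classical
  have := Fintype.ofFinite ι
  -- The windows `B i` may overlap, whereas independence is given for disjoint sets. So pass to the
  -- atoms they generate in `(0, s]`, and let `none` stand for `C`.
  let A : Option (ι → Bool) → Set ℝ := fun o => o.elim C
    fun σ => {x ∈ Ioc 0 s | ∀ i, x ∈ B i ↔ σ i = true}
  have hA : ∀ o, MeasurableSet (A o) := by
    rintro (_ | σ)
    · exact hC
    · refine measurableSet_Ioc.inter ?_
      change MeasurableSet {x | ∀ i, x ∈ B i ↔ σ i = true}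
      rw [ofPred_forall]
      refine MeasurableSet.iInter fun i => ?_
      cases h : σ i
      · have : {x | x ∈ B i ↔ false = true} = (B i)ᶜ := by ext; simp
        rw [this]; exact (hB i).compl
      · have : {x | x ∈ B i ↔ true = true} = B i := by ext; simp
        rw [this]; exact hB i
  have hAs : ∀ σ, A (some σ) ⊆ Ioc 0 s := fun σ x hx => hx.1
  have hb : ∀ o, Bornology.IsBounded (A o) := by
    rintro (_ | σ)
    · exact hCb
    · exact (Metric.isBounded_Ioc 0 s).subset (hAs σ)
  have hd : Pairwise fun o o' => Disjoint (A o) (A o') := by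
    rintro (_ | σ) (_ | τ) hne
    · exact absurd rfl hne
    · exact (hsC.mono_left (hAs τ)).symm
    · exact hsC.mono_left (hAs σ)
    · rw [Set.disjoint_left]
      intro x hx hx'
      refine hne (congrArg some (funext fun i => ?_))
      have := (hx.2 i).symm.trans (hx'.2 i)
      rwa [Bool.eq_iff_iff]
  have hind := hT.iIndepFun_count hA hb hd
  have hmeas : ∀ o, Measurable fun ω => count (A o) (T ω) := fun o =>
    (measurable_count (hA o) (hb o)).comp hm
  have h2 := hind.indepFun_finset (Finset.univ.erase none) {none} (by simp) hmeas
  -- The count of `B i` is the sum of the counts of the atoms contained in it.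
  let φ : ({o // o ∈ (Finset.univ.erase none : Finset (Option (ι → Bool)))} → ℕ) → ι → ℕ :=
    fun v i => ∑ σ : ι → Bool with σ i = true, v ⟨some σ, by simp⟩
  let ψ : (({none} : Finset (Option (ι → Bool))) → ℕ) → ℕ := fun v => v ⟨none, by simp⟩
  have hφ : Measurable φ := by fun_prop
  have hψ : Measurable ψ := by fun_prop
  have h3 := h2.comp hφ hψ
  convert h3 using 1
  swap
  · rfl
  funext ω i
  refine count_eq_sum (fun σ => hA (some σ)) (fun σ => hb (some σ))
    (fun σ τ h => hd fun h' => h (Option.some_injective _ h')) (fun σ => σ i = true) ?_ (T ω)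
  ext x
  simp only [Finset.mem_filter, Finset.mem_univ, true_and, mem_iUnion, exists_prop]
  constructor
  · intro hx
    exact ⟨fun j => decide (x ∈ B j), by simpa using hx, hBs i hx, fun j => by simp⟩
  · rintro ⟨σ, hσ, hx⟩
    exact (hx.2 i).2 hσ

/-- A Poisson process on `(0, s]` is independent of the count on a disjoint set. -/
lemma IsPoissonProcess.indepFun_restrict {T : Ω → Config ℝ} (hm : Measurable T)
    (hT : IsPoissonProcess μ T) {s : ℝ} {C : Set ℝ} (hC : MeasurableSet C)
    (hCb : Bornology.IsBounded C) (hsC : Disjoint (Ioc 0 s) C) :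
    IndepFun (fun ω => restrict s (T ω)) (fun ω => count C (T ω)) μ := by
  classical
  let 𝓑 := {B : Set ℝ // MeasurableSet B ∧ B ⊆ Ioc 0 s}
  -- Finite families of windows generate a directed system of σ-algebras. Independence passes to its
  -- supremum, for which the restricted process is measurable.
  let m : Finset 𝓑 → MeasurableSpace Ω := fun F =>
    MeasurableSpace.comap (fun ω (B : F) => count B.1.1 (T ω)) inferInstance
  have hcount : ∀ B : 𝓑, Measurable fun ω => count B.1 (T ω) := fun B =>
    (measurable_count B.2.1 ((Metric.isBounded_Ioc 0 s).subset B.2.2)).comp hm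
  have hmono : Monotone m := by
    intro F G hFG
    have : Measurable[m G] fun ω (B : F) => count B.1.1 (T ω) := by
      have h : Measurable fun (v : G → ℕ) (B : F) => v ⟨B.1, hFG B.2⟩ := by fun_prop
      exact h.comp (comap_measurable _)
    exact this.comap_le
  have hle : ∀ F, m F ≤ ‹MeasurableSpace Ω› := fun F =>
    (measurable_pi_lambda _ fun B : F => hcount B.1).comap_le
  rw [IndepFun_iff_Indep]
  have key : Indep (⨆ F, m F) (MeasurableSpace.comap (fun ω => count C (T ω)) inferInstance) μ := by
    refine indep_iSup_of_directed_le (fun F => ?_) hle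
      ((measurable_count hC hCb).comp hm).comap_le hmono.directed_le
    exact (IndepFun_iff_Indep _ _ _).1 (hT.indepFun_counts hm hC hCb hsC
      (B := fun B : F => B.1.1) (fun B => B.1.2.1) fun B => B.1.2.2)
  refine indep_of_indep_of_le_left key ?_
  rw [← measurable_iff_comap_le]
  refine @measurable_config_of_count ℝ _ _ _ Ω (⨆ F, m F) _ fun B hB _ => ?_
  simp_rw [pts_restrict s _ hB]
  let b : 𝓑 := ⟨Ioc 0 s ∩ B, measurableSet_Ioc.inter hB, inter_subset_left⟩
  have h1 : Measurable[m {b}] fun ω => count (Ioc 0 s ∩ B) (T ω) := by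
    have h : Measurable fun v : ({b} : Finset 𝓑) → ℕ => v ⟨b, by simp⟩ := by fun_prop
    exact h.comp (comap_measurable fun ω (B : ({b} : Finset 𝓑)) => count B.1.1 (T ω))
  exact measurable_from_top.comp (h1.mono (le_iSup m {b}) le_rfl)

/-- The joint law of the three variables factorizes completely. In the application `X` and `Y` come
from the past and the future of one clock, and `Z` from all the other clocks. -/
lemma indepFun_prodMk_of_indepFun {α β δ : Type*} [MeasurableSpace α] [MeasurableSpace β]
    [MeasurableSpace δ] {X : Ω → α} {Y : Ω → β} {Z : Ω → δ} (hX : Measurable X) (hY : Measurable Y)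
    (hZ : Measurable Z) (hXY : IndepFun X Y μ) (hXYZ : IndepFun (fun ω => (X ω, Y ω)) Z μ) :
    IndepFun (fun ω => (X ω, Z ω)) Y μ := by
  have hXZ : IndepFun X Z μ := hXYZ.comp measurable_fst measurable_id
  rw [indepFun_iff_map_prod_eq_prod_map_map (by fun_prop) (by fun_prop)]
  have : IsProbabilityMeasure (μ.map fun ω => (X ω, Z ω)) :=
    Measure.isProbabilityMeasure_map (by fun_prop)
  refine Measure.ext_prod₃_iff'.2 fun {s t u} hs ht hu => ?_
  rw [Measure.prod_prod, Measure.map_apply (by fun_prop) ((hs.prod ht).prod hu),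
    Measure.map_apply (by fun_prop) (hs.prod ht), Measure.map_apply hY hu]
  have e1 : (fun ω => ((X ω, Z ω), Y ω)) ⁻¹' ((s ×ˢ t) ×ˢ u)
      = (fun ω => (X ω, Y ω)) ⁻¹' (s ×ˢ u) ∩ Z ⁻¹' t := by
    ext; simp; tauto
  have e2 : (fun ω => (X ω, Z ω)) ⁻¹' (s ×ˢ t) = X ⁻¹' s ∩ Z ⁻¹' t := rfl
  have e3 : (fun ω => (X ω, Y ω)) ⁻¹' (s ×ˢ u) = X ⁻¹' s ∩ Y ⁻¹' u := rfl
  rw [e1, hXYZ.measure_inter_preimage_eq_mul _ _ (hs.prod hu) ht, e2, e3,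
    hXZ.measure_inter_preimage_eq_mul _ _ hs ht, hXY.measure_inter_preimage_eq_mul _ _ hs hu]
  ring

lemma indepFun_single_others {α : Type*} [MeasurableSpace α] {T : ℕ → Ω → α}
    (hT : ∀ n, Measurable (T n)) (hind : iIndepFun T μ) (i : ℕ) :
    IndepFun (T i) (fun ω (j : {j // j ≠ i}) => T j ω) μ := by
  rw [IndepFun_iff_Indep]
  have h := indep_iSup_of_disjoint (m := fun n => MeasurableSpace.comap (T n) inferInstance)
    (fun n => (hT n).comap_le) hind (S := {i}) (T := {j | j ≠ i}) (by simp)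
  refine indep_of_indep_of_le_left (indep_of_indep_of_le_right h ?_) ?_
  · rw [← measurable_iff_comap_le]
    refine @measurable_pi_lambda _ _ _ (_) _ _ fun j => ?_
    refine (comap_measurable (T j)).mono ?_ le_rfl
    exact le_iSup₂_of_le (f := fun n (_ : n ∈ {j | j ≠ i}) =>
      MeasurableSpace.comap (T n) inferInstance) j.1 j.2 le_rfl
  · exact le_iSup₂_of_le (f := fun n (_ : n ∈ ({i} : Set ℕ)) =>
      MeasurableSpace.comap (T n) inferInstance) i rfl le_rfl

/-- The past `(0, s]` of a sequence of independent Poisson processes is independent of the count of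
one of them on a disjoint set. -/
lemma indepFun_restrict_all {T : ℕ → Ω → Config ℝ} (hT : ∀ n, Measurable (T n))
    (hpois : ∀ n, IsPoissonProcess μ (T n)) (hind : iIndepFun T μ) (i : ℕ) {s : ℝ} {C : Set ℝ}
    (hC : MeasurableSet C) (hCb : Bornology.IsBounded C) (hsC : Disjoint (Ioc 0 s) C) :
    IndepFun (fun ω n => restrict s (T n ω)) (fun ω => count C (T i ω)) μ := by
  classical
  have hXY := (hpois i).indepFun_restrict (hT i) hC hCb hsC
  have hc := measurable_count hC hCb
  have hr := measurable_restrict s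
  have hXYZ : IndepFun (fun ω => (restrict s (T i ω), count C (T i ω)))
      (fun ω (j : {j // j ≠ i}) => T j ω) μ :=
    (indepFun_single_others hT hind i).comp (φ := fun θ => (restrict s θ, count C θ))
      (hr.prodMk hc) measurable_id
  have h := indepFun_prodMk_of_indepFun (hr.comp (hT i)) (hc.comp (hT i))
    (measurable_pi_lambda _ fun j : {j // j ≠ i} => hT j) hXY hXYZ
  -- Reassembles the past of all clocks from the past of clock `i` and the other clocks.
  let φ : Config ℝ × ({j // j ≠ i} → Config ℝ) → ℕ → Config ℝ :=
    fun q n => if hn : n = i then q.1 else restrict s (q.2 ⟨n, hn⟩)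
  have hφ : Measurable φ := by
    refine measurable_pi_lambda _ fun n => ?_
    by_cases hn : n = i
    · simpa [φ, hn] using measurable_fst
    · simp only [φ, hn, dite_false]
      exact hr.comp ((measurable_pi_apply _).comp measurable_snd)
  have h2 := h.comp hφ measurable_id
  convert h2 using 1
  swap
  · rfl
  funext ω n
  by_cases hn : n = i
  · subst hn; simp [φ]
  · simp [φ, hn]

end Independence

end Harness

/-! ### Paths followed by the backward walk and their measurability. -/

namespace Harness

/-- The backward walk driven by the epochs `T`, started at the site `i` with the times in `I` still
to be explored, jumps successively to the sites in the list and then stops. -/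
def Follows (T : ℕ → Set ℝ) : ℕ → List ℕ → Set ℝ → Prop
  | i, [], I => T i ∩ I = ∅
  | i, j :: l, I => (T i ∩ I).Nonempty ∧ Follows T j l (Ioo 0 (sSup (T i ∩ I)))

/-- The walk consults the clock of `i` on `I` only and, after its first jump, no clock at or after
that jump time. -/
lemma follows_congr {T T' : ℕ → Set ℝ} {I I' : Set ℝ} {i : ℕ} {l : List ℕ}
    (h : T i ∩ I = T' i ∩ I') (hT : ∀ j J, J ⊆ Ioo 0 (sSup (T i ∩ I)) → T j ∩ J = T' j ∩ J) :
    Follows T i l I ↔ Follows T' i l I' := by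
  induction l generalizing i I I' with
  | nil => simp only [Follows, h]
  | cons j l ih =>
    simp only [Follows, h]
    refine and_congr_right fun hne => ?_
    rw [h] at hT
    refine ih (hT j _ subset_rfl) fun k J hJ => hT k J (hJ.trans ?_)
    rcases (T j ∩ Ioo 0 (sSup (T' i ∩ I'))).eq_empty_or_nonempty with h0 | h0
    · simp [h0]
    · exact Ioo_subset_Ioo_right (csSup_le h0 fun x hx => hx.2.2.le)

section Measurability

variable {α : Type*} [MeasurableSpace α]

lemma measurableSet_inter_nonempty {θ : α → Config ℝ} (hθ : Measurable θ) {I : α → Set ℝ}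
    (hI : MeasurableSet {q : α × ℝ | q.2 ∈ I q.1}) :
    MeasurableSet {a | ((θ a).1 ∩ I a).Nonempty} :=
  measurableSet_exists_config (p := fun a x => x ∈ I a) hI hθ

lemma measurable_sSup_inter {θ : α → Config ℝ} (hθ : Measurable θ) {I : α → Set ℝ}
    (hI : MeasurableSet {q : α × ℝ | q.2 ∈ I q.1}) (hIb : ∀ a, Bornology.IsBounded (I a)) :
    Measurable fun a => sSup ((θ a).1 ∩ I a) := by
  refine measurable_of_Ioi fun b => ?_
  have h1 : MeasurableSet {a | ((θ a).1 ∩ (I a ∩ Ioi b)).Nonempty} :=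
    measurableSet_inter_nonempty hθ (I := fun a => I a ∩ Ioi b)
      (hI.inter (measurableSet_Ioi.preimage measurable_snd))
  have h2 := measurableSet_inter_nonempty hθ hI
  -- The second set accounts for the convention `sSup ∅ = 0`.
  have h3 : (fun a => sSup ((θ a).1 ∩ I a)) ⁻¹' Ioi b =
      {a | ((θ a).1 ∩ (I a ∩ Ioi b)).Nonempty} ∪
        ({a | ((θ a).1 ∩ I a).Nonempty}ᶜ ∩ {_a | b < 0}) := by
    ext a
    simp only [mem_preimage, mem_Ioi, mem_union, mem_inter_iff, mem_compl_iff, mem_ofPred_eq]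
    rcases ((θ a).1 ∩ I a).eq_empty_or_nonempty with h0 | h0
    · have : (θ a).1 ∩ (I a ∩ Ioi b) = ∅ := by rw [← inter_assoc, h0, empty_inter]
      simp [h0, this]
    · have hfin : Set.Finite _ := (θ a).2 _ (hIb a)
      simp only [h0, not_true, false_and, or_false]
      rw [lt_csSup_iff hfin.bddAbove h0]
      constructor
      · rintro ⟨x, hx, hb⟩; exact ⟨x, hx.1, hx.2, hb⟩
      · rintro ⟨x, hx, hxI, hb⟩; exact ⟨x, ⟨hx, hxI⟩, hb⟩
  rw [h3]
  exact h1.union (h2.compl.inter (MeasurableSet.const _))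

lemma measurableSet_follows {T : α → ℕ → Config ℝ} (hT : Measurable T) (i : ℕ) (l : List ℕ)
    {I : α → Set ℝ} (hI : MeasurableSet {q : α × ℝ | q.2 ∈ I q.1})
    (hIb : ∀ a, Bornology.IsBounded (I a)) :
    MeasurableSet {a | Follows (fun n => (T a n).1) i l (I a)} := by
  have hi : ∀ i, Measurable fun a => T a i := fun i => (measurable_pi_apply i).comp hT
  induction l generalizing i I with
  | nil =>
    have := (measurableSet_inter_nonempty (hi i) hI).compl
    convert this using 1
    ext a
    simp [Follows, not_nonempty_iff_eq_empty]
  | cons j l ih =>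
    have hs := measurable_sSup_inter (hi i) hI hIb
    refine (measurableSet_inter_nonempty (hi i) hI).inter (ih j ?_ fun a => Metric.isBounded_Ioo _ _)
    exact (measurableSet_lt measurable_const measurable_snd).inter
      (measurableSet_lt measurable_snd (hs.comp measurable_fst))

end Measurability

/-! ### The probability of a given path. -/

section Law

variable {Ω : Type*} [MeasurableSpace Ω] {μ : Measure Ω} [IsProbabilityMeasure μ]

lemma IsPoissonProcess.measureReal_inter_eq_empty {T : Ω → Config ℝ} (hm : Measurable T)
    (hT : IsPoissonProcess μ T) {s : ℝ} {h : ℝ} (hh : 0 ≤ h) :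
    μ.real {ω | (T ω).1 ∩ Ioc s (s + h) = ∅} = Real.exp (-h) := by
  have hb := Metric.isBounded_Ioc s (s + h)
  have h1 := congrArg (fun ν => ν.real {0}) (hT.1 (Ioc s (s + h)) measurableSet_Ioc hb)
  simp only [poissonMeasure_real_singleton] at h1
  have hc : Measurable fun ω => count (Ioc s (s + h)) (T ω) :=
    (measurable_count measurableSet_Ioc hb).comp hm
  rw [map_measureReal_apply hc (measurableSet_singleton _), Real.volume_Ioc] at h1
  have h2 : (fun ω => count (Ioc s (s + h)) (T ω)) ⁻¹' {0} = {ω | (T ω).1 ∩ Ioc s (s + h) = ∅} := by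
    ext ω
    simp only [mem_preimage, mem_singleton_iff, count, mem_ofPred_eq]
    exact ncard_eq_zero ((T ω).2 _ hb)
  rw [h2] at h1
  rw [h1, add_sub_cancel_left, ENNReal.coe_toNNReal_eq_toReal, ENNReal.toReal_ofReal hh]
  simp

lemma follows_restrict (T : ℕ → Config ℝ) (i : ℕ) (l : List ℕ) (s : ℝ) :
    Follows (fun n => (restrict s (T n)).1) i l (Ioc 0 s) ↔
      Follows (fun n => (T n).1) i l (Ioc 0 s) := by
  have h : ∀ j (J : Set ℝ), J ⊆ Ioc 0 s → (restrict s (T j)).1 ∩ J = (T j).1 ∩ J := by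
    intro j J hJ
    change (T j).1 ∩ Ioc 0 s ∩ J = _
    rw [inter_assoc, inter_eq_right.2 hJ]
  refine follows_congr (h i _ subset_rfl) fun j J hJ => h j J (hJ.trans ?_)
  rw [h i _ subset_rfl]
  rcases ((T i).1 ∩ Ioc 0 s).eq_empty_or_nonempty with h0 | h0
  · simp [h0]
  · exact fun x hx => ⟨hx.1, hx.2.le.trans (csSup_le h0 fun y hy => hy.2.2)⟩

variable {T : ℕ → Ω → Config ℝ}

lemma measurableSet_follows_Ioc (hT : ∀ n, Measurable (T n)) (i : ℕ) (l : List ℕ) (s : ℝ) :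
    MeasurableSet {ω | Follows (fun n => (T n ω).1) i l (Ioc 0 s)} :=
  measurableSet_follows (T := fun ω n => T n ω) (measurable_pi_lambda _ hT) i l
    (measurableSet_Ioc.preimage measurable_snd) fun _ => Metric.isBounded_Ioc _ _

lemma measurableSet_inter_eq_empty (hT : ∀ n, Measurable (T n)) (i : ℕ) (s h : ℝ) :
    MeasurableSet {ω | (T i ω).1 ∩ Ioc s (s + h) = ∅} := by
  convert (measurableSet_inter_nonempty (hT i) (I := fun _ => Ioc s (s + h))
    (measurableSet_Ioc.preimage measurable_snd)).compl using 1
  ext ω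
  simp [not_nonempty_iff_eq_empty]

/-- Following a path from time `s` depends only on the clocks restricted to `(0, s]`, by
`follows_restrict`. -/
lemma indepSet_follows (hT : ∀ n, Measurable (T n)) (hpois : ∀ n, IsPoissonProcess μ (T n))
    (hind : iIndepFun T μ) (i j : ℕ) (l : List ℕ) (s h : ℝ) :
    IndepSet {ω | Follows (fun n => (T n ω).1) j l (Ioc 0 s)}
      {ω | (T i ω).1 ∩ Ioc s (s + h) = ∅} μ := by
  have hb := Metric.isBounded_Ioc s (s + h)
  have hI := indepFun_restrict_all hT hpois hind i (s := s) measurableSet_Ioc hb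
    (by rw [Set.disjoint_left]; exact fun x hx hx' => absurd hx.2 (not_le.2 hx'.1))
  refine (indepFun_iff_indepSet_preimage (measurable_pi_lambda _ fun n =>
    (measurable_restrict s).comp (hT n)) ((measurable_count measurableSet_Ioc hb).comp (hT i))).1 hI
    {θ | Follows (fun n => (θ n).1) j l (Ioc 0 s)} {0}
    (measurableSet_follows measurable_id j l (measurableSet_Ioc.preimage measurable_snd)
      fun _ => Metric.isBounded_Ioc _ _) (measurableSet_singleton 0) |> cast ?_
  congr 1
  · ext ω
    exact follows_restrict (fun n => T n ω) j l s
  · ext ω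
    exact ncard_eq_zero ((T i ω).2 _ hb)

lemma IsPoissonProcess.measureReal_inter_nonempty {T : Ω → Config ℝ} (hm : Measurable T)
    (hT : IsPoissonProcess μ T) {s : ℝ} {h : ℝ} (hh : 0 ≤ h) :
    μ.real {ω | (T ω).1 ∩ Ioc s (s + h) = ∅}ᶜ = 1 - Real.exp (-h) := by
  rw [probReal_compl_eq_one_sub, hT.measureReal_inter_eq_empty hm hh]
  exact measurableSet_inter_eq_empty (T := fun _ => T) (fun _ => hm) 0 s h

lemma inter_Ioc_add {A : Set ℝ} {s h : ℝ} (hs : 0 ≤ s) (hh : 0 ≤ h) (hA : A ∩ Ioc s (s + h) = ∅) :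
    A ∩ Ioc 0 (s + h) = A ∩ Ioc 0 s := by
  rw [← Ioc_union_Ioc_eq_Ioc hs (le_add_of_nonneg_right hh), inter_union_distrib_left, hA,
    union_empty]

/-- The first jump happens in the last `h` units of time. The window left to `j` exceeds `(0, s]`
only where `j` has no epoch. -/
lemma follows_cons_iff_of_jump {T : ℕ → Config ℝ} {i j : ℕ} {l : List ℕ} {s h : ℝ} (hs : 0 ≤ s)
    (hi : (T i).1 ∩ Ioc s (s + h) ≠ ∅) (hj : (T j).1 ∩ Ioc s (s + h) = ∅) :
    Follows (fun n => (T n).1) i (j :: l) (Ioc 0 (s + h)) ↔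
      Follows (fun n => (T n).1) j l (Ioc 0 s) := by
  obtain ⟨x, hx⟩ := nonempty_iff_ne_empty.2 hi
  have hx' : x ∈ (T i).1 ∩ Ioc 0 (s + h) := ⟨hx.1, hs.trans_lt hx.2.1, hx.2.2⟩
  have hb : BddAbove ((T i).1 ∩ Ioc 0 (s + h)) := ⟨s + h, fun y hy => hy.2.2⟩
  have h1 : s < sSup ((T i).1 ∩ Ioc 0 (s + h)) := hx.2.1.trans_le (le_csSup hb hx')
  have h2 : sSup ((T i).1 ∩ Ioc 0 (s + h)) ≤ s + h := csSup_le ⟨x, hx'⟩ fun y hy => hy.2.2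
  simp only [Follows]
  rw [and_iff_right ⟨x, hx'⟩]
  refine follows_congr ?_ fun _ _ _ => rfl
  ext y
  constructor
  · rintro ⟨hy, hy0, hys⟩
    refine ⟨hy, hy0, ?_⟩
    by_contra! hsy
    have : y ∈ (T j).1 ∩ Ioc s (s + h) := ⟨hy, hsy, hys.le.trans h2⟩
    rw [hj] at this
    exact this
  · rintro ⟨hy, hy0, hys⟩
    exact ⟨hy, hy0, hys.trans_lt h1⟩

/-- The increment of the probability of a path in a short time. -/
lemma abs_measureReal_follows_sub_le (hT : ∀ n, Measurable (T n))
    (hpois : ∀ n, IsPoissonProcess μ (T n)) (hind : iIndepFun T μ) {i j : ℕ} (hij : i ≠ j)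
    (l : List ℕ) {s h : ℝ} (hs : 0 ≤ s) (hh : 0 ≤ h) :
    |μ.real {ω | Follows (fun n => (T n ω).1) i (j :: l) (Ioc 0 (s + h))} -
      (μ.real {ω | Follows (fun n => (T n ω).1) i (j :: l) (Ioc 0 s)} * Real.exp (-h) +
        μ.real {ω | Follows (fun n => (T n ω).1) j l (Ioc 0 s)} * (1 - Real.exp (-h)))|
      ≤ h ^ 2 := by
  set E' := {ω | Follows (fun n => (T n ω).1) i (j :: l) (Ioc 0 (s + h))}
  set E := {ω | Follows (fun n => (T n ω).1) i (j :: l) (Ioc 0 s)} with hE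
  set V := {ω | Follows (fun n => (T n ω).1) j l (Ioc 0 s)} with hV
  set A := {ω | (T i ω).1 ∩ Ioc s (s + h) = ∅} with hA
  set B := {ω | (T j ω).1 ∩ Ioc s (s + h) = ∅} with hB
  have hEm : MeasurableSet E := measurableSet_follows_Ioc hT i (j :: l) s
  have hE'm : MeasurableSet E' := measurableSet_follows_Ioc hT i (j :: l) (s + h)
  have hVm : MeasurableSet V := measurableSet_follows_Ioc hT j l s
  have hAm : MeasurableSet A := measurableSet_inter_eq_empty hT i s h
  have hBm : MeasurableSet B := measurableSet_inter_eq_empty hT j s h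
  have pA : μ.real A = Real.exp (-h) := (hpois i).measureReal_inter_eq_empty (hT i) hh
  have pA' : μ.real Aᶜ = 1 - Real.exp (-h) := (hpois i).measureReal_inter_nonempty (hT i) hh
  have pB' : μ.real Bᶜ = 1 - Real.exp (-h) := (hpois j).measureReal_inter_nonempty (hT j) hh
  have pEA : μ.real (E ∩ A) = μ.real E * Real.exp (-h) := by
    rw [← pA, measureReal_def, (indepSet_follows hT hpois hind i i (j :: l) s h).measure_inter_eq_mul,
      ENNReal.toReal_mul]; rfl
  have pVA : μ.real (V ∩ Aᶜ) = μ.real V * (1 - Real.exp (-h)) := by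
    have h1 : μ.real (V ∩ A) = μ.real V * Real.exp (-h) := by
      rw [← pA, measureReal_def, (indepSet_follows hT hpois hind i j l s h).measure_inter_eq_mul,
        ENNReal.toReal_mul]; rfl
    have h2 := measureReal_inter_add_sdiff (μ := μ) (s := V) hAm
    rw [← sdiff_eq]
    linarith
  have pAB : μ.real (Aᶜ ∩ Bᶜ) = (1 - Real.exp (-h)) ^ 2 := by
    have hIJ : IndepFun (T i) (T j) μ := hind.indepFun hij
    have hSm : MeasurableSet {θ : Config ℝ | θ.1 ∩ Ioc s (s + h) = ∅}ᶜ :=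
      (measurableSet_inter_eq_empty (T := fun _ θ => θ) (fun _ => measurable_id) 0 s h).compl
    have := hIJ.measure_inter_preimage_eq_mul _ _ hSm hSm
    have h3 : μ (Aᶜ ∩ Bᶜ) = μ Aᶜ * μ Bᶜ := this
    rw [measureReal_def, h3, ENNReal.toReal_mul, sq]
    exact congrArg₂ (· * ·) pA' pB'
  have hdisj : Disjoint (E ∩ A) (V ∩ Aᶜ) :=
    (_root_.disjoint_compl_right (a := A)).mono inter_subset_right inter_subset_right
  have hU : μ.real ((E ∩ A) ∪ (V ∩ Aᶜ)) =
      μ.real E * Real.exp (-h) + μ.real V * (1 - Real.exp (-h)) := by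
    rw [measureReal_union hdisj (hVm.inter hAm.compl), pEA, pVA]
  rw [← hU]
  -- If `i` has no epoch in the short window, the path is followed from time `s`; if only `i` has
  -- one, the tail is. The comparison can fail only when both clocks ring, and since `i ≠ j` that
  -- has probability of order `h ^ 2`.
  have hsub : symmDiff E' ((E ∩ A) ∪ (V ∩ Aᶜ)) ⊆ Aᶜ ∩ Bᶜ := by
    intro ω hω
    by_contra hn
    have hiff : ω ∈ E' ↔ ω ∈ (E ∩ A) ∪ (V ∩ Aᶜ) := by
      by_cases hωA : ω ∈ A
      · have : ω ∈ E' ↔ ω ∈ E :=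
          follows_congr (inter_Ioc_add (A := (T i ω).1) hs hh hωA) fun _ _ _ => rfl
        simp [this, hωA]
      · have hωB : ω ∈ B := by
          by_contra hωB
          exact hn ⟨hωA, hωB⟩
        have : ω ∈ E' ↔ ω ∈ V :=
          follows_cons_iff_of_jump (T := fun n => T n ω) hs hωA hωB
        simp [this, hωA]
    rcases hω with hω | hω
    · exact hω.2 (hiff.1 hω.1)
    · exact hω.2 (hiff.2 hω.1)
  calc _ ≤ μ.real (symmDiff E' ((E ∩ A) ∪ (V ∩ Aᶜ))) :=
        abs_measureReal_sub_le_measureReal_symmDiff hE'm.nullMeasurableSet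
          ((hEm.inter hAm).union (hVm.inter hAm.compl)).nullMeasurableSet
    _ ≤ μ.real (Aᶜ ∩ Bᶜ) := measureReal_mono hsub
    _ = (1 - Real.exp (-h)) ^ 2 := pAB
    _ ≤ h ^ 2 := by
        refine pow_le_pow_left₀ ?_ ?_ 2
        · have := Real.exp_le_one_iff.2 (neg_nonpos.2 hh); linarith
        · have := Real.one_sub_le_exp_neg h; linarith

end Law

/-- The increments encode the equation `a' = -a + exp (-s) * p`, that is `(exp s * a)' = p`. They
give only right derivatives, so the proof adds continuity of `a` and uses that a continuous function
with zero right derivative is constant. -/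
lemma exp_mul_eq_of_increments {a p : ℝ → ℝ} (P : ℝ → ℝ)
    (hP : ∀ s, HasDerivAt P (p s) s) (hP0 : P 0 = 0) (ha0 : a 0 = 0)
    (h01 : ∀ s, |a s| ≤ 1) (hp : ∀ s, 0 ≤ s → |Real.exp (-s) * p s| ≤ 1)
    (h : ∀ s h, 0 ≤ s → 0 ≤ h →
      |a (s + h) - (a s * Real.exp (-h) + Real.exp (-s) * p s * (1 - Real.exp (-h)))| ≤ h ^ 2)
    {t : ℝ} (ht : 0 ≤ t) : Real.exp t * a t = P t := by
  have hlip : ∀ s h, 0 ≤ s → 0 ≤ h → |a (s + h) - a s| ≤ 2 * h + h ^ 2 := by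
    intro s k hs hk
    have h1 := h s k hs hk
    have h2 : 0 ≤ 1 - Real.exp (-k) := by
      have := Real.exp_le_one_iff.2 (neg_nonpos.2 hk); linarith
    have h3 : 1 - Real.exp (-k) ≤ k := by
      have := Real.one_sub_le_exp_neg k; linarith
    have h4 : |a s * (1 - Real.exp (-k))| ≤ k := by
      rw [abs_mul, abs_of_nonneg h2]
      nlinarith [h01 s, abs_nonneg (a s)]
    have h5 : |Real.exp (-s) * p s * (1 - Real.exp (-k))| ≤ k := by
      rw [abs_mul, abs_of_nonneg h2]
      nlinarith [hp s hs, abs_nonneg (Real.exp (-s) * p s)]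
    rw [abs_le] at *
    constructor <;> nlinarith
  have hcont : ContinuousOn a (Icc 0 t) := by
    intro s hs
    rw [Metric.continuousWithinAt_iff]
    intro ε hε
    refine ⟨min 1 (ε / 3), by positivity, fun {y} hy hys => ?_⟩
    rw [Real.dist_eq, lt_min_iff] at *
    have h3 : 3 * |y - s| < ε := by linarith [hys.2]
    have key : |a y - a s| ≤ 2 * |y - s| + |y - s| ^ 2 := by
      rcases le_total s y with hle | hle
      · have := hlip s (y - s) hs.1 (sub_nonneg.2 hle)
        rwa [add_sub_cancel, ← abs_of_nonneg (sub_nonneg.2 hle)] at this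
      · have := hlip y (s - y) hy.1 (sub_nonneg.2 hle)
        rw [add_sub_cancel] at this
        rwa [abs_sub_comm, abs_sub_comm y s, abs_of_nonneg (sub_nonneg.2 hle)]
    nlinarith [abs_nonneg (y - s)]
  have hderiv : ∀ s ∈ Ico 0 t,
      HasDerivWithinAt (fun s => Real.exp s * a s - P s) 0 (Ici s) s := by
    intro s hs
    -- The error of the increment formula multiplied by `exp y`; being of second order, it has zero
    -- right derivative at `s`.
    let R : ℝ → ℝ := fun y => Real.exp y * a y - Real.exp s * a s - (Real.exp (y - s) - 1) * p s
    have hR : HasDerivWithinAt R 0 (Ici s) s := by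
      have hO : R =O[nhdsWithin s (Ici s)] fun y => ‖y - s‖ ^ 2 := by
        refine Asymptotics.IsBigO.of_bound (Real.exp (s + 1)) ?_
        filter_upwards [self_mem_nhdsWithin, nhdsWithin_le_nhds (Iio_mem_nhds (lt_add_one s))]
          with y hy hy1
        have hys : 0 ≤ y - s := sub_nonneg.2 hy
        have h1 := h s (y - s) hs.1 hys
        rw [add_sub_cancel] at h1
        have h2 : R y = Real.exp y * (a y - (a s * Real.exp (-(y - s)) +
            Real.exp (-s) * p s * (1 - Real.exp (-(y - s))))) := by
          have e1 : Real.exp y * Real.exp (-(y - s)) = Real.exp s := by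
            rw [← Real.exp_add]; congr 1; ring
          have e2 : Real.exp y * Real.exp (-s) = Real.exp (y - s) := by
            rw [← Real.exp_add]; congr 1
          have e3 : Real.exp y * Real.exp (-s) * Real.exp (-(y - s)) = 1 := by
            rw [← Real.exp_add, ← Real.exp_add, ← Real.exp_zero]; congr 1; ring
          simp only [R]
          linear_combination (a s) * e1 + p s * e2 - p s * e3
        rw [h2, Real.norm_eq_abs, abs_mul, abs_of_pos (Real.exp_pos y), norm_pow, norm_norm,
          Real.norm_eq_abs, abs_of_nonneg hys]
        exact mul_le_mul (Real.exp_le_exp.2 (le_of_lt hy1)) h1 (abs_nonneg _) (Real.exp_pos _).le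
      have := (hO.hasFDerivWithinAt (𝕜 := ℝ) self_mem_Ici one_lt_two).hasDerivWithinAt
      simpa using this
    have h1 : HasDerivWithinAt (fun y => Real.exp s * a s + (Real.exp (y - s) - 1) * p s) (p s)
        (Ici s) s := by
      have h2 : HasDerivAt (fun y => Real.exp (y - s)) 1 s := by
        have := ((hasDerivAt_id s).sub_const s).exp
        simpa using this
      have h3 := ((h2.sub_const 1).mul_const (p s)).const_add (Real.exp s * a s)
      simpa using h3.hasDerivWithinAt
    have h4 := (h1.add hR).sub (hP s).hasDerivWithinAt
    have h5 : p s + 0 - p s = 0 := by ring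
    rw [h5] at h4
    refine h4.congr (fun y _ => ?_) ?_ <;> simp only [R, Pi.add_apply, Pi.sub_apply] <;> ring
  have hPc : Continuous P := continuous_iff_continuousAt.2 fun s => (hP s).continuousAt
  have := constant_of_has_deriv_right_zero
    ((Real.continuous_exp.continuousOn.mul hcont).sub hPc.continuousOn) hderiv t ⟨ht, le_rfl⟩
  simp only [ha0, hP0, mul_zero, sub_zero, Pi.sub_apply, Pi.mul_apply] at this
  linarith

section Law

variable {Ω : Type*} [MeasurableSpace Ω] {μ : Measure Ω} [IsProbabilityMeasure μ]
  {T : ℕ → Ω → Config ℝ}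

/-- The probability that the backward walk follows a given path. -/
theorem measureReal_follows (hT : ∀ n, Measurable (T n))
    (hpois : ∀ n, IsPoissonProcess μ (T n)) (hind : iIndepFun T μ) (i : ℕ) (l : List ℕ)
    (hl : (i :: l).IsChain (· ≠ ·)) {t : ℝ} (ht : 0 ≤ t) :
    μ.real {ω | Follows (fun n => (T n ω).1) i l (Ioc 0 t)} =
      Real.exp (-t) * t ^ l.length / l.length.factorial := by
  induction l generalizing i t with
  | nil =>
    have := (hpois i).measureReal_inter_eq_empty (hT i) (s := 0) ht
    simpa [Follows] using this
  | cons j l ih =>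
    rw [List.isChain_cons_cons] at hl
    set n := l.length with hn
    -- By induction `exp (-s) * p s` is the probability of the tail of the path; `P` is the
    -- antiderivative of `p` vanishing at zero.
    let p : ℝ → ℝ := fun s => s ^ n / n.factorial
    let P : ℝ → ℝ := fun s => s ^ (n + 1) / (n + 1).factorial
    have hP : ∀ s, HasDerivAt P (p s) s := by
      intro s
      have h1 := (hasDerivAt_pow (n + 1) s).div_const ((n + 1).factorial : ℝ)
      refine h1.congr_deriv ?_
      simp only [p, Nat.factorial_succ, Nat.add_sub_cancel]
      push_cast
      have : (n.factorial : ℝ) ≠ 0 := by positivity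
      have : (n : ℝ) + 1 ≠ 0 := by positivity
      field_simp
    have hv : ∀ s, 0 ≤ s → μ.real {ω | Follows (fun n => (T n ω).1) j l (Ioc 0 s)} =
        Real.exp (-s) * p s := fun s hs => by rw [ih j hl.2 hs, mul_div_assoc]
    have key := exp_mul_eq_of_increments
      (a := fun s => μ.real {ω | Follows (fun n => (T n ω).1) i (j :: l) (Ioc 0 s)})
      (p := p) P hP (by simp [P]) (by simp [Follows])
      (fun s => by rw [abs_of_nonneg measureReal_nonneg]; exact measureReal_le_one)
      (fun s hs => by
        rw [← hv s hs, abs_of_nonneg measureReal_nonneg]; exact measureReal_le_one)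
      (fun s h hs hh => by
        rw [← hv s hs]
        exact abs_measureReal_follows_sub_le hT hpois hind hl.1 l hs hh) ht
    simp only [P] at key
    rw [List.length_cons, mul_div_assoc, ← key, ← mul_assoc, ← Real.exp_add, neg_add_cancel,
      Real.exp_zero, one_mul]

/-- The probability that the backward walk follows a given path. -/
theorem measure_follows (hT : ∀ n, Measurable (T n))
    (hpois : ∀ n, IsPoissonProcess μ (T n)) (hind : iIndepFun T μ) (i : ℕ) (l : List ℕ)
    (hl : (i :: l).IsChain (· ≠ ·)) (t : ℝ≥0) :
    μ {ω | Follows (fun n => (T n ω).1) i l (Ioc 0 (t : ℝ))} =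
      poissonMeasure t {l.length} := by
  rw [poissonMeasure_singleton, ← measureReal_follows hT hpois hind i l hl t.coe_nonneg,
    ofReal_measureReal]

end Law

end Harness

namespace Harness

/-! ### Sums over paths, and the convexity inequalities. -/

section Lists

lemma tsum_list (F : List ℕ → ℝ≥0∞) : ∑' l, F l = F [] + ∑' j, ∑' l, F (j :: l) := by
  classical
  rw [ENNReal.tsum_eq_add_tsum_ite []]
  congr 1
  let g : ℕ × List ℕ → List ℕ := fun q => q.1 :: q.2
  have hg : Function.Injective g := by
    rintro ⟨j, l⟩ ⟨j', l'⟩ h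
    simpa [g] using h
  rw [← hg.tsum_eq]
  · simp only [g, reduceCtorEq, if_false]
    exact ENNReal.tsum_prod (f := fun j l => F (j :: l))
  · intro l hl
    cases l with
    | nil => simp at hl
    | cons j l => exact ⟨(j, l), rfl⟩

/-- The sum over the lists of length `n`. -/
noncomputable def lengthSum (n : ℕ) (F : List ℕ → ℝ≥0∞) : ℝ≥0∞ :=
  ∑' l, if l.length = n then F l else 0

lemma lengthSum_zero (F : List ℕ → ℝ≥0∞) : lengthSum 0 F = F [] := by
  rw [lengthSum, tsum_list]
  simp

lemma lengthSum_succ (n : ℕ) (F : List ℕ → ℝ≥0∞) :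
    lengthSum (n + 1) F = ∑' j, lengthSum n fun l => F (j :: l) := by
  rw [lengthSum, tsum_list]
  simp [lengthSum]

lemma lengthSum_mul_left (n : ℕ) (a : ℝ≥0∞) (F : List ℕ → ℝ≥0∞) :
    (lengthSum n fun l => a * F l) = a * lengthSum n F := by
  rw [lengthSum, lengthSum, ← ENNReal.tsum_mul_left]
  simp

lemma lengthSum_add (n : ℕ) (F G : List ℕ → ℝ≥0∞) :
    (lengthSum n fun l => F l + G l) = lengthSum n F + lengthSum n G := by
  rw [lengthSum, lengthSum, lengthSum, ← ENNReal.tsum_add]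
  congr with l
  split_ifs <;> simp

lemma tsum_list_eq_tsum_lengthSum (F : List ℕ → ℝ≥0∞) : ∑' l, F l = ∑' n, lengthSum n F := by
  simp only [lengthSum]
  rw [ENNReal.tsum_comm]
  exact tsum_congr fun l => by simp

/-- A finite set of lists has bounded length. This form matches the supremum over the number of
jumps in `transProb`. -/
lemma tsum_list_eq_iSup (F : List ℕ → ℝ≥0∞) :
    ∑' l, F l = ⨆ n : ℕ, ∑' l, if l.length ≤ n then F l else 0 := by
  apply le_antisymm
  · rw [ENNReal.tsum_eq_iSup_sum]
    refine iSup_le fun s => ?_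
    refine le_trans ?_ (le_iSup _ (s.sup List.length))
    refine le_trans (Finset.sum_le_sum fun l hl => ?_) (ENNReal.sum_le_tsum s)
    rw [if_pos (Finset.le_sup (f := List.length) hl)]
  · refine iSup_le fun n => ENNReal.tsum_le_tsum fun l => ?_
    split_ifs <;> simp

/-- The product of the transition probabilities along a path. -/
noncomputable def pathWeight (p : ℕ → ℕ → ℝ≥0∞) : ℕ → List ℕ → ℝ≥0∞
  | _, [] => 1
  | i, j :: l => p i j * pathWeight p j l

/-- The sum of the values of `u` at the steps of a path. -/
noncomputable def pathEnergy (u : ℕ → ℕ → ℝ≥0∞) : ℕ → List ℕ → ℝ≥0∞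
  | _, [] => 0
  | i, j :: l => u i j + pathEnergy u j l

/-- The mean of the energy of the first `n` steps of the walk. -/
noncomputable def meanEnergy (p u : ℕ → ℕ → ℝ≥0∞) : ℕ → ℕ → ℝ≥0∞
  | 0, _ => 0
  | n + 1, i => ∑' j, p i j * (u i j + meanEnergy p u n j)

/-- Paths of positive weight never jump to the site where they are, which is the condition under
which the probability of a path is computed. -/
lemma isChain_of_pathWeight_ne_zero {p : ℕ → ℕ → ℝ≥0∞} (hp : ∀ i, p i i = 0) {i : ℕ} {l : List ℕ}
    (h : pathWeight p i l ≠ 0) : (i :: l).IsChain (· ≠ ·) := by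
  induction l generalizing i with
  | nil => exact List.isChain_singleton _
  | cons j l ih =>
    rw [pathWeight, mul_ne_zero_iff] at h
    rw [List.isChain_cons_cons]
    refine ⟨?_, ih h.2⟩
    rintro rfl
    exact h.1 (hp _)

lemma lengthSum_pathWeight {p : ℕ → ℕ → ℝ≥0∞} (hp : ∀ i, ∑' j, p i j = 1) (n i : ℕ) :
    lengthSum n (pathWeight p i) = 1 := by
  induction n generalizing i with
  | zero => simp [lengthSum_zero, pathWeight]
  | succ n ih =>
    simp only [lengthSum_succ, pathWeight, lengthSum_mul_left, ih, mul_one, hp]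

lemma lengthSum_pathWeight_mul_pathEnergy {p : ℕ → ℕ → ℝ≥0∞} (hp : ∀ i, ∑' j, p i j = 1)
    (u : ℕ → ℕ → ℝ≥0∞) (n i : ℕ) :
    (lengthSum n fun l => pathWeight p i l * pathEnergy u i l) = meanEnergy p u n i := by
  induction n generalizing i with
  | zero => simp [lengthSum_zero, pathEnergy, meanEnergy]
  | succ n ih =>
    simp only [lengthSum_succ, pathWeight, pathEnergy, meanEnergy]
    refine tsum_congr fun j => ?_
    have h : ∀ l, p i j * pathWeight p j l * (u i j + pathEnergy u j l) =
        p i j * (u i j * pathWeight p j l + pathWeight p j l * pathEnergy u j l) := fun l => by ring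
    simp_rw [h]
    rw [lengthSum_mul_left, lengthSum_add, lengthSum_mul_left, ih, lengthSum_pathWeight hp, mul_one]

lemma tsum_pathWeight_mul {p : ℕ → ℕ → ℝ≥0∞} (hp : ∀ i, ∑' j, p i j = 1) (a : ℕ → ℝ≥0∞) (i : ℕ) :
    ∑' l, pathWeight p i l * a l.length = ∑' n, a n := by
  rw [tsum_list_eq_tsum_lengthSum]
  refine tsum_congr fun n => ?_
  have : (lengthSum n fun l => pathWeight p i l * a l.length) =
      lengthSum n fun l => a n * pathWeight p i l := by
    refine tsum_congr fun l => ?_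
    split_ifs with h
    · simp only [h, mul_comm]
    · rfl
  rw [this, lengthSum_mul_left, lengthSum_pathWeight hp, mul_one]

lemma tsum_pathWeight_mul_pathEnergy {p : ℕ → ℕ → ℝ≥0∞} (hp : ∀ i, ∑' j, p i j = 1)
    (u : ℕ → ℕ → ℝ≥0∞) (a : ℕ → ℝ≥0∞) (i : ℕ) :
    ∑' l, pathWeight p i l * pathEnergy u i l * a l.length = ∑' n, a n * meanEnergy p u n i := by
  rw [tsum_list_eq_tsum_lengthSum]
  refine tsum_congr fun n => ?_
  have : (lengthSum n fun l => pathWeight p i l * pathEnergy u i l * a l.length) =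
      lengthSum n fun l => a n * (pathWeight p i l * pathEnergy u i l) := by
    refine tsum_congr fun l => ?_
    split_ifs with h
    · simp only [h, mul_comm]
    · rfl
  rw [this, lengthSum_mul_left, lengthSum_pathWeight_mul_pathEnergy hp]

/-- The power mean inequality for the steps of the path, once the energy is written as a sum over
`Fin l.length`. -/
lemma pathEnergy_rpow_le (u : ℕ → ℕ → ℝ≥0∞) {r : ℝ} (hr : 1 ≤ r) (i : ℕ) (l : List ℕ) :
    pathEnergy u i l ^ r ≤
      (l.length : ℝ≥0∞) ^ (r - 1) * pathEnergy (fun i j => u i j ^ r) i l := by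
  have h : ∀ (i : ℕ) (l : List ℕ), ∃ v : Fin l.length → ℝ≥0∞, pathEnergy u i l = ∑ k, v k ∧
      pathEnergy (fun i j => u i j ^ r) i l = ∑ k, v k ^ r := by
    intro i l
    induction l generalizing i with
    | nil => exact ⟨fun _ => 0, by simp [pathEnergy], by simp [pathEnergy]⟩
    | cons j l ih =>
      obtain ⟨v, h1, h2⟩ := ih j
      refine ⟨Fin.cons (u i j) v, ?_, ?_⟩
      · change _ = ∑ k : Fin (l.length + 1), _
        rw [Fin.sum_univ_succ]
        simp [pathEnergy, h1]
      · change _ = ∑ k : Fin (l.length + 1), _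
        rw [Fin.sum_univ_succ]
        simp [pathEnergy, h2]
  obtain ⟨v, h1, h2⟩ := h i l
  rw [h1, h2]
  simpa using ENNReal.rpow_sum_le_const_mul_sum_rpow Finset.univ v hr

/-- Jensen's inequality for countable or larger families: weighted Hölder on finite sums, then a
supremum. Mass at most one suffices. -/
lemma tsum_mul_rpow_le {ι : Type*} {w f : ι → ℝ≥0∞} (hw : ∑' i, w i ≤ 1) {r : ℝ} (hr : 1 ≤ r) :
    (∑' i, w i * f i) ^ r ≤ ∑' i, w i * f i ^ r := by
  have hr0 : 0 < r := zero_lt_one.trans_le hr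
  rw [← ENNReal.le_rpow_inv_iff hr0, ENNReal.tsum_eq_iSup_sum]
  refine iSup_le fun s => (ENNReal.inner_le_weight_mul_Lp_of_nonneg s hr w f).trans ?_
  have h1 : (∑ i ∈ s, w i) ^ (1 - r⁻¹) ≤ 1 :=
    ENNReal.rpow_le_one ((ENNReal.sum_le_tsum s).trans hw) (sub_nonneg.2 (inv_le_one_of_one_le₀ hr))
  calc _ ≤ 1 * (∑ i ∈ s, w i * f i ^ r) ^ r⁻¹ := mul_le_mul_left h1 _
    _ ≤ _ := by
      rw [one_mul]
      exact ENNReal.rpow_le_rpow (ENNReal.sum_le_tsum s) (inv_nonneg.2 hr0.le)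

end Lists

/-! ### The transition law as a sum over paths, with the clocks fixed. -/

section Walk

open Classical in
/-- The probability, given the epochs `T`, that the backward walk started at `i` with the times
in `I` to be explored follows the path `l`. -/
noncomputable def pathProb (p : ℕ → ℕ → ℝ≥0∞) (T : ℕ → Set ℝ) (I : Set ℝ) (i : ℕ) (l : List ℕ) :
    ℝ≥0∞ :=
  pathWeight p i l * if Follows T i l I then 1 else 0

lemma pathProb_nil_of_empty {p : ℕ → ℕ → ℝ≥0∞} {T : ℕ → Set ℝ} {I : Set ℝ} {i : ℕ}
    (h : T i ∩ I = ∅) : pathProb p T I i [] = 1 := by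
  simp [pathProb, pathWeight, Follows, h]

lemma pathProb_nil_of_nonempty {p : ℕ → ℕ → ℝ≥0∞} {T : ℕ → Set ℝ} {I : Set ℝ} {i : ℕ}
    (h : T i ∩ I ≠ ∅) : pathProb p T I i [] = 0 := by
  simp [pathProb, Follows, h]

lemma pathProb_cons_of_empty {p : ℕ → ℕ → ℝ≥0∞} {T : ℕ → Set ℝ} {I : Set ℝ} {i j : ℕ}
    {l : List ℕ} (h : T i ∩ I = ∅) : pathProb p T I i (j :: l) = 0 := by
  simp [pathProb, Follows, h]

lemma pathProb_cons_of_nonempty {p : ℕ → ℕ → ℝ≥0∞} {T : ℕ → Set ℝ} {I : Set ℝ} {i j : ℕ}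
    {l : List ℕ} (h : T i ∩ I ≠ ∅) :
    pathProb p T I i (j :: l) = p i j * pathProb p T (Ioo 0 (sSup (T i ∩ I))) j l := by
  rw [pathProb, pathProb, pathWeight, mul_assoc]
  have hF : Follows T i (j :: l) I ↔ Follows T j l (Ioo 0 (sSup (T i ∩ I))) :=
    and_iff_right (nonempty_iff_ne_empty.2 h)
  by_cases h2 : Follows T j l (Ioo 0 (sSup (T i ∩ I)))
  · rw [if_pos h2, if_pos (hF.2 h2)]
  · rw [if_neg h2, if_neg (mt hF.1 h2)]

lemma tsum_length_le_succ (n : ℕ) (F : List ℕ → ℝ≥0∞) :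
    (∑' l, if l.length ≤ n + 1 then F l else 0) =
      F [] + ∑' j, ∑' l, if l.length ≤ n then F (j :: l) else 0 := by
  rw [tsum_list]
  simp

lemma tsum_length_le_zero (F : List ℕ → ℝ≥0∞) :
    (∑' l, if l.length ≤ 0 then F l else 0) = F [] := by
  rw [tsum_list]
  simp

/-- Lists are finite, so for arbitrary clocks mass may be lost in infinitely many jumps; equality
holds almost surely (`ae_tsum_pathProb_eq_one`). -/
lemma tsum_pathProb_le_one {p : ℕ → ℕ → ℝ≥0∞} (hp : ∀ i, ∑' j, p i j ≤ 1) (T : ℕ → Set ℝ)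
    (I : Set ℝ) (i : ℕ) : ∑' l, pathProb p T I i l ≤ 1 := by
  rw [tsum_list_eq_iSup]
  refine iSup_le fun n => ?_
  induction n generalizing i I with
  | zero =>
    rw [tsum_length_le_zero]
    by_cases h : T i ∩ I = ∅
    · rw [pathProb_nil_of_empty h]
    · rw [pathProb_nil_of_nonempty h]; exact zero_le
  | succ n ih =>
    rw [tsum_length_le_succ]
    by_cases h : T i ∩ I = ∅
    · simp [pathProb_nil_of_empty h, pathProb_cons_of_empty h]
    · simp only [pathProb_nil_of_nonempty h, pathProb_cons_of_nonempty h, zero_add]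
      refine le_trans (ENNReal.tsum_le_tsum fun j => ?_) (hp i)
      have : ∀ l : List ℕ, (if l.length ≤ n then
            p i j * pathProb p T (Ioo 0 (sSup (T i ∩ I))) j l else 0) =
          p i j * if l.length ≤ n then pathProb p T (Ioo 0 (sSup (T i ∩ I))) j l else 0 := by
        intro l; split_ifs <;> simp
      simp_rw [this]
      rw [ENNReal.tsum_mul_left]
      exact mul_le_of_le_one_right' (ih _ _)

variable {d : ℕ}

open Classical in
/-- The transition probabilities of the walk on `c`, in terms of the enumeration `E`. -/
noncomputable def stepProb (c : Config (Space d)) (E : ℕ → Space d) (i j : ℕ) : ℝ≥0∞ :=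
  if Neighbor c (E i) (E j) then ((nbrs c (E i)).encard : ℝ≥0∞)⁻¹ else 0

lemma stepProb_self (c : Config (Space d)) (E : ℕ → Space d) (i : ℕ) : stepProb c E i i = 0 :=
  if_neg fun h => h.2.2.1 rfl

lemma tsum_subset_config {c : Config (Space d)} {E : ℕ → Space d} (hE : Function.Injective E)
    (hr : range E = c.1) {N : Set (Space d)} (hN : N ⊆ c.1) (f : Space d → ℝ≥0∞) :
    ∑' z : N, f z = ∑' j, N.indicator f (E j) := by
  rw [tsum_subtype, hE.tsum_eq]
  rw [hr]
  exact (Function.support_subset_iff'.2 fun x hx => indicator_of_notMem hx f).trans hN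

lemma nbrs_subset (c : Config (Space d)) (x : Space d) : nbrs c x ⊆ c.1 := fun _ h => h.2.1

lemma mean_nbrs_eq_tsum {c : Config (Space d)} {E : ℕ → Space d} (hE : Function.Injective E)
    (hr : range E = c.1) (i : ℕ) (f : Space d → ℝ≥0∞) :
    ((nbrs c (E i)).encard : ℝ≥0∞)⁻¹ * ∑' z : nbrs c (E i), f z = ∑' j, stepProb c E i j * f (E j) := by
  classical
  rw [tsum_subset_config hE hr (nbrs_subset c _), ← ENNReal.tsum_mul_left]
  refine tsum_congr fun j => ?_
  by_cases h : Neighbor c (E i) (E j)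
  · rw [indicator_of_mem (show E j ∈ nbrs c (E i) from h), stepProb, if_pos h]
  · rw [indicator_of_notMem (show E j ∉ nbrs c (E i) from h), stepProb, if_neg h]
    simp

/-- The degree must be neither zero nor infinite, as `⊤⁻¹ = 0`. It is nonzero because an injective
enumeration supplies a second point and `exists_neighbor` then applies. -/
lemma tsum_stepProb {c : Config (Space d)} {E : ℕ → Space d} (hE : Function.Injective E)
    (hr : range E = c.1) {i : ℕ} (hf : (nbrs c (E i)).Finite) : ∑' j, stepProb c E i j = 1 := by
  have h := mean_nbrs_eq_tsum hE hr i fun _ => 1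
  simp only [mul_one, ENNReal.tsum_set_one] at h
  rw [← h]
  have h1 : E i ∈ c.1 := hr ▸ mem_range_self i
  have h2 : E (i + 1) ∈ c.1 := hr ▸ mem_range_self (i + 1)
  obtain ⟨z, hz⟩ := exists_neighbor h1 h2 (hE.ne (Nat.lt_succ_self i).ne)
  apply ENNReal.inv_mul_cancel
  · simp only [ne_eq, ENat.toENNReal_eq_zero, encard_eq_zero]
    exact nonempty_iff_ne_empty.1 ⟨z, hz⟩
  · simpa using hf

open Classical in
-- Both sides satisfy the same recursion on the first jump. The default `i` in `getLastD` makes the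
-- starting site the endpoint of the empty path.
lemma walkLaw_eq_tsum {c : Config (Space d)} {E : ℕ → Space d} (hE : Function.Injective E)
    (hr : range E = c.1) (m : Space d → Set ℝ) (n i : ℕ) (I : Set ℝ) (y : Space d) :
    walkLaw c m n (E i) I y = ∑' l : List ℕ, if l.length ≤ n then
      pathProb (stepProb c E) (fun j => m (E j)) I i l * (if E (l.getLastD i) = y then 1 else 0)
      else 0 := by
  induction n generalizing i I with
  | zero =>
    rw [tsum_length_le_zero, walkLaw]
    by_cases h : m (E i) ∩ I = ∅
    · rw [pathProb_nil_of_empty (T := fun j => m (E j)) h]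
      simp [h]
    · rw [pathProb_nil_of_nonempty (T := fun j => m (E j)) h]
      simp [h]
  | succ n ih =>
    rw [tsum_length_le_succ, walkLaw]
    by_cases h : (fun j => m (E j)) i ∩ I = ∅
    · rw [if_pos h]
      simp only [pathProb_nil_of_empty (T := fun j => m (E j)) h,
        pathProb_cons_of_empty (T := fun j => m (E j)) h]
      simp
    · rw [if_neg h]
      simp only [pathProb_nil_of_nonempty (T := fun j => m (E j)) h,
        pathProb_cons_of_nonempty (T := fun j => m (E j)) h]
      rw [mean_nbrs_eq_tsum hE hr i fun z =>
        walkLaw c m n z (Ioo 0 (sSup (m (E i) ∩ I))) y]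
      simp only [ih, zero_mul, zero_add, ← ENNReal.tsum_mul_left]
      refine tsum_congr fun j => tsum_congr fun l => ?_
      rw [List.getLastD_cons]
      split_ifs <;> simp

open Classical in
lemma transProb_eq_tsum {c : Config (Space d)} {E : ℕ → Space d} (hE : Function.Injective E)
    (hr : range E = c.1) (m : Space d → Set ℝ) (t : ℝ) (i : ℕ) (y : Space d) :
    transProb c m t (E i) y = ∑' l : List ℕ,
      pathProb (stepProb c E) (fun j => m (E j)) (Ioc 0 t) i l *
        (if E (l.getLastD i) = y then 1 else 0) := by
  simp only [transProb, walkLaw_eq_tsum hE hr]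
  rw [← tsum_list_eq_iSup]

lemma tsum_transProb_mul {c : Config (Space d)} {E : ℕ → Space d} (hE : Function.Injective E)
    (hr : range E = c.1) (m : Space d → Set ℝ) (t : ℝ) (i : ℕ) (f : Space d → ℝ≥0∞) :
    ∑' y : c.1, transProb c m t (E i) y * f y = ∑' l : List ℕ,
      pathProb (stepProb c E) (fun j => m (E j)) (Ioc 0 t) i l * f (E (l.getLastD i)) := by
  classical
  simp only [transProb_eq_tsum hE hr, ← ENNReal.tsum_mul_right]
  rw [ENNReal.tsum_comm]
  refine tsum_congr fun l => ?_
  have hmem : E (l.getLastD i) ∈ c.1 := hr ▸ mem_range_self _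
  rw [tsum_eq_single ⟨_, hmem⟩]
  · simp
  · intro y hy
    rw [if_neg, mul_zero, zero_mul]
    exact fun h => hy (Subtype.ext h.symm)

/-- A function with the same gradient as `f` has the same increments along the paths. -/
lemma sub_eq_sub_of_pathWeight_ne_zero {c : Config (Space d)} {E : ℕ → Space d}
    {f g : Space d → ℝ} (hfg : ∀ x y, Neighbor c x y → f y - f x = g y - g x) {i : ℕ}
    {l : List ℕ} (h : pathWeight (stepProb c E) i l ≠ 0) :
    f (E (l.getLastD i)) - f (E i) = g (E (l.getLastD i)) - g (E i) := by
  induction l generalizing i with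
  | nil => simp
  | cons j l ih =>
    rw [pathWeight, mul_ne_zero_iff] at h
    have h1 : Neighbor c (E i) (E j) := by
      by_contra hn
      exact h.1 (if_neg hn)
    have h2 := ih h.2
    have h3 := hfg _ _ h1
    rw [List.getLastD_cons]
    linarith

/-- The increment telescopes along the path; positive weight makes every step an edge, where the
conductance is one. -/
lemma enorm_sub_le_pathEnergy {c : Config (Space d)} {E : ℕ → Space d} (f : Space d → ℝ) {i : ℕ}
    {l : List ℕ} (h : pathWeight (stepProb c E) i l ≠ 0) :
    ‖f (E (l.getLastD i)) - f (E i)‖ₑ ≤ pathEnergy (fun i j => ‖grad c f (E i) (E j)‖ₑ) i l := by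
  induction l generalizing i with
  | nil => simp [pathEnergy]
  | cons j l ih =>
    rw [pathWeight, mul_ne_zero_iff] at h
    have h1 : Neighbor c (E i) (E j) := by
      by_contra hn
      exact h.1 (if_neg hn)
    have h3 : grad c f (E i) (E j) = f (E j) - f (E i) := by
      rw [grad, cond, if_pos h1, one_mul]
    rw [List.getLastD_cons, pathEnergy, h3, ← sub_add_sub_cancel _ (f (E j)) (f (E i)), add_comm]
    exact (enorm_add_le _ _).trans (add_le_add le_rfl (ih h.2))

/-- The bound for the moment of the increment of the harness process at the point `E i`. -/
noncomputable def walkEnergy (c : Config (Space d)) (E : ℕ → Space d) (f : Space d → ℝ) (r : ℝ)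
    (T : ℕ → Set ℝ) (t : ℝ) (i : ℕ) : ℝ≥0∞ :=
  ∑' l : List ℕ, pathProb (stepProb c E) T (Ioc 0 t) i l * ((l.length : ℝ≥0∞) ^ (r - 1) *
    pathEnergy (fun i j => ‖grad c f (E i) (E j)‖ₑ ^ r) i l)

/-- Jensen's inequality over the paths, then the power mean inequality within each path. -/
lemma tsum_transProb_rpow_le {c : Config (Space d)} {E : ℕ → Space d} (hE : Function.Injective E)
    (hr : range E = c.1) (m : Space d → Set ℝ) (t : ℝ) (f : Space d → ℝ) {r : ℝ} (h1r : 1 ≤ r)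
    {i : ℕ} (hone : ∑' l, pathProb (stepProb c E) (fun j => m (E j)) (Ioc 0 t) i l = 1) :
    (∑' y : c.1, transProb c m t (E i) y * ‖f y - f (E i)‖ₑ) ^ r ≤
      walkEnergy c E f r (fun j => m (E j)) t i := by
  rw [tsum_transProb_mul hE hr m t i fun y => ‖f y - f (E i)‖ₑ]
  refine (tsum_mul_rpow_le hone.le h1r).trans (ENNReal.tsum_le_tsum fun l => ?_)
  by_cases h : pathWeight (stepProb c E) i l = 0
  · simp [pathProb, h]
  · refine mul_le_mul_right ?_ _
    exact (ENNReal.rpow_le_rpow (enorm_sub_le_pathEnergy f h) (zero_le_one.trans h1r)).trans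
      (pathEnergy_rpow_le _ h1r i l)

lemma tsum_transProb {c : Config (Space d)} {E : ℕ → Space d} (hE : Function.Injective E)
    (hr : range E = c.1) (m : Space d → Set ℝ) (t : ℝ) (i : ℕ) :
    ∑' y : c.1, transProb c m t (E i) y =
      ∑' l, pathProb (stepProb c E) (fun j => m (E j)) (Ioc 0 t) i l := by
  simpa using tsum_transProb_mul hE hr m t i fun _ => 1

/-- The series that defines the harness process, for a transition law of mass one with a finite mean
of the increment. -/
lemma summable_transProb_mul {c : Config (Space d)} {q : Space d → ℝ≥0∞} {f : Space d → ℝ}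
    {x : Space d} (hq : ∑' y : c.1, q y = 1)
    (hfin : ∑' y : c.1, q y * ‖f y - f x‖ₑ ≠ ∞) :
    Summable (fun y : c.1 => (q y).toReal * f y) ∧
      Summable (fun y : c.1 => (q y).toReal * (f y - f x)) ∧
      ∑' y : c.1, (q y).toReal * f y - f x = ∑' y : c.1, (q y).toReal * (f y - f x) := by
  have hq1 : ∀ y : c.1, q y ≠ ∞ := fun y =>
    ne_top_of_le_ne_top (hq ▸ ENNReal.one_ne_top) (ENNReal.le_tsum y)
  have hs : Summable fun y : c.1 => (q y).toReal :=
    ENNReal.summable_toReal (hq ▸ ENNReal.one_ne_top)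
  have hs1 : ∑' y : c.1, (q y).toReal = 1 := by
    rw [← ENNReal.tsum_toReal_eq hq1, hq, ENNReal.toReal_one]
  have hd : Summable fun y : c.1 => (q y).toReal * (f y - f x) := by
    refine Summable.of_enorm ?_
    convert hfin using 3 with y
    rw [enorm_mul, ← ofReal_norm, Real.norm_of_nonneg ENNReal.toReal_nonneg,
      ENNReal.ofReal_toReal (hq1 y)]
  have h1 : (fun y : c.1 => (q y).toReal * f y) =
      fun y : c.1 => (q y).toReal * (f y - f x) + (q y).toReal * f x := by
    funext y; ring
  refine ⟨?_, hd, ?_⟩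
  · rw [h1]
    exact hd.add (hs.mul_right _)
  · rw [h1, hd.tsum_add (hs.mul_right _), tsum_mul_right, hs1]
    ring

variable {γ : Space d → Config (Space d) → ℝ} {c : Config (Space d)} {E : ℕ → Space d}
  {m : Space d → Set ℝ} {t : ℝ} {r : ℝ} {i : ℕ}

lemma tsum_transProb_mul_enorm_ne_top (hE : Function.Injective E) (hr : range E = c.1)
    (f : Space d → ℝ) (h1r : 1 ≤ r)
    (hone : ∑' l, pathProb (stepProb c E) (fun j => m (E j)) (Ioc 0 t) i l = 1)
    (hfin : walkEnergy c E f r (fun j => m (E j)) t i ≠ ∞) :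
    ∑' y : c.1, transProb c m t (E i) y * ‖f y - f (E i)‖ₑ ≠ ∞ := by
  intro h
  have := tsum_transProb_rpow_le hE hr m t f h1r hone
  rw [h, ENNReal.top_rpow_of_pos (zero_lt_one.trans_le h1r), top_le_iff] at this
  exact hfin this

lemma summable_harness (hE : Function.Injective E) (hr : range E = c.1) (h1r : 1 ≤ r)
    (hone : ∑' l, pathProb (stepProb c E) (fun j => m (E j)) (Ioc 0 t) i l = 1)
    (hfin : walkEnergy c E (fun w => γ w c) r (fun j => m (E j)) t i ≠ ∞) :
    Summable fun y : c.1 => (transProb c m t (E i) y).toReal * γ y c :=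
  (summable_transProb_mul (q := transProb c m t (E i)) (f := fun w => γ w c)
    ((tsum_transProb hE hr m t i).trans hone)
    (tsum_transProb_mul_enorm_ne_top hE hr _ h1r hone hfin)).1

lemma psi_enorm_rpow_le (hE : Function.Injective E) (hr : range E = c.1) (h1r : 1 ≤ r)
    (hone : ∑' l, pathProb (stepProb c E) (fun j => m (E j)) (Ioc 0 t) i l = 1)
    (hfin : walkEnergy c E (fun w => γ w c) r (fun j => m (E j)) t i ≠ ∞) :
    ‖psi γ c m t (E i)‖ₑ ^ r ≤ walkEnergy c E (fun w => γ w c) r (fun j => m (E j)) t i := by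
  have hq := (tsum_transProb hE hr m t i).trans hone
  have h := summable_transProb_mul (q := transProb c m t (E i)) (f := fun w => γ w c) hq
    (tsum_transProb_mul_enorm_ne_top hE hr _ h1r hone hfin)
  rw [psi, harness, h.2.2]
  refine (ENNReal.rpow_le_rpow (enorm_tsum_le_tsum_enorm.trans ?_) (zero_le_one.trans h1r)).trans
    (tsum_transProb_rpow_le hE hr m t (fun w => γ w c) h1r hone)
  refine ENNReal.tsum_le_tsum fun y => ?_
  rw [enorm_mul, ← ofReal_norm, Real.norm_of_nonneg ENNReal.toReal_nonneg]
  exact mul_le_mul_left ENNReal.ofReal_toReal_le _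

lemma tsum_shift_real (x : Space d) (c : Config (Space d)) (f : Space d → ℝ) :
    ∑' y : (shift x c).1, f y = ∑' y : c.1, f (y - x) := by
  let e : (shift x c).1 ≃ c.1 :=
    { toFun := fun y => ⟨y + x, y.2⟩
      invFun := fun y => ⟨y - x, by rw [mem_shift, sub_add_cancel]; exact y.2⟩
      left_inv := fun y => by simp
      right_inv := fun y => by simp }
  rw [← e.tsum_eq]
  simp [e]

lemma HasCovariantGradient.sub_eq (hcov : HasCovariantGradient γ) {x y z : Space d}
    (hx : x ∈ c.1) (h : Neighbor c y z) :
    γ (z - x) (shift x c) - γ (y - x) (shift x c) = γ z c - γ y c := by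
  have h1 := hcov c x hx y h.1 z h.2.1
  have h2 : Neighbor (shift x c) (y - x) (z - x) := by
    rw [neighbor_shift, sub_add_cancel, sub_add_cancel]; exact h
  rwa [grad, grad, cond, cond, if_pos h, if_pos h2, one_mul, one_mul] at h1

/-- Only the gradient of `γ` is covariant, not `γ`. But as the transition law has mass one, `ψ_t` is
a mean of increments of `γ`, and these are sums of gradients along the paths of the walk. -/
lemma psi_shift (hE : Function.Injective E) (hr : range E = c.1) (h1r : 1 ≤ r)
    (hcov : HasCovariantGradient γ)
    (hone : ∑' l, pathProb (stepProb c E) (fun j => m (E j)) (Ioc 0 t) i l = 1)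
    (hfin : walkEnergy c E (fun w => γ w c) r (fun j => m (E j)) t i ≠ ∞) :
    psi γ c m t (E i) = psi γ (shift (E i) c) (fun y => m (y + E i)) t 0 := by
  have hq := (tsum_transProb hE hr m t i).trans hone
  have hx : E i ∈ c.1 := hr ▸ mem_range_self i
  have hfin' := tsum_transProb_mul_enorm_ne_top hE hr (fun w => γ w c) h1r hone hfin
  have h := summable_transProb_mul (q := transProb c m t (E i)) (f := fun w => γ w c) hq hfin'
  set g : Space d → ℝ := fun y => γ (y - E i) (shift (E i) c) with hg
  -- A point charged by the transition law is the end of a path of positive weight, so connectedness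
  -- of the whole graph is not needed.
  have hinc : ∀ y, transProb c m t (E i) y ≠ 0 → g y - g (E i) = γ y c - γ (E i) c := by
    classical
    intro y hy
    rw [transProb_eq_tsum hE hr, ne_eq, ENNReal.tsum_eq_zero, not_forall] at hy
    obtain ⟨l, hl⟩ := hy
    rw [← ne_eq, mul_ne_zero_iff, pathProb, mul_ne_zero_iff] at hl
    have hly : E (l.getLastD i) = y := by
      by_contra hn
      exact hl.2 (if_neg hn)
    have := sub_eq_sub_of_pathWeight_ne_zero (f := g) (g := fun w => γ w c)
      (fun x y hxy => hcov.sub_eq hx hxy) hl.1.1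
    rwa [hly] at this
  have hinc' : ∀ y, transProb c m t (E i) y * ‖g y - g (E i)‖ₑ =
      transProb c m t (E i) y * ‖γ y c - γ (E i) c‖ₑ := by
    intro y
    by_cases hy : transProb c m t (E i) y = 0
    · simp [hy]
    · rw [hinc y hy]
  have h' := summable_transProb_mul (q := transProb c m t (E i)) (f := g) hq
    (by rw [tsum_congr fun y : c.1 => hinc' y]; exact hfin')
  have e1 : psi γ (shift (E i) c) (fun y => m (y + E i)) t 0 =
      ∑' y : c.1, (transProb c m t (E i) y).toReal * g y - g (E i) := by
    rw [psi, harness, tsum_shift_real (E i) c fun y =>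
      (transProb (shift (E i) c) (fun y => m (y + E i)) t 0 y).toReal * γ y (shift (E i) c)]
    simp only [transProb_shift, zero_add, sub_add_cancel, hg, sub_self]
  rw [e1, h'.2.2, psi, harness, h.2.2]
  refine tsum_congr fun y => ?_
  by_cases hy : transProb c m t (E i) y = 0
  · simp [hy]
  · rw [hinc y hy]

end Walk

end Harness

namespace Harness

/-! ### Mean energy of the walk under the Palm measure. -/

section Energy

variable {d : ℕ}

lemma Neighbor.symm {c : Config (Space d)} {x y : Space d} (h : Neighbor c x y) : Neighbor c y x :=
  ⟨h.2.1, h.1, h.2.2.1.symm, by rw [inter_comm]; exact h.2.2.2⟩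

open Classical in
lemma tsum_nbrs_eq (c : Config (Space d)) (x : Space d) (f : Space d → ℝ≥0∞) :
    ∑' z : nbrs c x, f z = ∑' z : c.1, if Neighbor c x z then f z else 0 := by
  rw [tsum_subtype, tsum_subtype c.1 fun z => if Neighbor c x z then f z else 0]
  refine tsum_congr fun z => ?_
  by_cases h : Neighbor c x z
  · rw [indicator_of_mem (show z ∈ nbrs c x from h), indicator_of_mem h.2.1, if_pos h]
  · rw [indicator_of_notMem (show z ∉ nbrs c x from h)]
    simp [indicator, h]

/-- The number of neighbors. -/
noncomputable def degree (c : Config (Space d)) (x : Space d) : ℝ≥0∞ := (nbrs c x).encard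

lemma degree_eq_tsum (c : Config (Space d)) (x : Space d) : degree c x = ∑' _ : nbrs c x, 1 := by
  rw [ENNReal.tsum_set_one, degree]

lemma degree_lt_top {c : Config (Space d)} {x : Space d} : degree c x < ∞ ↔ (nbrs c x).Finite := by
  simp [degree]

lemma degree_shift (c : Config (Space d)) (x y : Space d) :
    degree (shift x c) y = degree c (y + x) := by
  rw [degree, degree, encard_nbrs_shift]

section Measurability

variable {α : Type*} [MeasurableSpace α] {g : α → Config (Space d)} {x : α → Space d}

lemma measurable_tsum_nbrs (hg : Measurable g) (hx : Measurable x) {f : α → Space d → ℝ≥0∞}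
    (hf : Measurable (Function.uncurry f)) :
    Measurable fun a => ∑' z : nbrs (g a) (x a), f a z := by
  classical
  simp_rw [tsum_nbrs_eq]
  refine measurable_tsum_config (f := fun a z => if Neighbor (g a) (x a) z then f a z else 0) ?_ hg
  exact Measurable.ite (measurableSet_neighbor (hg.comp measurable_fst) (hx.comp measurable_fst)
    measurable_snd) hf measurable_const

lemma measurable_degree (hg : Measurable g) (hx : Measurable x) :
    Measurable fun a => degree (g a) (x a) := by
  simp_rw [degree_eq_tsum]
  exact measurable_tsum_nbrs hg hx (f := fun _ _ => 1) measurable_const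

end Measurability

variable (γ : Space d → Config (Space d) → ℝ) (r : ℝ)

/-- The power of the slope of the surface `γ`. -/
noncomputable def slope (c : Config (Space d)) (x y : Space d) : ℝ≥0∞ :=
  ‖grad c (fun w => γ w c) x y‖ₑ ^ r

/-- The mean energy of the first `n` steps of the random walk on `c` started at `x`. -/
noncomputable def siteEnergy : ℕ → Config (Space d) → Space d → ℝ≥0∞
  | 0, _, _ => 0
  | n + 1, c, x => (degree c x)⁻¹ * ∑' z : nbrs c x, (slope γ r c x z + siteEnergy n c z)

/-- The mean of the energy of the walk with a Poisson number of steps. -/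
noncomputable def poissonEnergy (t : ℝ≥0) (c : Config (Space d)) (x : Space d) : ℝ≥0∞ :=
  ∑' n : ℕ, (n : ℝ≥0∞) ^ (r - 1) * poissonMeasure t {n} * siteEnergy γ r n c x

variable {γ r}

section Measurability

variable {α : Type*} [MeasurableSpace α] {g : α → Config (Space d)} {x y : α → Space d}

lemma measurable_slope (hγ : Measurable (Function.uncurry γ)) (hg : Measurable g)
    (hx : Measurable x) (hy : Measurable y) : Measurable fun a => slope γ r (g a) (x a) (y a) := by
  classical
  have h1 : Measurable fun a => γ (x a) (g a) := hγ.comp (hx.prodMk hg)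
  have h2 : Measurable fun a => γ (y a) (g a) := hγ.comp (hy.prodMk hg)
  have h3 : Measurable fun a => cond (g a) (x a) (y a) :=
    Measurable.ite (measurableSet_neighbor hg hx hy) measurable_const measurable_const
  have h4 : Measurable fun a => grad (g a) (fun w => γ w (g a)) (x a) (y a) := h3.mul (h2.sub h1)
  exact h4.enorm.pow_const r

lemma measurable_siteEnergy (hγ : Measurable (Function.uncurry γ)) (n : ℕ) :
    Measurable fun q : Config (Space d) × Space d => siteEnergy γ r n q.1 q.2 := by
  induction n with
  | zero => exact measurable_const
  | succ n ih =>
    simp only [siteEnergy]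
    refine (measurable_degree measurable_fst measurable_snd).inv.mul ?_
    refine measurable_tsum_nbrs measurable_fst measurable_snd
      (f := fun q z => slope γ r q.1 q.2 z + siteEnergy γ r n q.1 z) ?_
    have h1 : Measurable fun q : (Config (Space d) × Space d) × Space d =>
        slope γ r q.1.1 q.1.2 q.2 :=
      measurable_slope hγ (measurable_fst.comp measurable_fst) (measurable_snd.comp measurable_fst)
        measurable_snd
    have h2 : Measurable fun q : (Config (Space d) × Space d) × Space d =>
        siteEnergy γ r n q.1.1 q.2 :=
      ih.comp ((measurable_fst.comp measurable_fst).prodMk measurable_snd)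
    exact h1.add h2

lemma measurable_poissonEnergy (hγ : Measurable (Function.uncurry γ)) (t : ℝ≥0) :
    Measurable fun q : Config (Space d) × Space d => poissonEnergy γ r t q.1 q.2 :=
  Measurable.tsum fun n => (measurable_siteEnergy hγ n).const_mul _

end Measurability

lemma slope_shift (hcov : HasCovariantGradient γ) {c : Config (Space d)} {x y z : Space d}
    (hx : x ∈ c.1) (hy : y + x ∈ c.1) (hz : z + x ∈ c.1) :
    slope γ r (shift x c) y z = slope γ r c (y + x) (z + x) := by
  have := hcov c x hx _ hy _ hz
  rw [add_sub_cancel_right, add_sub_cancel_right] at this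
  rw [slope, slope, this]

lemma siteEnergy_shift (hcov : HasCovariantGradient γ) (n : ℕ) {c : Config (Space d)}
    {x y : Space d} (hx : x ∈ c.1) (hy : y + x ∈ c.1) :
    siteEnergy γ r n (shift x c) y = siteEnergy γ r n c (y + x) := by
  induction n generalizing y with
  | zero => rfl
  | succ n ih =>
    rw [siteEnergy, siteEnergy, degree_shift, ← tsum_nbrs_shift c x y fun z =>
      slope γ r c (y + x) z + siteEnergy γ r n c z]
    congr 1
    refine tsum_congr fun z => ?_
    have hz : (z : Space d) + x ∈ c.1 := z.2.2.1
    rw [ih hz, slope_shift hcov hx hy hz]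

lemma poissonEnergy_shift (hcov : HasCovariantGradient γ) (t : ℝ≥0) {c : Config (Space d)}
    {x y : Space d} (hx : x ∈ c.1) (hy : y + x ∈ c.1) :
    poissonEnergy γ r t (shift x c) y = poissonEnergy γ r t c (y + x) := by
  simp only [poissonEnergy, siteEnergy_shift hcov _ hx hy]

/-- The enumeration need not be compatible with translations; the form free of it is the one on
which mass transport can act. -/
lemma meanEnergy_eq_siteEnergy {c : Config (Space d)} {E : ℕ → Space d}
    (hE : Function.Injective E) (hr : range E = c.1) (n i : ℕ) :
    meanEnergy (stepProb c E) (fun i j => slope γ r c (E i) (E j)) n i =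
      siteEnergy γ r n c (E i) := by
  induction n generalizing i with
  | zero => rfl
  | succ n ih =>
    rw [meanEnergy, siteEnergy, degree, mean_nbrs_eq_tsum hE hr i fun z =>
      slope γ r c (E i) z + siteEnergy γ r n c z]
    simp only [ih]

variable {P Q : Measure (Config (Space d))} [IsProbabilityMeasure P] [IsProbabilityMeasure Q]

/-- The degree-biased Palm measure is invariant for the environment seen from the walk. -/
theorem lintegral_tsum_nbrs (hstat : IsStationary P) (hpalm : IsPalm P Q)
    {F : Config (Space d) → Space d → ℝ≥0∞} (hF : Measurable (Function.uncurry F))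
    (hcov : ∀ c x y, x ∈ c.1 → y + x ∈ c.1 → F (shift x c) y = F c (y + x)) :
    ∫⁻ c, ∑' z : nbrs c 0, F c z ∂Q = ∫⁻ c, degree c 0 * F c 0 ∂Q := by
  classical
  -- The origin sends `F c y` to each neighbor `y`. By symmetry of the graph and covariance of `F`,
  -- it receives `F c 0` along each of its edges.
  have hg : Measurable (Function.uncurry fun (y : Space d) (c : Config (Space d)) =>
      if Neighbor c 0 y then F c y else 0) :=
    Measurable.ite (measurableSet_neighbor measurable_snd measurable_const measurable_fst)
      (hF.comp measurable_swap) measurable_const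
  have h := massTransport hstat hpalm hg
  simp_rw [tsum_nbrs_eq, h]
  refine lintegral_congr fun c => ?_
  rw [degree_eq_tsum, ← ENNReal.tsum_mul_right, tsum_nbrs_eq c 0 fun _ => 1 * F c 0]
  refine tsum_congr fun y => ?_
  have hN : Neighbor (shift (y : Space d) c) 0 (-y) ↔ Neighbor c 0 y := by
    rw [neighbor_shift, zero_add, neg_add_cancel]
    exact ⟨Neighbor.symm, Neighbor.symm⟩
  by_cases h : Neighbor c 0 y
  · rw [if_pos h, if_pos (hN.2 h), one_mul, hcov c y _ h.2.1 (by rw [neg_add_cancel]; exact h.1),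
      neg_add_cancel]
  · rw [if_neg h, if_neg (mt hN.1 h)]

/-- The degree cancels the uniform choice of the first jump, which leaves the energy at the edges of
the origin. The remaining `n` steps start from the neighbors, and invariance brings them back to the
origin. -/
lemma lintegral_degree_mul_siteEnergy_le (hstat : IsStationary P) (hpalm : IsPalm P Q)
    (hγ : Measurable (Function.uncurry γ)) (hcov : HasCovariantGradient γ) (n : ℕ) :
    ∫⁻ c, degree c 0 * siteEnergy γ r n c 0 ∂Q ≤
      n * ∫⁻ c, ∑' z : nbrs c 0, slope γ r c 0 z ∂Q := by
  induction n with
  | zero => simp [siteEnergy]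
  | succ n ih =>
    have hm : Measurable fun c : Config (Space d) => ∑' z : nbrs c 0, slope γ r c 0 z :=
      measurable_tsum_nbrs measurable_id measurable_const
        (f := fun c z => slope γ r c 0 z)
        (measurable_slope hγ measurable_fst measurable_const measurable_snd)
    calc ∫⁻ c, degree c 0 * siteEnergy γ r (n + 1) c 0 ∂Q
        ≤ ∫⁻ c, (∑' z : nbrs c 0, slope γ r c 0 z) + ∑' z : nbrs c 0, siteEnergy γ r n c z ∂Q := by
          refine lintegral_mono fun c => ?_
          simp only [siteEnergy]
          rw [← mul_assoc, ← ENNReal.tsum_add]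
          exact mul_le_of_le_one_left' (ENNReal.mul_inv_le_one _)
      _ = (∫⁻ c, ∑' z : nbrs c 0, slope γ r c 0 z ∂Q) +
            ∫⁻ c, degree c 0 * siteEnergy γ r n c 0 ∂Q := by
          rw [lintegral_add_left hm, lintegral_tsum_nbrs hstat hpalm
            (F := fun c z => siteEnergy γ r n c z) (measurable_siteEnergy hγ n)
            fun c x y hx hy => siteEnergy_shift hcov n hx hy]
      _ ≤ _ := by
          push_cast
          rw [add_mul, one_mul, add_comm]
          exact add_le_add ih le_rfl

lemma poissonMoment_eq (r : ℝ) (t : ℝ≥0) :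
    poissonMoment r t = ∑' n : ℕ, (n : ℝ≥0∞) ^ r * poissonMeasure t {n} := by
  rw [poissonMoment, lintegral_countable']

/-- The factor `n ^ (r - 1)` of the power mean inequality times the number `n` of steps gives the
moment of order `r`. -/
lemma lintegral_degree_mul_poissonEnergy_le (hstat : IsStationary P) (hpalm : IsPalm P Q)
    (hγ : Measurable (Function.uncurry γ)) (hcov : HasCovariantGradient γ) (hr : 1 ≤ r) (t : ℝ≥0) :
    ∫⁻ c, degree c 0 * poissonEnergy γ r t c 0 ∂Q ≤
      (∫⁻ c, ∑' z : nbrs c 0, slope γ r c 0 z ∂Q) * poissonMoment r t := by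
  have hs : ∀ n, Measurable fun c : Config (Space d) => degree c 0 * siteEnergy γ r n c 0 :=
    fun n => (measurable_degree measurable_id measurable_const).mul
      ((measurable_siteEnergy hγ n).comp (measurable_id.prodMk measurable_const))
  have h : ∀ c : Config (Space d), degree c 0 * poissonEnergy γ r t c 0 =
      ∑' n : ℕ, (n : ℝ≥0∞) ^ (r - 1) * poissonMeasure t {n} *
        (degree c 0 * siteEnergy γ r n c 0) := by
    intro c
    rw [poissonEnergy, ← ENNReal.tsum_mul_left]
    exact tsum_congr fun n => by ring
  simp_rw [h]
  rw [lintegral_tsum fun n => ((hs n).const_mul _).aemeasurable, poissonMoment_eq,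
    ← ENNReal.tsum_mul_left]
  refine ENNReal.tsum_le_tsum fun n => ?_
  rw [lintegral_const_mul _ (hs n)]
  refine (mul_le_mul_right (lintegral_degree_mul_siteEnergy_le hstat hpalm hγ hcov n) _).trans_eq ?_
  have hn : (n : ℝ≥0∞) ^ r = (n : ℝ≥0∞) ^ (r - 1) * n := by
    rcases eq_or_ne n 0 with rfl | hn
    · simp [ENNReal.zero_rpow_of_pos (zero_lt_one.trans_le hr)]
    · conv_rhs => rw [← ENNReal.rpow_one (n : ℝ≥0∞), ← ENNReal.rpow_mul, one_mul]
      rw [← ENNReal.rpow_add _ _ (by exact_mod_cast hn) (ENNReal.natCast_ne_top n), sub_add_cancel]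
  rw [hn]
  ring

/-- With an integer `k ≥ r`, the bound `n ^ k ≤ k! * exp n` leaves an exponential series. -/
lemma poissonMoment_lt_top {r : ℝ} (hr : 0 ≤ r) (t : ℝ≥0) : poissonMoment r t < ∞ := by
  obtain ⟨k, hk⟩ := exists_nat_ge r
  rw [poissonMoment_eq]
  have hle : ∀ n : ℕ, (n : ℝ≥0∞) ^ r * poissonMeasure t {n} ≤
      ENNReal.ofReal (k.factorial * Real.exp (-t) * ((t * Real.exp 1) ^ n / n.factorial)) := by
    intro n
    rw [poissonMeasure_singleton]
    have h1 : (n : ℝ≥0∞) ^ r ≤ ENNReal.ofReal (k.factorial * Real.exp n) := by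
      rcases eq_or_ne n 0 with rfl | hn
      · rcases hr.eq_or_lt with rfl | hr
        · have : (1 : ℝ) ≤ k.factorial := by exact_mod_cast Nat.factorial_pos k
          simpa using this
        · simp [ENNReal.zero_rpow_of_pos hr]
      · have h1n : (1 : ℝ≥0∞) ≤ n := by exact_mod_cast Nat.one_le_iff_ne_zero.2 hn
        calc (n : ℝ≥0∞) ^ r ≤ (n : ℝ≥0∞) ^ (k : ℝ) := ENNReal.rpow_le_rpow_of_exponent_le h1n hk
          _ = ENNReal.ofReal ((n : ℝ) ^ k) := by
            rw [ENNReal.rpow_natCast, ENNReal.ofReal_pow (by positivity), ENNReal.ofReal_natCast]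
          _ ≤ _ := by
            refine ENNReal.ofReal_le_ofReal ?_
            have := Real.pow_div_factorial_le_exp (n : ℝ) (by positivity) k
            rwa [div_le_iff₀' (by positivity)] at this
    refine (mul_le_mul_left h1 _).trans_eq ?_
    rw [← ENNReal.ofReal_mul (by positivity)]
    congr 1
    rw [mul_pow, ← Real.exp_nat_mul, mul_one]
    ring
  refine (ENNReal.tsum_le_tsum hle).trans_lt ?_
  exact ((Real.summable_pow_div_factorial _).mul_left _).tsum_ofReal_lt_top

end Energy

end Harness

namespace Harness

/-! ### Averaging over the epochs. -/

section Assembly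

variable {d : ℕ} {Ω : Type*} [MeasurableSpace Ω] {μ : Measure Ω} [IsProbabilityMeasure μ]
  {S₀ : Ω → Config (Space d)} {e : ℕ → Config (Space d) → Space d} {T : ℕ → Ω → Config ℝ}
  {γ : Space d → Config (Space d) → ℝ} {r : ℝ}

lemma measurable_stepProb (he : ∀ n, Measurable (e n)) (i j : ℕ) :
    Measurable fun c : Config (Space d) => stepProb c (fun n => e n c) i j :=
  Measurable.ite (measurableSet_neighbor measurable_id (he i) (he j))
    (measurable_degree measurable_id (he i)).inv measurable_const

lemma measurable_pathWeight (he : ∀ n, Measurable (e n)) (i : ℕ) (l : List ℕ) :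
    Measurable fun c : Config (Space d) => pathWeight (stepProb c fun n => e n c) i l := by
  induction l generalizing i with
  | nil => exact measurable_const
  | cons j l ih => exact (measurable_stepProb he i j).mul (ih j)

lemma measurable_pathEnergy (he : ∀ n, Measurable (e n)) (hγ : Measurable (Function.uncurry γ))
    (i : ℕ) (l : List ℕ) :
    Measurable fun c : Config (Space d) =>
      pathEnergy (fun i j => slope γ r c (e i c) (e j c)) i l := by
  induction l generalizing i with
  | nil => exact measurable_const
  | cons j l ih => exact (measurable_slope hγ measurable_id (he i) (he j)).add (ih j)

lemma measurable_pathProb (he : ∀ n, Measurable (e n)) (hS₀ : Measurable S₀)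
    (hT : ∀ n, Measurable (T n)) (t : ℝ) (i : ℕ) (l : List ℕ) :
    Measurable fun ω => pathProb (stepProb (S₀ ω) fun n => e n (S₀ ω)) (fun n => (T n ω).1)
      (Ioc 0 t) i l := by
  classical
  exact ((measurable_pathWeight he i l).comp hS₀).mul
    (Measurable.ite (measurableSet_follows_Ioc hT i l t) measurable_const measurable_const)

/-- Averaging over the epochs. -/
lemma lintegral_tsum_pathProb_mul (hS₀ : Measurable S₀) (he : ∀ n, Measurable (e n))
    (hT : ∀ n, Measurable (T n)) (hpois : ∀ n, IsPoissonProcess μ (T n)) (hTindep : iIndepFun T μ)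
    (hindep : IndepFun S₀ (fun ω n => T n ω) μ) (t : ℝ≥0) (i : ℕ)
    {K : List ℕ → Config (Space d) → ℝ≥0∞} (hK : ∀ l, Measurable (K l)) :
    ∫⁻ ω, ∑' l, pathProb (stepProb (S₀ ω) fun n => e n (S₀ ω)) (fun n => (T n ω).1)
        (Ioc 0 (t : ℝ)) i l * K l (S₀ ω) ∂μ =
      ∫⁻ ω, ∑' l, pathWeight (stepProb (S₀ ω) fun n => e n (S₀ ω)) i l * K l (S₀ ω) *
        poissonMeasure t {l.length} ∂μ := by
  classical
  have hW : ∀ l, Measurable fun c : Config (Space d) =>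
      pathWeight (stepProb c fun n => e n c) i l * K l c := fun l =>
    (measurable_pathWeight he i l).mul (hK l)
  have hWS : ∀ l, Measurable fun ω =>
      pathWeight (stepProb (S₀ ω) fun n => e n (S₀ ω)) i l * K l (S₀ ω) := fun l => (hW l).comp hS₀
  have hm1 : ∀ l, AEMeasurable (fun ω => pathProb (stepProb (S₀ ω) fun n => e n (S₀ ω))
      (fun n => (T n ω).1) (Ioc 0 (t : ℝ)) i l * K l (S₀ ω)) μ := fun l =>
    ((measurable_pathProb he hS₀ hT t i l).mul ((hK l).comp hS₀)).aemeasurable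
  have hm2 : ∀ l : List ℕ, AEMeasurable (fun ω =>
      pathWeight (stepProb (S₀ ω) fun n => e n (S₀ ω)) i l * K l (S₀ ω) *
        poissonMeasure t {l.length}) μ := fun l => ((hWS l).mul_const _).aemeasurable
  rw [lintegral_tsum hm1, lintegral_tsum hm2]
  refine tsum_congr fun l => ?_
  rw [lintegral_mul_const _ (hWS l)]
  have hF : MeasurableSet {θ : ℕ → Config ℝ | Follows (fun n => (θ n).1) i l (Ioc 0 (t : ℝ))} :=
    measurableSet_follows measurable_id i l (measurableSet_Ioc.preimage measurable_snd)
      fun _ => Metric.isBounded_Ioc _ _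
  have hJ : Measurable fun θ : ℕ → Config ℝ =>
      if Follows (fun n => (θ n).1) i l (Ioc 0 (t : ℝ)) then (1 : ℝ≥0∞) else 0 :=
    Measurable.ite hF measurable_const measurable_const
  -- On chains the weight is independent of the clocks and `measure_follows` applies; other lists
  -- have weight zero.
  by_cases hl : (i :: l).IsChain (· ≠ ·)
  · have hI := hindep.comp (hW l) hJ
    have h1 := lintegral_mul_eq_lintegral_mul_lintegral_of_indepFun''
      ((hW l).comp hS₀).aemeasurable (hJ.comp (measurable_pi_lambda _ hT)).aemeasurable hI
    have h2 : ∫⁻ ω, (if Follows (fun n => (T n ω).1) i l (Ioc 0 (t : ℝ)) then (1 : ℝ≥0∞) else 0) ∂μ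
        = poissonMeasure t {l.length} := by
      rw [← measure_follows hT hpois hTindep i l hl t,
        ← lintegral_indicator_one (measurableSet_follows_Ioc hT i l t)]
      exact lintegral_congr fun ω => by simp [indicator]
    rw [← h2]
    refine Eq.trans (lintegral_congr fun ω => ?_) h1
    simp only [Function.comp_apply, pathProb]
    ring
  · have h0 : ∀ c : Config (Space d), pathWeight (stepProb c fun n => e n c) i l = 0 := by
      intro c
      by_contra h
      exact hl (isChain_of_pathWeight_ne_zero (stepProb_self c _) h)
    simp [pathProb, h0]

/-- The enumeration `e` of the points is proper and every point has finitely many neighbors. -/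
def Regular (e : ℕ → Config (Space d) → Space d) (c : Config (Space d)) : Prop :=
  Function.Injective (fun n => e n c) ∧ range (fun n => e n c) = c.1 ∧ ∀ x ∈ c.1, (nbrs c x).Finite

lemma Regular.tsum_stepProb {c : Config (Space d)} (h : Regular e c) (i : ℕ) :
    ∑' j, stepProb c (fun n => e n c) i j = 1 :=
  Harness.tsum_stepProb h.1 h.2.1 (h.2.2 _ (h.2.1 ▸ mem_range_self i))

lemma tsum_poissonMeasure (t : ℝ≥0) : ∑' n : ℕ, poissonMeasure t {n} = 1 := by
  have h : ∫⁻ _, 1 ∂(poissonMeasure t) = 1 := by simp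
  rw [lintegral_countable'] at h
  simpa using h

/-- The backward walk makes finitely many jumps. -/
lemma ae_tsum_pathProb_eq_one (hS₀ : Measurable S₀) (he : ∀ n, Measurable (e n))
    (hreg : ∀ᵐ ω ∂μ, Regular e (S₀ ω))
    (hT : ∀ n, Measurable (T n)) (hpois : ∀ n, IsPoissonProcess μ (T n)) (hTindep : iIndepFun T μ)
    (hindep : IndepFun S₀ (fun ω n => T n ω) μ) (t : ℝ≥0) :
    ∀ᵐ ω ∂μ, ∀ i, ∑' l, pathProb (stepProb (S₀ ω) fun n => e n (S₀ ω)) (fun n => (T n ω).1)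
        (Ioc 0 (t : ℝ)) i l = 1 := by
  rw [ae_all_iff]
  intro i
  have h := lintegral_tsum_pathProb_mul hS₀ he hT hpois hTindep hindep t i
    (K := fun _ _ => 1) fun _ => measurable_const
  simp only [mul_one] at h
  have h1 : ∫⁻ ω, ∑' l, pathWeight (stepProb (S₀ ω) fun n => e n (S₀ ω)) i l *
      poissonMeasure t {l.length} ∂μ = ∫⁻ _, 1 ∂μ := by
    refine lintegral_congr_ae ?_
    filter_upwards [hreg] with ω hω
    rw [tsum_pathWeight_mul hω.tsum_stepProb fun n => poissonMeasure t {n}, tsum_poissonMeasure]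
  -- The total mass is at most one and its mean is one, the Poisson weights summing to one.
  refine ae_eq_of_ae_le_of_lintegral_le ?_ ?_ aemeasurable_const ?_
  · filter_upwards [hreg] with ω hω
    exact tsum_pathProb_le_one (fun i => (hω.tsum_stepProb i).le) _ _ _
  · rw [h, h1]; simp
  · rw [h, h1]

/-- The energy of the backward walk from the `i`-th point. -/
noncomputable def pointEnergy (γ : Space d → Config (Space d) → ℝ)
    (e : ℕ → Config (Space d) → Space d) (r t : ℝ) (c : Config (Space d)) (θ : ℕ → Config ℝ)
    (i : ℕ) : ℝ≥0∞ :=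
  walkEnergy c (fun n => e n c) (fun w => γ w c) r (fun n => (θ n).1) t i

lemma measurable_pointEnergy (hγ : Measurable (Function.uncurry γ)) (hS₀ : Measurable S₀)
    (he : ∀ n, Measurable (e n)) (hT : ∀ n, Measurable (T n)) (t : ℝ) (i : ℕ) :
    Measurable fun ω => pointEnergy γ e r t (S₀ ω) (fun n => T n ω) i := by
  refine Measurable.tsum fun l => (measurable_pathProb he hS₀ hT t i l).mul ?_
  exact measurable_const.mul ((measurable_pathEnergy he hγ i l).comp hS₀)

/-- The weight `B` depends on the configuration alone, so it passes through the average over the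
epochs. It serves both to truncate and to select the edges at the origin. -/
lemma lintegral_mul_pointEnergy (hγ : Measurable (Function.uncurry γ)) (hS₀ : Measurable S₀)
    (he : ∀ n, Measurable (e n)) (hreg : ∀ᵐ ω ∂μ, Regular e (S₀ ω))
    (hT : ∀ n, Measurable (T n)) (hpois : ∀ n, IsPoissonProcess μ (T n)) (hTindep : iIndepFun T μ)
    (hindep : IndepFun S₀ (fun ω n => T n ω) μ) (t : ℝ≥0) (i : ℕ)
    {B : Config (Space d) → ℝ≥0∞} (hB : Measurable B) :
    ∫⁻ ω, B (S₀ ω) * pointEnergy γ e r t (S₀ ω) (fun n => T n ω) i ∂μ =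
      ∫⁻ ω, B (S₀ ω) * poissonEnergy γ r t (S₀ ω) (e i (S₀ ω)) ∂μ := by
  have h := lintegral_tsum_pathProb_mul hS₀ he hT hpois hTindep hindep t i
    (K := fun l c => B c * ((l.length : ℝ≥0∞) ^ (r - 1) *
      pathEnergy (fun i j => slope γ r c (e i c) (e j c)) i l))
    fun l => hB.mul (measurable_const.mul (measurable_pathEnergy he hγ i l))
  refine Eq.trans (lintegral_congr fun ω => ?_) (h.trans (lintegral_congr_ae ?_))
  · rw [pointEnergy, walkEnergy, ← ENNReal.tsum_mul_left]
    refine tsum_congr fun l => ?_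
    rw [mul_left_comm]
    rfl
  · filter_upwards [hreg] with ω hω
    have h2 := tsum_pathWeight_mul_pathEnergy hω.tsum_stepProb
      (fun i j => slope γ r (S₀ ω) (e i (S₀ ω)) (e j (S₀ ω)))
      (fun n => (n : ℝ≥0∞) ^ (r - 1) * poissonMeasure t {n}) i
    simp only [meanEnergy_eq_siteEnergy hω.1 hω.2.1] at h2
    rw [poissonEnergy, ← h2, ← ENNReal.tsum_mul_left]
    exact tsum_congr fun l => by ring

end Assembly

end Harness

namespace Harness

/-! ### Consequences for a regular configuration, and sums over the edges at the origin. -/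

section Deterministic

variable {d : ℕ} {c : Config (Space d)} {e : ℕ → Config (Space d) → Space d}

lemma epochs_apply (hinj : Function.Injective fun n => e n c) (θ : ℕ → Config ℝ) (i : ℕ) :
    epochs e c θ (e i c) = (θ i).1 := by
  ext τ
  refine ⟨?_, fun h => ⟨i, rfl, h⟩⟩
  rintro ⟨n, hn, h⟩
  rwa [hinj hn] at h

variable {γ : Space d → Config (Space d) → ℝ} {r t : ℝ} {θ : ℕ → Config ℝ} {i : ℕ}

lemma Regular.summable_harness (h : Regular e c) (hr : 1 ≤ r)
    (hone : ∑' l, pathProb (stepProb c fun n => e n c) (fun n => (θ n).1) (Ioc 0 t) i l = 1)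
    (hfin : pointEnergy γ e r t c θ i ≠ ∞) :
    Summable fun y : c.1 => (transProb c (epochs e c θ) t (e i c) y).toReal * γ y c := by
  rw [pointEnergy] at hfin
  rw [← funext fun j => epochs_apply h.1 θ j] at hone hfin
  exact Harness.summable_harness (E := fun n => e n c) (m := epochs e c θ) h.1 h.2.1 hr hone hfin

lemma Regular.psi_shift (h : Regular e c) (hr : 1 ≤ r) (hcov : HasCovariantGradient γ)
    (hone : ∑' l, pathProb (stepProb c fun n => e n c) (fun n => (θ n).1) (Ioc 0 t) i l = 1)
    (hfin : pointEnergy γ e r t c θ i ≠ ∞) :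
    psi γ c (epochs e c θ) t (e i c) =
      psi γ (shift (e i c) c) (fun y => epochs e c θ (y + e i c)) t 0 := by
  rw [pointEnergy] at hfin
  rw [← funext fun j => epochs_apply h.1 θ j] at hone hfin
  exact Harness.psi_shift (E := fun n => e n c) (m := epochs e c θ) h.1 h.2.1 hr hcov hone hfin

lemma Regular.psi_enorm_rpow_le (h : Regular e c) (hr : 1 ≤ r)
    (hone : ∑' l, pathProb (stepProb c fun n => e n c) (fun n => (θ n).1) (Ioc 0 t) i l = 1)
    (hfin : pointEnergy γ e r t c θ i ≠ ∞) :
    ‖psi γ c (epochs e c θ) t (e i c)‖ₑ ^ r ≤ pointEnergy γ e r t c θ i := by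
  rw [pointEnergy] at hfin ⊢
  rw [← funext fun j => epochs_apply h.1 θ j] at hone hfin ⊢
  exact Harness.psi_enorm_rpow_le (E := fun n => e n c) (m := epochs e c θ) h.1 h.2.1 hr hone hfin

lemma Regular.degree_ne_zero (h : Regular e c) {x : Space d} (hx : x ∈ c.1) : degree c x ≠ 0 := by
  obtain ⟨i, rfl⟩ := h.2.1.symm ▸ hx
  obtain ⟨z, hz⟩ := exists_neighbor hx (h.2.1 ▸ mem_range_self (i + 1) : e (i + 1) c ∈ c.1)
    (h.1.ne (Nat.lt_succ_self i).ne)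
  simp only [degree, ne_eq, ENat.toENNReal_eq_zero, encard_eq_zero]
  exact nonempty_iff_ne_empty.1 ⟨z, hz⟩

open Classical in
/-- The number of the ends `z` of the edges at the origin: one if `z` is a neighbor of the origin,
and the degree if `z` is the origin. -/
noncomputable def originWeight (c : Config (Space d)) (z : Space d) : ℝ≥0∞ :=
  (if Neighbor c 0 z then 1 else 0) + degree c 0 * if z = 0 then 1 else 0

lemma measurable_originWeight {α : Type*} [MeasurableSpace α] {g : α → Config (Space d)}
    {z : α → Space d} (hg : Measurable g) (hz : Measurable z) :
    Measurable fun a => originWeight (g a) (z a) := by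
  classical
  have h1 : Measurable fun a => if Neighbor (g a) 0 (z a) then (1 : ℝ≥0∞) else 0 :=
    Measurable.ite (measurableSet_neighbor hg measurable_const hz) measurable_const measurable_const
  have h2 : Measurable fun a => if z a = 0 then (1 : ℝ≥0∞) else 0 :=
    Measurable.ite (hz (measurableSet_singleton 0)) measurable_const measurable_const
  exact h1.add ((measurable_degree hg measurable_const).mul h2)

/-- Averaging over the epochs is available for a fixed index, while the neighbors of the origin have
random indices. Hence the sum over all indices, with weights that depend on the configuration. -/
lemma tsum_originWeight_mul {E : ℕ → Space d} (hE : Function.Injective E) (hr : range E = c.1)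
    (h0 : (0 : Space d) ∈ c.1) (F : Space d → ℝ≥0∞) :
    ∑' i, originWeight c (E i) * F (E i) = ∑' z : nbrs c 0, F z + degree c 0 * F 0 := by
  classical
  obtain ⟨k, hk⟩ := hr.symm ▸ h0
  rw [tsum_subset_config hE hr (nbrs_subset c 0)]
  simp only [originWeight, add_mul]
  rw [ENNReal.tsum_add]
  congr 1
  · refine tsum_congr fun i => ?_
    by_cases h : Neighbor c 0 (E i)
    · rw [if_pos h, one_mul, indicator_of_mem (show E i ∈ nbrs c 0 from h)]
    · rw [if_neg h, zero_mul, indicator_of_notMem (show E i ∉ nbrs c 0 from h)]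
  · rw [tsum_eq_single k]
    · rw [hk, if_pos rfl, mul_one]
    · intro i hi
      rw [if_neg, mul_zero, zero_mul]
      rw [← hk]
      exact hE.ne hi

/-- Convexity: `(a + b) ^ r ≤ 2 ^ (r - 1) * (a ^ r + b ^ r)`, with the end at the origin counted
once per edge. -/
lemma tsum_nbrs_enorm_grad_rpow_le (c : Config (Space d)) (f : Space d → ℝ) {r : ℝ} (hr : 1 ≤ r) :
    ∑' y : nbrs c 0, ‖grad c f 0 y‖ₑ ^ r ≤
      2 ^ (r - 1) * (∑' y : nbrs c 0, ‖f y‖ₑ ^ r + degree c 0 * ‖f 0‖ₑ ^ r) := by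
  rw [degree_eq_tsum, ← ENNReal.tsum_mul_right, ← ENNReal.tsum_add, ← ENNReal.tsum_mul_left]
  refine ENNReal.tsum_le_tsum fun y => ?_
  rw [grad, cond, if_pos (show Neighbor c 0 y from y.2), one_mul, one_mul]
  exact (ENNReal.rpow_le_rpow enorm_sub_le (zero_le_one.trans hr)).trans
    (ENNReal.rpow_add_le_mul_rpow_add_rpow _ _ hr)

end Deterministic

/-! ### Almost sure finiteness and the mean energy at the origin. -/

section Assembly

variable {d : ℕ} {Ω : Type*} [MeasurableSpace Ω] {μ : Measure Ω}
  {S₀ : Ω → Config (Space d)} {e : ℕ → Config (Space d) → Space d} {T : ℕ → Ω → Config ℝ}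
  {γ : Space d → Config (Space d) → ℝ} {r : ℝ}

lemma campbell_eq (S₀ : Ω → Config (Space d)) (ζ : Ω → Space d → Space d → ℝ≥0∞) :
    campbell μ S₀ ζ = 2⁻¹ * ∫⁻ ω, ∑' y : nbrs (S₀ ω) 0, ζ ω 0 y ∂μ := by
  classical
  rw [campbell]
  congr 1
  refine lintegral_congr fun ω => ?_
  rw [tsum_nbrs_eq]
  refine tsum_congr fun y => ?_
  rw [cond]
  split_ifs <;> simp

lemma campbell_slope (hγ : Measurable (Function.uncurry γ)) (hS₀ : Measurable S₀) :
    campbell μ S₀ (fun ω x y => ‖grad (S₀ ω) (fun w => γ w (S₀ ω)) x y‖ₑ ^ r) =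
      2⁻¹ * ∫⁻ c, ∑' z : nbrs c 0, slope γ r c 0 z ∂(μ.map S₀) := by
  have hm : Measurable fun c : Config (Space d) => ∑' z : nbrs c 0, slope γ r c 0 z :=
    measurable_tsum_nbrs measurable_id measurable_const (f := fun c z => slope γ r c 0 z)
      (measurable_slope hγ measurable_fst measurable_const measurable_snd)
  rw [campbell_eq, lintegral_map hm hS₀]
  rfl

variable [IsProbabilityMeasure μ] {P : Measure (Config (Space d))} [IsProbabilityMeasure P]

lemma ae_zero_mem (hS₀ : Measurable S₀) (hpalm : IsPalm P (μ.map S₀)) :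
    ∀ᵐ ω ∂μ, (0 : Space d) ∈ (S₀ ω).1 := by
  have := Measure.isProbabilityMeasure_map (μ := μ) hS₀.aemeasurable
  exact ae_of_ae_map hS₀.aemeasurable hpalm.ae_zero_mem

/-- All the points have finitely many neighbors if the origin of the Palm version does. -/
lemma ae_regular (hstat : IsStationary P) (hS₀ : Measurable S₀) (hpalm : IsPalm P (μ.map S₀))
    (hdeg : ∀ᵐ ω ∂μ, (nbrs (S₀ ω) 0).Finite)
    (henum : ∀ᵐ ω ∂μ, Function.Injective (fun n => e n (S₀ ω)) ∧
      range (fun n => e n (S₀ ω)) = (S₀ ω).1) :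
    ∀ᵐ ω ∂μ, Regular e (S₀ ω) := by
  have := Measure.isProbabilityMeasure_map (μ := μ) hS₀.aemeasurable
  have hA : MeasurableSet {c : Config (Space d) | degree c 0 < ∞} :=
    measurableSet_lt (measurable_degree measurable_id measurable_const) measurable_const
  have h1 : ∀ᵐ c ∂(μ.map S₀), c ∈ {c : Config (Space d) | degree c 0 < ∞} := by
    refine (ae_map_iff hS₀.aemeasurable hA).2 ?_
    filter_upwards [hdeg] with ω hω
    exact degree_lt_top.2 hω
  have h2 := ae_of_ae_map hS₀.aemeasurable (ae_forall_shift hstat hpalm hA h1)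
  filter_upwards [henum, h2] with ω h3 h4
  refine ⟨h3.1, h3.2, fun x hx => degree_lt_top.1 ?_⟩
  have : degree (shift x (S₀ ω)) 0 < ∞ := h4 x hx
  rwa [degree_shift, zero_add] at this

/-- The mean weighted by the degree is finite and the degree is nonzero, so the energy is finite at
the origin; `ae_forall_shift` and covariance carry this to every point. -/
lemma ae_poissonEnergy_lt_top (hstat : IsStationary P) (hS₀ : Measurable S₀)
    (hpalm : IsPalm P (μ.map S₀)) (hreg : ∀ᵐ ω ∂μ, Regular e (S₀ ω))
    (hγ : Measurable (Function.uncurry γ)) (hcov : HasCovariantGradient γ) (hr : 1 ≤ r)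
    (hfin : ∫⁻ c, ∑' z : nbrs c 0, slope γ r c 0 z ∂(μ.map S₀) < ∞) (t : ℝ≥0) :
    ∀ᵐ ω ∂μ, ∀ x ∈ (S₀ ω).1, poissonEnergy γ r t (S₀ ω) x < ∞ := by
  have := Measure.isProbabilityMeasure_map (μ := μ) hS₀.aemeasurable
  have hm : Measurable fun c : Config (Space d) => poissonEnergy γ r t c 0 :=
    (measurable_poissonEnergy hγ t).comp (measurable_id.prodMk measurable_const)
  have hA : MeasurableSet {c : Config (Space d) | poissonEnergy γ r t c 0 < ∞} :=
    measurableSet_lt hm measurable_const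
  have h1 : ∀ᵐ c ∂(μ.map S₀), degree c 0 * poissonEnergy γ r t c 0 < ∞ :=
    ae_lt_top ((measurable_degree measurable_id measurable_const).mul hm)
      ((lintegral_degree_mul_poissonEnergy_le hstat hpalm hγ hcov hr t).trans_lt
        (ENNReal.mul_lt_top hfin (poissonMoment_lt_top (zero_le_one.trans hr) t))).ne
  have h2 : ∀ᵐ c ∂(μ.map S₀), c ∈ {c : Config (Space d) | poissonEnergy γ r t c 0 < ∞} := by
    refine (ae_map_iff hS₀.aemeasurable hA).2 ?_
    filter_upwards [ae_of_ae_map hS₀.aemeasurable h1, hreg, ae_zero_mem hS₀ hpalm] with ω h3 h4 h5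
    exact ENNReal.lt_top_of_mul_ne_top_right h3.ne (h4.degree_ne_zero h5)
  filter_upwards [ae_of_ae_map hS₀.aemeasurable (ae_forall_shift hstat hpalm hA h2),
    ae_zero_mem hS₀ hpalm] with ω h3 h4 x hx
  have h5 : poissonEnergy γ r t (shift x (S₀ ω)) 0 < ∞ := h3 x hx
  rwa [poissonEnergy_shift hcov t hx (by rwa [zero_add]), zero_add] at h5

/-- The `i`-th point of an arbitrary enumeration is not typical, so no bound on its mean energy is
at hand. Truncating at the levels `K` of `poissonEnergy` makes the means finite, and the levels
exhaust almost every configuration. -/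
lemma ae_pointEnergy_ne_top (hγ : Measurable (Function.uncurry γ)) (hS₀ : Measurable S₀)
    (he : ∀ n, Measurable (e n)) (hreg : ∀ᵐ ω ∂μ, Regular e (S₀ ω))
    (hT : ∀ n, Measurable (T n)) (hpois : ∀ n, IsPoissonProcess μ (T n)) (hTindep : iIndepFun T μ)
    (hindep : IndepFun S₀ (fun ω n => T n ω) μ) (t : ℝ≥0)
    (hfin : ∀ᵐ ω ∂μ, ∀ x ∈ (S₀ ω).1, poissonEnergy γ r t (S₀ ω) x < ∞) :
    ∀ᵐ ω ∂μ, ∀ i, pointEnergy γ e r t (S₀ ω) (fun n => T n ω) i ≠ ∞ := by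
  classical
  have hm : ∀ i, Measurable fun c : Config (Space d) => poissonEnergy γ r t c (e i c) := fun i =>
    (measurable_poissonEnergy hγ t).comp (measurable_id.prodMk (he i))
  have h : ∀ i K : ℕ, ∀ᵐ ω ∂μ, poissonEnergy γ r t (S₀ ω) (e i (S₀ ω)) ≤ K →
      pointEnergy γ e r t (S₀ ω) (fun n => T n ω) i ≠ ∞ := by
    intro i K
    have hB : Measurable fun c : Config (Space d) =>
        if poissonEnergy γ r t c (e i c) ≤ K then (1 : ℝ≥0∞) else 0 :=
      Measurable.ite (measurableSet_le (hm i) measurable_const) measurable_const measurable_const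
    have h1 := lintegral_mul_pointEnergy (r := r) hγ hS₀ he hreg hT hpois hTindep hindep t i hB
    have h2 : ∫⁻ ω, (if poissonEnergy γ r t (S₀ ω) (e i (S₀ ω)) ≤ K then (1 : ℝ≥0∞) else 0) *
        poissonEnergy γ r t (S₀ ω) (e i (S₀ ω)) ∂μ ≤ ∫⁻ _, (K : ℝ≥0∞) ∂μ := by
      refine lintegral_mono fun ω => ?_
      split_ifs with hK <;> simp [hK]
    rw [← h1, lintegral_const, measure_univ, mul_one] at h2
    filter_upwards [ae_lt_top ((hB.comp hS₀).mul (measurable_pointEnergy hγ hS₀ he hT t i))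
      (h2.trans_lt (ENNReal.natCast_lt_top K)).ne] with ω h3 h4
    simp only [Function.comp_apply, if_pos h4, one_mul, Pi.mul_apply] at h3
    exact h3.ne
  filter_upwards [ae_all_iff.2 fun i => ae_all_iff.2 (h i), hfin, hreg] with ω h1 h2 h3 i
  obtain ⟨K, hK⟩ := ENNReal.exists_nat_gt (h2 _ (h3.2.1 ▸ mem_range_self i : e i (S₀ ω) ∈ _)).ne
  exact h1 i K hK.le

/-- The mean energy of the backward walks from the origin and from its neighbors. -/
lemma lintegral_tsum_originWeight_mul_pointEnergy_le (hstat : IsStationary P)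
    (hγ : Measurable (Function.uncurry γ)) (hcov : HasCovariantGradient γ) (hr : 1 ≤ r)
    (hS₀ : Measurable S₀) (hpalm : IsPalm P (μ.map S₀))
    (he : ∀ n, Measurable (e n)) (hreg : ∀ᵐ ω ∂μ, Regular e (S₀ ω))
    (hT : ∀ n, Measurable (T n)) (hpois : ∀ n, IsPoissonProcess μ (T n)) (hTindep : iIndepFun T μ)
    (hindep : IndepFun S₀ (fun ω n => T n ω) μ) (t : ℝ≥0) :
    ∫⁻ ω, ∑' i, originWeight (S₀ ω) (e i (S₀ ω)) *
        pointEnergy γ e r t (S₀ ω) (fun n => T n ω) i ∂μ ≤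
      2 * ((∫⁻ c, ∑' z : nbrs c 0, slope γ r c 0 z ∂(μ.map S₀)) * poissonMoment r t) := by
  have := Measure.isProbabilityMeasure_map (μ := μ) hS₀.aemeasurable
  have hw : ∀ i, Measurable fun c : Config (Space d) => originWeight c (e i c) := fun i =>
    measurable_originWeight measurable_id (he i)
  have hm : ∀ i, Measurable fun c : Config (Space d) => poissonEnergy γ r t c (e i c) := fun i =>
    (measurable_poissonEnergy hγ t).comp (measurable_id.prodMk (he i))
  have hm0 : Measurable fun c : Config (Space d) => degree c 0 * poissonEnergy γ r t c 0 :=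
    (measurable_degree measurable_id measurable_const).mul
      ((measurable_poissonEnergy hγ t).comp (measurable_id.prodMk measurable_const))
  have hm1 : ∀ i, AEMeasurable (fun ω => originWeight (S₀ ω) (e i (S₀ ω)) *
      pointEnergy γ e r t (S₀ ω) (fun n => T n ω) i) μ := fun i =>
    (((hw i).comp hS₀).mul (measurable_pointEnergy hγ hS₀ he hT t i)).aemeasurable
  have hm2 : ∀ i, AEMeasurable (fun ω => originWeight (S₀ ω) (e i (S₀ ω)) *
      poissonEnergy γ r t (S₀ ω) (e i (S₀ ω))) μ := fun i =>
    (((hw i).mul (hm i)).comp hS₀).aemeasurable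
  have hm3 : Measurable fun c : Config (Space d) => ∑' z : nbrs c 0, poissonEnergy γ r t c z :=
    measurable_tsum_nbrs measurable_id measurable_const
      (f := fun c z => poissonEnergy γ r t c z) (measurable_poissonEnergy hγ t)
  calc _ = ∫⁻ ω, ∑' i, originWeight (S₀ ω) (e i (S₀ ω)) *
        poissonEnergy γ r t (S₀ ω) (e i (S₀ ω)) ∂μ := by
        rw [lintegral_tsum hm1, lintegral_tsum hm2]
        exact tsum_congr fun i =>
          lintegral_mul_pointEnergy hγ hS₀ he hreg hT hpois hTindep hindep t i (hw i)
    _ = ∫⁻ ω, (∑' z : nbrs (S₀ ω) 0, poissonEnergy γ r t (S₀ ω) z) +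
        degree (S₀ ω) 0 * poissonEnergy γ r t (S₀ ω) 0 ∂μ := by
        refine lintegral_congr_ae ?_
        filter_upwards [hreg, ae_zero_mem hS₀ hpalm] with ω h1 h2
        exact tsum_originWeight_mul h1.1 h1.2.1 h2 _
    _ = ∫⁻ c, (∑' z : nbrs c 0, poissonEnergy γ r t c z) +
        degree c 0 * poissonEnergy γ r t c 0 ∂(μ.map S₀) :=
        (lintegral_map (hm3.add hm0) hS₀).symm
    -- Reversing the edges shows that the neighbors of the origin contribute as much as the origin
    -- weighted by its degree.
    _ = 2 * ∫⁻ c, degree c 0 * poissonEnergy γ r t c 0 ∂(μ.map S₀) := by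
        rw [lintegral_add_left hm3, lintegral_tsum_nbrs hstat hpalm
          (F := fun c z => poissonEnergy γ r t c z) (measurable_poissonEnergy hγ t)
          fun c x y hx hy => poissonEnergy_shift hcov t hx hy, two_mul]
    _ ≤ _ := mul_le_mul_right (lintegral_degree_mul_poissonEnergy_le hstat hpalm hγ hcov hr t) _

end Assembly

end Harness

theorem mainTheorem7 {d : ℕ} (hd : 1 ≤ d)
    -- the law of the stationary point process
    (P : Measure (Harness.Config (Harness.Space d))) [IsProbabilityMeasure P]
    (hstat : Harness.IsStationary P) (hint : Harness.HasUnitIntensity P)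
    -- its Palm version
    {Ω : Type*} [MeasurableSpace Ω] (μ : Measure Ω) [IsProbabilityMeasure μ]
    (S₀ : Ω → Harness.Config (Harness.Space d)) (hS₀ : Measurable S₀)
    (hpalm : Harness.IsPalm P (μ.map S₀)) (hdeg : Harness.HasExpMomentDegree μ S₀)
    -- a measurable enumeration of the points
    (e : ℕ → Harness.Config (Harness.Space d) → Harness.Space d) (he : ∀ n, Measurable (e n))
    (henum : ∀ᵐ ω ∂μ, Function.Injective (fun n => e n (S₀ ω)) ∧
      Set.range (fun n => e n (S₀ ω)) = (S₀ ω).1)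
    -- independent Poisson processes, independent of the points
    (T : ℕ → Ω → Harness.Config ℝ) (hT : ∀ n, Measurable (T n))
    (hpois : ∀ n, Harness.IsPoissonProcess μ (T n)) (hTindep : iIndepFun T μ)
    (hindep : IndepFun S₀ (fun ω n => T n ω) μ)
    -- the initial surface
    (γ : Harness.Space d → Harness.Config (Harness.Space d) → ℝ)
    (hγ : Measurable (Function.uncurry γ)) (hcov : Harness.HasCovariantGradient γ)
    (r : ℝ) (hr : 1 ≤ r)
    (hfin : Harness.campbell μ S₀
      (fun ω x y => ‖Harness.grad (S₀ ω) (fun w => γ w (S₀ ω)) x y‖ₑ ^ r) < ⊤)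
    (t : ℝ≥0) :
    -- almost surely the series defining the process converge and the difference of the process
    -- and its initial surface is translation invariant
    (∀ᵐ ω ∂μ, ∀ x ∈ (S₀ ω).1,
      Summable (fun y : (S₀ ω).1 =>
        (Harness.transProb (S₀ ω) (Harness.epochs e (S₀ ω) (fun n => T n ω)) t x y).toReal
          * γ y (S₀ ω)) ∧
      Harness.psi γ (S₀ ω) (Harness.epochs e (S₀ ω) (fun n => T n ω)) t x =
        Harness.psi γ (Harness.shift x (S₀ ω))
          (fun y => Harness.epochs e (S₀ ω) (fun n => T n ω) (y + x)) t 0) ∧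
    Harness.campbell μ S₀ (fun ω x y =>
        ‖Harness.grad (S₀ ω)
          (Harness.psi γ (S₀ ω) (Harness.epochs e (S₀ ω) (fun n => T n ω)) t) x y‖ₑ ^ r)
      ≤ 2 ^ r * Harness.campbell μ S₀
          (fun ω x y => ‖Harness.grad (S₀ ω) (fun w => γ w (S₀ ω)) x y‖ₑ ^ r)
          * Harness.poissonMoment r t ∧
    2 ^ r * Harness.campbell μ S₀
        (fun ω x y => ‖Harness.grad (S₀ ω) (fun w => γ w (S₀ ω)) x y‖ₑ ^ r)
        * Harness.poissonMoment r t < ⊤ := by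
  have hr0 : 0 ≤ r := zero_le_one.trans hr
  have h2r : (2 : ℝ≥0∞) ^ r < ∞ := ENNReal.rpow_lt_top_of_nonneg hr0 ENNReal.ofNat_ne_top
  have hprod := ENNReal.mul_lt_top (ENNReal.mul_lt_top h2r hfin)
    (Harness.poissonMoment_lt_top hr0 t)
  have hreg := Harness.ae_regular hstat hS₀ hpalm hdeg.1 henum
  have hone := Harness.ae_tsum_pathProb_eq_one hS₀ he hreg hT hpois hTindep hindep t
  rw [Harness.campbell_slope hγ hS₀] at hfin ⊢
  have hD : ∫⁻ c, ∑' z : Harness.nbrs c 0, Harness.slope γ r c 0 z ∂(μ.map S₀) < ∞ :=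
    ENNReal.lt_top_of_mul_ne_top_right hfin.ne (by simp)
  have hpe := Harness.ae_pointEnergy_ne_top hγ hS₀ he hreg hT hpois hTindep hindep t
    (Harness.ae_poissonEnergy_lt_top hstat hS₀ hpalm hreg hγ hcov hr hD t)
  refine ⟨?_, ?_, by rwa [Harness.campbell_slope hγ hS₀] at hprod⟩
  · filter_upwards [hreg, hone, hpe] with ω h1 h2 h3 x hx
    obtain ⟨i, rfl⟩ := h1.2.1.symm ▸ hx
    exact ⟨h1.summable_harness hr (h2 i) (h3 i), h1.psi_shift hr hcov (h2 i) (h3 i)⟩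
  · have hle : ∀ᵐ ω ∂μ, ∑' y : Harness.nbrs (S₀ ω) 0, ‖Harness.grad (S₀ ω)
        (Harness.psi γ (S₀ ω) (Harness.epochs e (S₀ ω) (fun n => T n ω)) t) 0 y‖ₑ ^ r ≤
        2 ^ (r - 1) * ∑' i, Harness.originWeight (S₀ ω) (e i (S₀ ω)) *
          Harness.pointEnergy γ e r t (S₀ ω) (fun n => T n ω) i := by
      filter_upwards [hreg, hone, hpe, Harness.ae_zero_mem hS₀ hpalm] with ω h1 h2 h3 h0
      refine (Harness.tsum_nbrs_enorm_grad_rpow_le _ _ hr).trans (mul_le_mul_right ?_ _)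
      rw [← Harness.tsum_originWeight_mul h1.1 h1.2.1 h0 fun y =>
        ‖Harness.psi γ (S₀ ω) (Harness.epochs e (S₀ ω) (fun n => T n ω)) t y‖ₑ ^ r]
      exact ENNReal.tsum_le_tsum fun i =>
        mul_le_mul_right (h1.psi_enorm_rpow_le hr (h2 i) (h3 i)) _
    rw [Harness.campbell_eq]
    -- The factor `2⁻¹` is that of `campbell` and stays on both sides; `2 ^ (r - 1)` comes from
    -- convexity and `2` from the two ends of an edge, together `2 ^ r`.
    calc _ ≤ 2⁻¹ * (2 ^ (r - 1) * (2 *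
          ((∫⁻ c, ∑' z : Harness.nbrs c 0, Harness.slope γ r c 0 z ∂(μ.map S₀)) *
            Harness.poissonMoment r t))) := by
          refine mul_le_mul_right ((lintegral_mono_ae hle).trans ?_) _
          rw [lintegral_const_mul' _ _
            (ENNReal.rpow_lt_top_of_nonneg (sub_nonneg.2 hr) ENNReal.ofNat_ne_top).ne]
          exact mul_le_mul_right (Harness.lintegral_tsum_originWeight_mul_pointEnergy_le hstat hγ
            hcov hr hS₀ hpalm he hreg hT hpois hTindep hindep t) _
      _ = _ := by
          have h2 : (2 : ℝ≥0∞) ^ r = 2 ^ (r - 1) * 2 := by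
            conv_rhs => rw [← ENNReal.rpow_one (2 : ℝ≥0∞), ← ENNReal.rpow_mul, one_mul]
            rw [← ENNReal.rpow_add _ _ two_ne_zero ENNReal.ofNat_ne_top, sub_add_cancel]
          rw [h2]
          ring
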